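/- Let $\Gamma$ be a countable discrete group, let $L(\Gamma)\subseteq B(\ell^2\Gamma)$ be its von Neumann algebra, generated by the left translation unitaries $u_\gamma$, with trace $\tau(x)=\langle x\delta_e,\delta_e\rangle$. For a subgroup $\Lambda\leq\Gamma$ let $L(\Lambda)=\{u_\lambda:\lambda\in\Lambda\}''\subseteq L(\Gamma)$. Let $N\subseteq L(\Gamma)$ be a (unital) subfactor normalized by $\Gamma$, i.e. $u_\gamma Nu_\gamma^*=N$ for all $\gamma\in\Gamma$. Then there exists a normal subgroup $\Lambda\lhd\Gamma$ such that $$N\subseteq L(\Lambda)\subseteq N\vee (N'\cap L(\Gamma)),$$ and such that, moreover, the following hold. 1. If $N'\cap L(\Gamma)$ is finite dimensional, then both inclusions $N\subseteq L(\Lambda)\subseteq N\vee (N'\cap L(\Gamma))$ have finite index; in particular, if $N'\cap L(\Gamma)=\mathbb C1$, then $N=L(\Lambda)$. 2. If $L(\Gamma)$ is solid (for every diffuse von Neumann subalgebra $A\subseteq L(\Gamma)$ the relative commutant $A'\cap L(\Gamma)$ is amenable), then either $N$ is an amenable factor or both inclusions $N\subseteq L(\Lambda)\subseteq N\vee (N'\cap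 L(\Gamma))$ have finite index. If $L(\Gamma)$ is nonamenable and strongly solid (for every diffuse amenable von Neumann subalgebra $A\subseteq L(\Gamma)$ the normalizer of $A$ in $L(\Gamma)$ generates an amenable von Neumann algebra), then either $N$ is finite dimensional or $N\subseteq L(\Lambda)\subseteq N\vee (N'\cap L(\Lambda))$ and both of these inclusions have finite index. 3. If $\Gamma$ is a simple group and $L(\Gamma)$ is a prime factor (a factor such that $L(\Gamma)=P\bar\otimes Q$ only if $P$ or $Q$ is finite dimensional), then either $N$ is finite dimensional or $N\subseteq L(\Gamma)$ has finite index. Here an inclusion $P\subseteq Q$ of von Neumann subalgebras of $L(\Gamma)$ has finite index if $Q$ admits a finite Pimsner–Popa basis over $P$: there are $m_1,\dots,m_n\in Q$ with $E_P(m_im_j^*)=\delta_{ij}p_i$ for some projections $p_i\in P$ and $x=\sum_i E_P(xm_i^*)m_i$ for all $x\in Q$, where $E_P$ is the $\tau$-preserving conditional expectation onto $P$. For subfactors this says that the Jones index $[Q:P]$ is finite. -/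

import Mathlib

namespace GroupVN

section General

variable {H : Type*} [NormedAddCommGroup H] [InnerProductSpace ℂ H] [CompleteSpace H]

/-- The von Neumann algebra generated by a set `S` of bounded operators: the double commutant of
`S ∪ S*`. -/
noncomputable def generated (S : Set (H →L[ℂ] H)) : VonNeumannAlgebra H where
  toStarSubalgebra :=
    StarSubalgebra.centralizer ℂ (StarSubalgebra.centralizer ℂ S : Set (H →L[ℂ] H))
  centralizer_centralizer' := by
    change Set.centralizer (Set.centralizer
      (StarSubalgebra.centralizer ℂ (StarSubalgebra.centralizer ℂ S : Set (H →L[ℂ] H)) :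
        Set (H →L[ℂ] H))) = (StarSubalgebra.centralizer ℂ
          (StarSubalgebra.centralizer ℂ S : Set (H →L[ℂ] H)) : Set (H →L[ℂ] H))
    simp only [StarSubalgebra.coe_centralizer_centralizer, Set.centralizer_centralizer_centralizer]

/-- `P ∨ Q`, the von Neumann algebra generated by `P` and `Q`. -/
noncomputable def join (P Q : VonNeumannAlgebra H) : VonNeumannAlgebra H :=
  generated ((P : Set (H →L[ℂ] H)) ∪ (Q : Set (H →L[ℂ] H)))

/-- The relative commutant `N' ∩ M`. -/
noncomputable def relCommutant (N M : VonNeumannAlgebra H) : VonNeumannAlgebra H where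
  toStarSubalgebra := N.commutant.toStarSubalgebra ⊓ M.toStarSubalgebra
  centralizer_centralizer' := by
    change Set.centralizer (Set.centralizer
      ((N.commutant : Set (H →L[ℂ] H)) ∩ (M : Set (H →L[ℂ] H)))) =
      (N.commutant : Set (H →L[ℂ] H)) ∩ (M : Set (H →L[ℂ] H))
    apply Set.Subset.antisymm
    · apply Set.subset_inter
      · conv_rhs => rw [← VonNeumannAlgebra.centralizer_centralizer N.commutant]
        exact Set.centralizer_subset (Set.centralizer_subset Set.inter_subset_left)
      · conv_rhs => rw [← VonNeumannAlgebra.centralizer_centralizer M]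
        exact Set.centralizer_subset (Set.centralizer_subset Set.inter_subset_right)
    · exact Set.subset_centralizer_centralizer

/-- A von Neumann algebra is a factor if its center consists of the scalars. -/
def IsFactor (M : VonNeumannAlgebra H) : Prop :=
  ∀ x ∈ M, x ∈ M.commutant → ∃ c : ℂ, x = c • (1 : H →L[ℂ] H)

/-- The von Neumann algebra `M` is finite dimensional as a complex vector space. -/
def IsFinDim (M : VonNeumannAlgebra H) : Prop :=
  FiniteDimensional ℂ M.toStarSubalgebra

/-- The von Neumann algebra `M` equals `ℂ 1`. -/
def IsTrivial (M : VonNeumannAlgebra H) : Prop :=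
  ∀ x ∈ M, ∃ c : ℂ, x = c • (1 : H →L[ℂ] H)

/-- The normalizer `{u ∈ 𝒰(M) : u A u* = A}` of `A` in `M`. -/
def normalizer (A M : VonNeumannAlgebra H) : Set (H →L[ℂ] H) :=
  {u | u ∈ M ∧ u ∈ unitary (H →L[ℂ] H) ∧
    (fun x => u * x * star u) '' (A : Set (H →L[ℂ] H)) = (A : Set (H →L[ℂ] H))}

/-- `A` is diffuse: it has no minimal projection, that is, every nonzero projection of `A` strictly
dominates some nonzero projection of `A`. -/
def IsDiffuse (A : VonNeumannAlgebra H) : Prop :=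
  ∀ p ∈ A, IsStarProjection p → p ≠ 0 →
    ∃ q ∈ A, IsStarProjection q ∧ q ≠ 0 ∧ q ≠ p ∧ p * q = q

/-- `M` is amenable (injective): there is a projection of norm one of `B(H)` onto `M`. -/
def IsAmenable (M : VonNeumannAlgebra H) : Prop :=
  ∃ E : (H →L[ℂ] H) →ₗ[ℂ] (H →L[ℂ] H),
    (∀ T, E T ∈ M) ∧ (∀ T ∈ M, E T = T) ∧ ∀ T, ‖E T‖ ≤ ‖T‖

/-- `M` is solid: every diffuse von Neumann subalgebra has amenable relative commutant. -/
def IsSolid (M : VonNeumannAlgebra H) : Prop :=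
  ∀ A : VonNeumannAlgebra H, A ≤ M → IsDiffuse A → IsAmenable (relCommutant A M)

/-- `M` is strongly solid: the normalizer of every diffuse amenable von Neumann subalgebra of `M`
generates an amenable von Neumann algebra. -/
def IsStronglySolid (M : VonNeumannAlgebra H) : Prop :=
  ∀ A : VonNeumannAlgebra H, A ≤ M → IsDiffuse A → IsAmenable A →
    IsAmenable (generated (normalizer A M))

end General

section Group

variable {Γ : Type*} [Group Γ]

/-- The Hilbert space `ℓ²(Γ)`. -/
abbrev Ell2 (Γ : Type*) : Type _ := lp (fun _ : Γ => ℂ) 2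

/-- The unitary `u_γ` of the left regular representation, `(u_γ ξ)(x) = ξ(γ⁻¹ x)`. -/
noncomputable def u (γ : Γ) : Ell2 Γ →L[ℂ] Ell2 Γ :=
  LinearIsometry.toContinuousLinearMap
    { toFun := fun ξ => ⟨fun x => ξ (γ⁻¹ * x), by
        have h := (lp.memℓp ξ).summable (by norm_num)
        exact memℓp_gen (h.comp_injective (mul_right_injective γ⁻¹))⟩
      map_add' := fun _ _ => rfl
      map_smul' := fun _ _ => rfl
      norm_map' := fun ξ => by
        have h2 : 0 < (2 : ENNReal).toReal := by norm_num
        rw [lp.norm_eq_tsum_rpow h2, lp.norm_eq_tsum_rpow h2]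
        congr 1
        exact (Equiv.mulLeft γ⁻¹).tsum_eq (fun x => ‖ξ x‖ ^ (2 : ENNReal).toReal) }

/-- `L(Λ)`, for a subgroup `Λ` of `Γ`, as a von Neumann subalgebra of `L(Γ) ⊆ B(ℓ²(Γ))`. -/
noncomputable def L (Λ : Subgroup Γ) : VonNeumannAlgebra (Ell2 Γ) :=
  generated (u '' (Λ : Set Γ))

variable (Γ) in
/-- The group von Neumann algebra `L(Γ)`. -/
noncomputable def LG : VonNeumannAlgebra (Ell2 Γ) := L (⊤ : Subgroup Γ)

open scoped Classical in
/-- The canonical trace `τ(x) = ⟨x δ_e, δ_e⟩` of `L(Γ)`. -/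
noncomputable def τ (x : Ell2 Γ →L[ℂ] Ell2 Γ) : ℂ :=
  inner ℂ (lp.single 2 (1 : Γ) (1 : ℂ) : Ell2 Γ) (x (lp.single 2 (1 : Γ) (1 : ℂ)))

/-- For `x ∈ L(Γ)` and a von Neumann subalgebra `P` of `L(Γ)`, this says `y = E_P(x)` where `E_P` is
the trace-preserving conditional expectation onto `P`. -/
def IsCondExp (P : VonNeumannAlgebra (Ell2 Γ)) (x y : Ell2 Γ →L[ℂ] Ell2 Γ) : Prop :=
  y ∈ P ∧ ∀ z ∈ P, τ (y * z) = τ (x * z)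

/-- The inclusion `P ⊆ Q` of von Neumann subalgebras of `L(Γ)` has finite index: `Q` admits a finite
Pimsner-Popa basis over `P`, i.e. there are `m₁, …, mₙ ∈ Q` with `E_P(mᵢ mⱼ*) = δᵢⱼ pᵢ` for some
projections `pᵢ`, and `x = ∑ᵢ E_P(x mᵢ*) mᵢ` for all `x ∈ Q`. -/
def HasFiniteIndex (P Q : VonNeumannAlgebra (Ell2 Γ)) : Prop :=
  P ≤ Q ∧ ∃ (n : ℕ) (m p : Fin n → (Ell2 Γ →L[ℂ] Ell2 Γ)),
    (∀ i, m i ∈ Q) ∧ (∀ i, IsStarProjection (p i)) ∧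
    (∀ i j, IsCondExp P (m i * star (m j)) (if i = j then p i else 0)) ∧
    ∀ x ∈ Q, ∃ y : Fin n → (Ell2 Γ →L[ℂ] Ell2 Γ),
      (∀ i, IsCondExp P (x * star (m i)) (y i)) ∧ x = ∑ i, y i * m i

/-- `M = P ⊗̄ Q` as tracial von Neumann algebras: `P` and `Q` are commuting von Neumann subalgebras
which generate `M`, and the trace is the product trace `τ(xy) = τ(x)τ(y)`, so that `x ⊗ y ↦ xy`
extends to a trace-preserving isomorphism of the von Neumann tensor product onto `M`. -/
def IsTensorDecomposition (M P Q : VonNeumannAlgebra (Ell2 Γ)) : Prop :=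
  (∀ x ∈ P, ∀ y ∈ Q, x * y = y * x) ∧ (∀ x ∈ P, ∀ y ∈ Q, τ (x * y) = τ x * τ y) ∧ join P Q = M

/-- `M ⊆ L(Γ)` is a prime factor: a factor such that in every tensor product decomposition
`M = P ⊗̄ Q` one of `P`, `Q` is finite dimensional. (A tensor product decomposition of a finite
factor always respects the traces.) -/
def IsPrimeFactor (M : VonNeumannAlgebra (Ell2 Γ)) : Prop :=
  IsFactor M ∧ ∀ P Q : VonNeumannAlgebra (Ell2 Γ),
    IsTensorDecomposition M P Q → IsFinDim P ∨ IsFinDim Q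

end Group

end GroupVN

/-! For γ in Γ put e = E_N(u_γ). Bimodularity of E_N gives e x = (u_γ x u_γ*) e for x in N, so e*e
and ee* are central in N, hence scalars. If e ≠ 0, a multiple of e is therefore a unitary v of N
inducing the same automorphism of N as u_γ, and v*u_γ lies in N'. Let Λ (`innerSubgroup`) consist of
the γ with u_γ in U(N)·N'; invariance of N makes it normal. If γ is outside Λ, then E_N(u_γ) = 0, so
elements of N have no coefficient at γ and N ⊆ L(Λ). For γ in Λ the two factors v and v*u_γ lie in
L(Λ), so L(Λ) = N ∨ (N' ∩ L(Λ)).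

Write B = N' ∩ L(Γ). Since N is a factor, E_N is scalar on B, so τ(bx) = τ(b)τ(x) for b in B and x
in N. Hence E_{N∨C} restricts to E_C on B for every C ⊆ B. When B is finite dimensional,
Gram-Schmidt over C gives a basis of B over C, and the same elements are a Pimsner-Popa basis of N ∨
B over N ∨ C (`hasFiniteIndex_join`). The finite-index claims follow by varying C and B. If Γ is
simple, Λ is trivial or everything; in the latter case N and B give a tensor decomposition of L(Γ),
and primeness applies.

Under solidity or strong solidity it remains to see that B is finite dimensional when N is not
amenable. If some projection p of B dominated no minimal projection of B, the relative commutant of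
Np and p would be diffuse (for Γ infinite). A diffuse abelian subalgebra A of it is amenable, its
relative commutant contains Np and lies in an amenable algebra, and independence transports
amenability from Np back to N. So B is atomic (`exists_isMinProj_le`).

Atomicity alone does not bound the dimension; the action of Γ does. If a in Λ has a finite conjugacy
class C and u_a = v w as above, then the expectation of u_a onto the centre of L(Γ) has norm at most
|τ(v)|, but it is the average of the u_b over b in C, whose norm is 1 because products from C grow
polynomially. So v is a scalar and u_a lies in B. Coefficients of the regular representation vanish
at infinity, so a minimal projection excludes infinitely many such elements; this forces the
FC-centre of Γ to be finite (`finite_fcSubgroup`). A minimal central projection of B has a finite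
Γ-orbit, since its conjugates are orthogonal with equal trace, so it is supported on the FC-centre.
Hence there are finitely many of them, each with a finite dimensional summand, and by atomicity they
sum to 1. -/

namespace GroupVN

/-! ### Bicommutants, the regular representations and the trace -/

section

section General

variable {H : Type*} [NormedAddCommGroup H] [InnerProductSpace ℂ H] [CompleteSpace H]

theorem vn_smul_mem (M : VonNeumannAlgebra H) (c : ℂ) {x : H →L[ℂ] H} (hx : x ∈ M) : c • x ∈ M :=
  M.toStarSubalgebra.smul_mem hx c

theorem mem_of_commute {M : VonNeumannAlgebra H} {x : H →L[ℂ] H}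
    (h : ∀ y ∈ M.commutant, y * x = x * y) : x ∈ M := by
  rw [← M.commutant_commutant, VonNeumannAlgebra.mem_commutant_iff]
  exact h

theorem commute_of_mem {M : VonNeumannAlgebra H} {x y : H →L[ℂ] H} (hx : x ∈ M)
    (hy : y ∈ M.commutant) : x * y = y * x :=
  VonNeumannAlgebra.mem_commutant_iff.1 hy x hx

theorem mem_relCommutant {N M : VonNeumannAlgebra H} {x : H →L[ℂ] H} :
    x ∈ relCommutant N M ↔ x ∈ M ∧ ∀ y ∈ N, y * x = x * y := by
  change x ∈ N.commutant.toStarSubalgebra ⊓ M.toStarSubalgebra ↔ _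
  rw [StarSubalgebra.mem_inf]
  change x ∈ N.commutant ∧ x ∈ M ↔ _
  rw [VonNeumannAlgebra.mem_commutant_iff, and_comm]

/-- The operators commuting with S and S* form a star-closed set, so the star condition on x in the
double centralizer is automatic. -/
theorem mem_generated {S : Set (H →L[ℂ] H)} {x : H →L[ℂ] H} :
    x ∈ generated S ↔
      ∀ y, (∀ s ∈ S, s * y = y * s ∧ star s * y = y * star s) → y * x = x * y := by
  change x ∈ StarSubalgebra.centralizer ℂ
    (StarSubalgebra.centralizer ℂ S : Set (H →L[ℂ] H)) ↔ _
  rw [StarSubalgebra.mem_centralizer_iff]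
  constructor
  · intro h y hy
    exact (h y ((StarSubalgebra.mem_centralizer_iff ℂ).2 hy)).1
  · intro h g hg
    refine ⟨h g ((StarSubalgebra.mem_centralizer_iff ℂ).1 hg), ?_⟩
    exact h _ ((StarSubalgebra.mem_centralizer_iff ℂ).1 (star_mem hg))

theorem subset_generated {S : Set (H →L[ℂ] H)} : S ⊆ (generated S : Set (H →L[ℂ] H)) :=
  fun s hs => mem_generated.2 fun _ hy => ((hy s hs).1).symm

theorem generated_le {S : Set (H →L[ℂ] H)} {M : VonNeumannAlgebra H}
    (h : S ⊆ (M : Set (H →L[ℂ] H))) : generated S ≤ M := by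
  intro x hx
  refine mem_of_commute fun y hy => mem_generated.1 hx y fun s hs => ?_
  exact ⟨commute_of_mem (h hs) hy, commute_of_mem (star_mem (h hs) : star s ∈ M) hy⟩

theorem le_join_left (P Q : VonNeumannAlgebra H) : P ≤ join P Q :=
  fun _ hx => subset_generated (Or.inl hx)

theorem le_join_right (P Q : VonNeumannAlgebra H) : Q ≤ join P Q :=
  fun _ hx => subset_generated (Or.inr hx)

theorem join_le {P Q M : VonNeumannAlgebra H} (h₁ : P ≤ M) (h₂ : Q ≤ M) : join P Q ≤ M :=
  generated_le (Set.union_subset h₁ h₂)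

theorem relCommutant_le (N M : VonNeumannAlgebra H) : relCommutant N M ≤ M :=
  fun _ hx => (mem_relCommutant.1 hx).1

theorem relCommutant_mono (N : VonNeumannAlgebra H) {P Q : VonNeumannAlgebra H}
    (h : P ≤ Q) : relCommutant N P ≤ relCommutant N Q := fun _ hx =>
  mem_relCommutant.2 ⟨h (mem_relCommutant.1 hx).1, (mem_relCommutant.1 hx).2⟩

theorem join_mono_right (N : VonNeumannAlgebra H) {P Q : VonNeumannAlgebra H}
    (h : P ≤ Q) : join N P ≤ join N Q :=
  join_le (le_join_left _ _) (h.trans (le_join_right _ _))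

/-- A closed subspace invariant under a set of operators and their adjoints is invariant under the
von Neumann algebra that they generate. -/
theorem generated_invariant {S : Set (H →L[ℂ] H)} (K : Submodule ℂ H)
    (hK : IsClosed (K : Set H)) (h₁ : ∀ s ∈ S, ∀ v ∈ K, s v ∈ K)
    (h₂ : ∀ s ∈ S, ∀ v ∈ K, star s v ∈ K) {x : H →L[ℂ] H} (hx : x ∈ generated S) {v : H}
    (hv : v ∈ K) : x v ∈ K := by
  have : CompleteSpace K := hK.completeSpace_coe
  -- An operator that leaves K invariant together with its adjoint commutes with the projection onto
  -- K; so this projection lies in the commutant and x commutes with it.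
  have key : ∀ s : H →L[ℂ] H, (∀ v ∈ K, s v ∈ K) → (∀ v ∈ K, star s v ∈ K) →
      s * K.starProjection = K.starProjection * s := by
    intro s hs hs'
    ext w
    have hw : w = K.starProjection w + (w - K.starProjection w) := by abel
    have h3 : w - K.starProjection w ∈ Kᗮ := K.sub_starProjection_mem_orthogonal w
    have h4 : s (w - K.starProjection w) ∈ Kᗮ := by
      rw [Submodule.mem_orthogonal] at h3 ⊢
      intro k hk
      rw [← ContinuousLinearMap.adjoint_inner_left, ← ContinuousLinearMap.star_eq_adjoint]
      exact h3 _ (hs' k hk)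
    have h5 : s (K.starProjection w) ∈ K := hs _ (K.starProjection_apply_mem w)
    change s (K.starProjection w) = K.starProjection (s w)
    conv_rhs => rw [hw, map_add, map_add]
    rw [Submodule.starProjection_eq_self_iff.2 h5,
      (Submodule.starProjection_apply_eq_zero_iff K).2 h4, add_zero]
  have := mem_generated.1 hx K.starProjection fun s hs =>
    ⟨key s (h₁ s hs) (h₂ s hs), key (star s) (h₂ s hs) (by simpa using h₁ s hs)⟩
  have h6 : x v = K.starProjection (x v) := by
    conv_lhs => rw [← Submodule.starProjection_eq_self_iff.2 hv]
    exact (congrArg (fun f : H →L[ℂ] H => f v) this).symm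
  rw [h6]
  exact K.starProjection_apply_mem _

/-- Whatever commutes with a commutes with f(a), so the bicommutant contains f(a). No continuity is
needed: otherwise `cfc` takes the default value 0. -/
theorem isSelfAdjoint_cfc_mem {M : VonNeumannAlgebra H} {a : H →L[ℂ] H} (ha : a ∈ M)
    (hsa : IsSelfAdjoint a) (f : ℝ → ℝ) : cfc f a ∈ M := by
  refine mem_of_commute fun y hy => ?_
  have : Commute a y := commute_of_mem ha hy
  exact ((hsa.commute_cfc this f).symm).eq

theorem inner_star_left (x : H →L[ℂ] H) (v w : H) : inner ℂ (star x v) w = inner ℂ v (x w) :=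
  ContinuousLinearMap.adjoint_inner_left x w v

theorem inner_star_right (x : H →L[ℂ] H) (v w : H) : inner ℂ v (star x w) = inner ℂ (x v) w :=
  ContinuousLinearMap.adjoint_inner_right x v w

end General

section Group

variable {Γ : Type*}

open scoped Classical in
/-- The basis vector `δ_γ` of `ℓ²(Γ)`. -/
noncomputable def delta (γ : Γ) : Ell2 Γ := lp.single 2 γ (1 : ℂ)

open scoped Classical in
theorem delta_apply (γ x : Γ) : delta γ x = if x = γ then (1 : ℂ) else 0 := by
  simp [delta, Pi.single_apply]

theorem inner_delta (γ : Γ) (ξ : Ell2 Γ) : inner ℂ (delta γ) ξ = ξ γ := by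
  classical
  rw [delta, lp.inner_single_left]
  simp

theorem ext_delta {ξ η : Ell2 Γ} (h : ∀ γ, inner ℂ (delta γ) ξ = inner ℂ (delta γ) η) : ξ = η := by
  ext γ
  simpa only [inner_delta] using h γ

theorem norm_delta (γ : Γ) : ‖delta γ‖ = 1 := by
  classical
  simp [delta, lp.norm_single]

theorem inner_delta_delta_self (γ : Γ) : inner ℂ (delta γ) (delta γ) = (1 : ℂ) := by
  rw [inner_delta, delta_apply, if_pos rfl]

theorem inner_delta_delta_ne {γ η : Γ} (h : γ ≠ η) : inner ℂ (delta γ) (delta η) = (0 : ℂ) := by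
  rw [inner_delta, delta_apply, if_neg h]

theorem ext_of_apply_delta {x y : Ell2 Γ →L[ℂ] Ell2 Γ} (h : ∀ γ : Γ, x (delta γ) = y (delta γ)) :
    x = y := by
  refine ContinuousLinearMap.ext fun ξ => ?_
  have h1 : star x = star y := by
    refine ContinuousLinearMap.ext fun ξ => ext_delta fun γ => ?_
    rw [inner_star_right, inner_star_right, h]
  rw [star_injective h1]

variable [Group Γ]

theorem tau_eq (x : Ell2 Γ →L[ℂ] Ell2 Γ) : τ x = inner ℂ (delta (1 : Γ)) (x (delta 1)) := rfl

theorem u_apply (γ : Γ) (ξ : Ell2 Γ) (x : Γ) : u γ ξ x = ξ (γ⁻¹ * x) := rfl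

theorem u_delta (γ η : Γ) : u γ (delta η) = delta (γ * η) := by
  ext x
  rw [u_apply, delta_apply, delta_apply]
  congr 1
  rw [inv_mul_eq_iff_eq_mul]

theorem u_one : u (1 : Γ) = 1 := by
  ext ξ x
  simp [u_apply]

theorem u_mul (γ η : Γ) : u (γ * η) = u γ * u η := by
  ext ξ x
  simp [u_apply, mul_assoc]

theorem norm_u_apply (γ : Γ) (ξ : Ell2 Γ) : ‖u γ ξ‖ = ‖ξ‖ := by
  have h2 : 0 < (2 : ENNReal).toReal := by norm_num
  rw [lp.norm_eq_tsum_rpow h2, lp.norm_eq_tsum_rpow h2]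
  congr 1
  exact (Equiv.mulLeft γ⁻¹).tsum_eq (fun x => ‖ξ x‖ ^ (2 : ENNReal).toReal)

theorem u_star (γ : Γ) : star (u γ) = u γ⁻¹ := by
  have h : star (u γ) * u γ = 1 := by
    rw [ContinuousLinearMap.star_eq_adjoint]
    exact (ContinuousLinearMap.norm_map_iff_adjoint_comp_self (u γ)).1 (norm_u_apply γ)
  calc star (u γ) = star (u γ) * (u γ * u γ⁻¹) := by rw [← u_mul, mul_inv_cancel, u_one, mul_one]
    _ = u γ⁻¹ := by rw [← mul_assoc, h, one_mul]

/-- The unitary `ρ_γ` of the right regular representation. -/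
noncomputable def rho (γ : Γ) : Ell2 Γ →L[ℂ] Ell2 Γ :=
  LinearIsometry.toContinuousLinearMap
    { toFun := fun ξ => ⟨fun x => ξ (x * γ), by
        have h := (lp.memℓp ξ).summable (by norm_num)
        exact memℓp_gen (h.comp_injective (mul_left_injective γ))⟩
      map_add' := fun _ _ => rfl
      map_smul' := fun _ _ => rfl
      norm_map' := fun ξ => by
        have h2 : 0 < (2 : ENNReal).toReal := by norm_num
        rw [lp.norm_eq_tsum_rpow h2, lp.norm_eq_tsum_rpow h2]
        congr 1
        exact (Equiv.mulRight γ).tsum_eq (fun x => ‖ξ x‖ ^ (2 : ENNReal).toReal) }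

theorem rho_apply (γ : Γ) (ξ : Ell2 Γ) (x : Γ) : rho γ ξ x = ξ (x * γ) := rfl

theorem inner_rho_rho (γ : Γ) (ξ η : Ell2 Γ) :
    inner ℂ (rho γ ξ) (rho γ η) = inner ℂ ξ η := by
  rw [lp.inner_eq_tsum, lp.inner_eq_tsum]
  exact (Equiv.mulRight γ).tsum_eq (fun x => inner ℂ (ξ x) (η x))

theorem rho_delta (γ η : Γ) : rho γ (delta η) = delta (η * γ⁻¹) := by
  ext x
  rw [rho_apply, delta_apply, delta_apply]
  congr 1
  rw [eq_mul_inv_iff_mul_eq]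

theorem u_mul_rho (γ η : Γ) : u γ * rho η = rho η * u γ := by
  ext ξ x
  simp [u_apply, rho_apply, mul_assoc]

theorem mem_commutant_L {Λ : Subgroup Γ} {y : Ell2 Γ →L[ℂ] Ell2 Γ}
    (h : ∀ γ ∈ Λ, u γ * y = y * u γ) {x : Ell2 Γ →L[ℂ] Ell2 Γ} (hx : x ∈ L Λ) : x * y = y * x := by
  refine (mem_generated.1 hx y ?_).symm
  rintro _ ⟨γ, hγ, rfl⟩
  exact ⟨h γ hγ, by rw [u_star]; exact h _ (Λ.inv_mem hγ)⟩

theorem u_mem_L {Λ : Subgroup Γ} {γ : Γ} (h : γ ∈ Λ) : u γ ∈ L Λ :=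
  subset_generated ⟨γ, h, rfl⟩

theorem u_mem (γ : Γ) : u γ ∈ LG Γ := u_mem_L (Subgroup.mem_top γ)

theorem L_mono {Λ Δ : Subgroup Γ} (h : Λ ≤ Δ) : L Λ ≤ L Δ := by
  refine generated_le ?_
  rintro _ ⟨γ, hγ, rfl⟩
  exact u_mem_L (h hγ)

theorem L_le (Λ : Subgroup Γ) : L Λ ≤ LG Γ := L_mono le_top

theorem rho_comm {x : Ell2 Γ →L[ℂ] Ell2 Γ} (hx : x ∈ LG Γ) (γ : Γ) (ξ : Ell2 Γ) :
    x (rho γ ξ) = rho γ (x ξ) :=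
  congrArg (fun f : Ell2 Γ →L[ℂ] Ell2 Γ => f ξ)
    (mem_commutant_L (Λ := ⊤) (fun η _ => u_mul_rho η γ) hx)

theorem apply_delta {x : Ell2 Γ →L[ℂ] Ell2 Γ} (hx : x ∈ LG Γ) (γ : Γ) :
    x (delta γ) = rho γ⁻¹ (x (delta 1)) := by
  rw [← rho_comm hx, rho_delta, one_mul, inv_inv]

/-- The vector δ_1 is separating: right translations commute with L(Γ) and carry δ_1 to every δ_γ.
-/
theorem ext_of_mem {x y : Ell2 Γ →L[ℂ] Ell2 Γ} (hx : x ∈ LG Γ) (hy : y ∈ LG Γ)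
    (h : x (delta 1) = y (delta 1)) : x = y :=
  ext_of_apply_delta fun γ => by rw [apply_delta hx, apply_delta hy, h]

theorem star_coeff {x : Ell2 Γ →L[ℂ] Ell2 Γ} (hx : x ∈ LG Γ) (γ : Γ) :
    star x (delta 1) γ = star (x (delta 1) γ⁻¹) := by
  rw [← inner_delta, inner_star_right, apply_delta hx, ← inner_delta, ← inner_conj_symm]
  rw [← inner_rho_rho γ⁻¹ (delta γ⁻¹), rho_delta]
  simp

theorem tau_mul (x y : Ell2 Γ →L[ℂ] Ell2 Γ) :
    τ (x * y) = inner ℂ (star x (delta 1)) (y (delta 1)) := by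
  rw [inner_star_left]; rfl

theorem tau_star_mul (x y : Ell2 Γ →L[ℂ] Ell2 Γ) :
    τ (star x * y) = inner ℂ (x (delta 1)) (y (delta 1)) := by
  rw [tau_mul, star_star]

/-- The substitution γ ↦ γ⁻¹ exchanges the two sums of coefficients. -/
theorem tau_comm {x y : Ell2 Γ →L[ℂ] Ell2 Γ} (hx : x ∈ LG Γ) (hy : y ∈ LG Γ) :
    τ (x * y) = τ (y * x) := by
  rw [tau_mul, tau_mul, lp.inner_eq_tsum, lp.inner_eq_tsum, ← (Equiv.inv Γ).tsum_eq]
  refine tsum_congr fun γ => ?_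
  simp [star_coeff hx, star_coeff hy, mul_comm]

theorem tau_add (x y : Ell2 Γ →L[ℂ] Ell2 Γ) : τ (x + y) = τ x + τ y := by
  simp [tau_eq]

theorem tau_sub (x y : Ell2 Γ →L[ℂ] Ell2 Γ) : τ (x - y) = τ x - τ y := by
  simp [tau_eq]

theorem tau_smul (c : ℂ) (x : Ell2 Γ →L[ℂ] Ell2 Γ) : τ (c • x) = c * τ x := by
  simp [tau_eq]

theorem tau_zero : τ (0 : Ell2 Γ →L[ℂ] Ell2 Γ) = 0 := by
  simp [tau_eq]

theorem tau_one : τ (1 : Ell2 Γ →L[ℂ] Ell2 Γ) = 1 := by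
  simp [tau_eq, norm_delta]

theorem tau_sum {ι : Type*} (s : Finset ι) (f : ι → Ell2 Γ →L[ℂ] Ell2 Γ) :
    τ (∑ i ∈ s, f i) = ∑ i ∈ s, τ (f i) := by
  simp [tau_eq]

theorem tau_star (x : Ell2 Γ →L[ℂ] Ell2 Γ) : τ (star x) = star (τ x) := by
  rw [tau_eq, inner_star_right, tau_eq]
  exact (inner_conj_symm _ _).symm

theorem tau_star_mul_self (x : Ell2 Γ →L[ℂ] Ell2 Γ) :
    τ (star x * x) = ((‖x (delta 1)‖ ^ 2 : ℝ) : ℂ) := by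
  rw [tau_star_mul, inner_self_eq_norm_sq_to_K]
  norm_cast

theorem eq_zero_of_tau {x : Ell2 Γ →L[ℂ] Ell2 Γ} (hx : x ∈ LG Γ) (h : τ (star x * x) = 0) :
    x = 0 := by
  refine ext_of_mem hx (zero_mem _) ?_
  rw [tau_star_mul] at h
  simpa using h

theorem eq_of_tau {P : VonNeumannAlgebra (Ell2 Γ)} (hP : P ≤ LG Γ) {x y : Ell2 Γ →L[ℂ] Ell2 Γ}
    (hx : x ∈ P) (hy : y ∈ P) (h : ∀ z ∈ P, τ (x * z) = τ (y * z)) : x = y := by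
  have hm : x - y ∈ P := sub_mem hx hy
  have h1 := h (star (x - y)) (star_mem hm)
  have h2 : τ ((x - y) * star (x - y)) = 0 := by rw [sub_mul, tau_sub, h1, sub_self]
  have h3 : star (x - y) = 0 :=
    eq_zero_of_tau (hP (star_mem hm)) (by rwa [star_star])
  exact sub_eq_zero.1 (star_eq_zero.1 h3)

end Group

end

/-! ### Duality between `N` and its `L¹`-norm on vectors -/

section

open Filter Topology

section General

variable {H : Type*} [NormedAddCommGroup H] [InnerProductSpace ℂ H]

theorem exists_nearest_point {K : Set H} (hne : K.Nonempty) (hc : IsComplete K)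
    (hconv : ∀ x ∈ K, ∀ y ∈ K, ∀ a b : ℝ, 0 ≤ a → 0 ≤ b → a + b = 1 →
      (a : ℂ) • x + (b : ℂ) • y ∈ K) (ξ : H) :
    ∃ v ∈ K, ∀ w ∈ K, (inner ℂ (ξ - v) (w - v)).re ≤ 0 := by
  let _ : InnerProductSpace ℝ H := InnerProductSpace.rclikeToReal ℂ H
  have hK : Convex ℝ K := by
    intro x hx y hy a b ha hb hab
    exact hconv x hx y hy a b ha hb hab
  obtain ⟨v, hv, hv'⟩ := exists_norm_eq_iInf_of_complete_convex hne hc hK ξ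
  exact ⟨v, hv, fun w hw => (norm_eq_iInf_iff_real_inner_le_zero hK hv).1 hv' w hw⟩

variable [CompleteSpace H]

/-- An approximate polar decomposition by continuous functions only: with |z| = (z*z)^{1/2}, take w
= z(|z| + ε)⁻¹ and k = (|z| + ε)^{1/2}. The last bound is k² ≤ z*w + 2ε, which holds because t/(√t +
ε) + 2ε − (√t + ε) = ε²/(√t + ε). It says that the `L¹`-norm of z is nearly attained by pairing with
the contraction w. -/
theorem exists_polar {N : VonNeumannAlgebra H} {z : H →L[ℂ] H} (hz : z ∈ N) {ε : ℝ} (hε : 0 < ε) :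
    ∃ w ∈ N, ∃ k ∈ N, IsSelfAdjoint k ∧ ‖w‖ ≤ 1 ∧ z = w * k * k ∧
      ∀ v : H, ‖k v‖ ^ 2 ≤ (inner ℂ (z v) (w v)).re + 2 * ε * ‖v‖ ^ 2 := by
  set a := star z * z with ha
  have haN : a ∈ N := mul_mem (star_mem hz) hz
  have hsa : IsSelfAdjoint a := IsSelfAdjoint.star_mul_self z
  have hpos : 0 ≤ a := star_mul_self_nonneg z
  have hspec : ∀ t ∈ spectrum ℝ a, 0 ≤ t := fun t ht => spectrum_nonneg_of_nonneg hpos ht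
  have hne : ∀ t : ℝ, Real.sqrt t + ε ≠ 0 := fun t => by positivity
  set k := cfc (fun t : ℝ => Real.sqrt (Real.sqrt t + ε)) a with hk
  set h := cfc (fun t : ℝ => (Real.sqrt t + ε)⁻¹) a with hh
  have c0 : ContinuousOn (fun t : ℝ => Real.sqrt t + ε) (spectrum ℝ a) := by fun_prop
  have c1 : ContinuousOn (fun t : ℝ => Real.sqrt (Real.sqrt t + ε)) (spectrum ℝ a) := by fun_prop
  have c2 : ContinuousOn (fun t : ℝ => (Real.sqrt t + ε)⁻¹) (spectrum ℝ a) :=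
    c0.inv₀ fun t _ => hne t
  have c3 : ContinuousOn (fun t : ℝ => t) (spectrum ℝ a) := continuousOn_id
  have c4 : ContinuousOn (fun t : ℝ => t * (Real.sqrt t + ε)⁻¹) (spectrum ℝ a) := c3.mul c2
  have c5 : ContinuousOn (fun t : ℝ => (Real.sqrt t + ε)⁻¹ * t) (spectrum ℝ a) := c2.mul c3
  have c6 : ContinuousOn (fun t : ℝ => t * (Real.sqrt t + ε)⁻¹ + 2 * ε) (spectrum ℝ a) :=
    c4.add continuousOn_const
  have hkk : k * k = cfc (fun t : ℝ => Real.sqrt t + ε) a := by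
    rw [hk, ← cfc_mul _ _ a c1 c1]
    congr 1; ext t
    exact Real.mul_self_sqrt (by positivity)
  have hhkk : h * (k * k) = 1 := by
    rw [hkk, hh, ← cfc_mul _ _ a c2 c0, ← cfc_const_one ℝ a]
    congr 1; ext t
    exact inv_mul_cancel₀ (hne t)
  have hsk : IsSelfAdjoint k := cfc_predicate _ a
  have hsh : IsSelfAdjoint h := cfc_predicate _ a
  have hkN : k ∈ N := isSelfAdjoint_cfc_mem haN hsa _
  have hhN : h ∈ N := isSelfAdjoint_cfc_mem haN hsa _
  refine ⟨z * h, mul_mem hz hhN, k, hkN, hsk, ?_, ?_, ?_⟩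
  · have h1 : star (z * h) * (z * h) = cfc (fun t : ℝ => (Real.sqrt t + ε)⁻¹ * t *
        (Real.sqrt t + ε)⁻¹) a := by
      rw [cfc_mul _ _ a c5 c2, cfc_mul _ _ a c2 c3, cfc_id' ℝ a, star_mul, hsh.star_eq, ← hh, ha]
      simp only [mul_assoc]
    have h2 : ‖star (z * h) * (z * h)‖ ≤ 1 := by
      rw [h1]
      refine norm_cfc_le zero_le_one fun t ht => ?_
      have h0 := hspec t ht
      have hs := Real.sqrt_nonneg t
      have hs2 := Real.mul_self_sqrt h0
      rw [Real.norm_of_nonneg (by positivity), mul_comm, ← mul_assoc, ← mul_inv, inv_mul_le_iff₀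
        (by positivity)]
      nlinarith [mul_nonneg hs hε.le, mul_pos hε hε]
    rw [CStarRing.norm_star_mul_self] at h2
    nlinarith [norm_nonneg (z * h)]
  · rw [mul_assoc, mul_assoc, hhkk, mul_one]
  · intro v
    have h1 : star z * (z * h) + ((2 * ε : ℝ) : ℂ) • (1 : H →L[ℂ] H) - k * k
        = ((ε ^ 2 : ℝ) : ℂ) • h := by
      rw [← mul_assoc, ← ha, hkk]
      have e1 : a * h = cfc (fun t : ℝ => t * (Real.sqrt t + ε)⁻¹) a := by
        rw [cfc_mul _ _ a c3 c2, cfc_id' ℝ a]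
      have e2 : ((2 * ε : ℝ) : ℂ) • (1 : H →L[ℂ] H) = cfc (fun _ : ℝ => 2 * ε) a := by
        rw [cfc_const _ a, Algebra.algebraMap_eq_smul_one, Complex.coe_smul]
      have e3 : ((ε ^ 2 : ℝ) : ℂ) • h = cfc (fun t : ℝ => ε ^ 2 * (Real.sqrt t + ε)⁻¹) a := by
        rw [cfc_const_mul _ _ a c2, Complex.coe_smul]
      rw [e1, e2, e3, ← cfc_add a _ _ c4 continuousOn_const, ← cfc_sub _ _ a c6 c0]
      refine cfc_congr fun t ht => ?_
      have h0 := hspec t ht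
      have hs2 := Real.mul_self_sqrt h0
      have := hne t
      field_simp
      nlinarith
    have h2 : 0 ≤ h := cfc_nonneg fun t _ => by positivity
    have h3 : 0 ≤ (inner ℂ v (h v)).re := by
      have := ((ContinuousLinearMap.nonneg_iff_isPositive h).1 h2).inner_nonneg_right v
      exact (Complex.le_def.1 this).1
    have h4 := congrArg (fun f : H →L[ℂ] H => (inner ℂ v (f v)).re) h1
    have h5 : inner ℂ v (star z (z (h v))) = inner ℂ (z v) (z (h v)) := inner_star_right _ _ _
    have h6 : inner ℂ v (k (k v)) = inner ℂ (k v) (k v) := by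
      rw [← inner_star_right, hsk.star_eq]
    simp only [sub_apply, add_apply,
      mul_apply_eq_comp, smul_apply, inner_sub_right,
      inner_add_right, inner_smul_right, one_apply_eq_self, h5, h6,
      inner_self_eq_norm_sq_to_K, Complex.sub_re, Complex.add_re, Complex.re_ofReal_mul] at h4
    simp only [Complex.coe_algebraMap, ← Complex.ofReal_pow, Complex.ofReal_re] at h4
    have h7 : 0 ≤ ε ^ 2 * (inner ℂ v (h v)).re := by positivity
    simp only [mul_apply_eq_comp]
    linarith

end General

section Group

variable {Γ : Type*}

theorem mem_of_delta_mem (K : Submodule ℂ (Ell2 Γ)) (hK : IsClosed (K : Set (Ell2 Γ)))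
    (h : ∀ γ, delta γ ∈ K) (ξ : Ell2 Γ) : ξ ∈ K := by
  classical
  have h1 := lp.hasSum_single (E := fun _ : Γ => ℂ) (p := 2) (by norm_num) ξ
  refine hK.mem_of_tendsto h1 (Eventually.of_forall fun s => K.sum_mem fun i _ => ?_)
  have : lp.single (E := fun _ : Γ => ℂ) 2 i (ξ i) = ξ i • delta i := by
    rw [delta, ← lp.single_smul]; simp
  change lp.single (E := fun _ : Γ => ℂ) 2 i (ξ i) ∈ K
  rw [this]
  exact K.smul_mem _ (h i)

/-- The vectors along which a bounded sequence is Cauchy form a closed subspace, so the basis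
vectors suffice. -/
theorem exists_limit {y : ℕ → Ell2 Γ →L[ℂ] Ell2 Γ} {c : ℝ} (hy : ∀ n, ‖y n‖ ≤ c)
    (h : ∀ γ, CauchySeq fun n => y n (delta γ)) :
    ∃ x : Ell2 Γ →L[ℂ] Ell2 Γ, ‖x‖ ≤ c ∧ ∀ ξ, Tendsto (fun n => y n ξ) atTop (𝓝 (x ξ)) := by
  have hc : 0 ≤ c := (norm_nonneg _).trans (hy 0)
  let K : Submodule ℂ (Ell2 Γ) :=
    { carrier := {ξ | CauchySeq fun n => y n ξ}
      add_mem' := fun {a b} ha hb => by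
        have := CauchySeq.add ha hb
        simpa [Pi.add_def] using this
      zero_mem' := by simpa using cauchySeq_const (0 : Ell2 Γ)
      smul_mem' := fun a ξ hξ => by
        have := (uniformContinuous_const_smul a).comp_cauchySeq (u := fun n => y n ξ) hξ
        simpa [Function.comp_def] using this }
  have hK : IsClosed (K : Set (Ell2 Γ)) := by
    refine isClosed_of_closure_subset fun ξ hξ => ?_
    change CauchySeq fun n => y n ξ
    rw [Metric.cauchySeq_iff']
    intro ε hε
    obtain ⟨η, hη, hd⟩ := Metric.mem_closure_iff.1 hξ (ε / (3 * (c + 1))) (by positivity)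
    obtain ⟨n₀, hn⟩ := Metric.cauchySeq_iff'.1 (show CauchySeq fun n => y n η from hη) (ε / 3)
      (by positivity)
    have hb : ∀ n, dist (y n ξ) (y n η) < ε / 3 := fun n => by
      rw [dist_eq_norm, ← map_sub]
      calc ‖y n (ξ - η)‖ ≤ c * ‖ξ - η‖ := (y n).le_of_opNorm_le (hy n) _
        _ ≤ (c + 1) * ‖ξ - η‖ := by gcongr; linarith
        _ < (c + 1) * (ε / (3 * (c + 1))) := by
            rw [dist_eq_norm] at hd
            gcongr
        _ = ε / 3 := by field_simp
    refine ⟨n₀, fun n hn' => ?_⟩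
    calc dist (y n ξ) (y n₀ ξ) ≤ dist (y n ξ) (y n η) + dist (y n η) (y n₀ η)
          + dist (y n₀ η) (y n₀ ξ) := dist_triangle4 _ _ _ _
      _ < ε / 3 + ε / 3 + ε / 3 := by
          have h1 := hb n
          have h2 := hn n hn'
          have h3 := hb n₀
          rw [dist_comm] at h3
          linarith
      _ = ε := by ring
  have hall : ∀ ξ, ∃ l, Tendsto (fun n => y n ξ) atTop (𝓝 l) := fun ξ =>
    cauchySeq_tendsto_of_complete (mem_of_delta_mem K hK h ξ)
  choose f hf using hall
  refine ⟨continuousLinearMapOfTendsto y (tendsto_pi_nhds.2 hf), ?_, hf⟩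
  refine ContinuousLinearMap.opNorm_le_bound _ hc fun ξ => ?_
  exact le_of_tendsto (hf ξ).norm (Eventually.of_forall fun n => (y n).le_of_opNorm_le (hy n) ξ)

variable [Group Γ]

/-- If y_n δ_1 converges, so does y_n δ_γ, being a right translate of it; a bounded sequence then
converges strongly, and strong limits stay in N and in the ball. -/
theorem isComplete_ball_apply_delta {N : VonNeumannAlgebra (Ell2 Γ)} (hN : N ≤ LG Γ) (c : ℝ) :
    IsComplete {ξ : Ell2 Γ | ∃ y ∈ N, ‖y‖ ≤ c ∧ y (delta 1) = ξ} := by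
  refine IsClosed.isComplete (IsSeqClosed.isClosed fun s ξ hs hξ => ?_)
  choose y hyN hyc hy using hs
  obtain ⟨x, hxc, hx⟩ := exists_limit hyc fun γ => by
    have h1 : (fun n => y n (delta γ)) = fun n => rho γ⁻¹ (s n) := by
      ext1 n; rw [apply_delta (hN (hyN n)), hy]
    rw [h1]
    exact (((rho γ⁻¹).continuous.tendsto ξ).comp hξ).cauchySeq
  refine ⟨x, mem_of_commute fun z hz => ?_, hxc, ?_⟩
  · ext1 η
    refine tendsto_nhds_unique ((z.continuous.tendsto _).comp (hx η)) ?_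
    refine (hx (z η)).congr fun n => ?_
    exact congrArg (fun f : Ell2 Γ →L[ℂ] Ell2 Γ => f η) (commute_of_mem (hyN n) hz)
  · refine tendsto_nhds_unique (hx (delta 1)) ?_
    simpa only [hy] using hξ

/-- A vector which is bounded with respect to the `L¹`-norm of `N` agrees, on `N`, with an element of
`N`. -/
theorem exists_mem_of_bound {N : VonNeumannAlgebra (Ell2 Γ)} (hN : N ≤ LG Γ) (ξ : Ell2 Γ) {c : ℝ}
    (hc : 0 ≤ c)
    (h : ∀ w ∈ N, ∀ k ∈ N, IsSelfAdjoint k → ‖w‖ ≤ 1 →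
      ‖inner ℂ ((w * k * k) (delta 1)) ξ‖ ≤ c * ‖k (delta 1)‖ ^ 2) :
    ∃ y ∈ N, ‖y‖ ≤ c ∧ ∀ z ∈ N, inner ℂ (z (delta 1)) ξ = inner ℂ (z (delta 1)) (y (delta 1)) := by
  -- The element y gives the point of the radius-c ball of N, applied to δ_1, nearest to ξ.
  obtain ⟨v, ⟨y, hyN, hyc, rfl⟩, hv⟩ := exists_nearest_point
    (K := {ξ : Ell2 Γ | ∃ y ∈ N, ‖y‖ ≤ c ∧ y (delta 1) = ξ}) ⟨0, 0, zero_mem N, by simpa, by simp⟩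
    (isComplete_ball_apply_delta hN c) (by
      rintro _ ⟨x, hx, hxc, rfl⟩ _ ⟨y, hy, hyc, rfl⟩ a b ha hb hab
      refine ⟨(a : ℂ) • x + (b : ℂ) • y, add_mem (vn_smul_mem N _ hx) (vn_smul_mem N _ hy), ?_, rfl⟩
      calc ‖(a : ℂ) • x + (b : ℂ) • y‖ ≤ a * ‖x‖ + b * ‖y‖ := by
            refine (norm_add_le _ _).trans_eq ?_
            rw [norm_smul, norm_smul, Complex.norm_of_nonneg ha, Complex.norm_of_nonneg hb]
        _ ≤ a * c + b * c := by gcongr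
        _ = c := by rw [← add_mul, hab, one_mul]) ξ
  refine ⟨y, hyN, hyc, ?_⟩
  set ζ := ξ - y (delta 1) with hζ
  let K₀ : Submodule ℂ (Ell2 Γ) :=
    { carrier := {η | ∃ z ∈ N, z (delta 1) = η}
      add_mem' := by
        rintro _ _ ⟨a, ha, rfl⟩ ⟨b, hb, rfl⟩
        exact ⟨a + b, add_mem ha hb, rfl⟩
      zero_mem' := ⟨0, zero_mem N, rfl⟩
      smul_mem' := by
        rintro a _ ⟨b, hb, rfl⟩
        exact ⟨a • b, vn_smul_mem N a hb, rfl⟩ }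
  let K := K₀.topologicalClosure
  have hK₀ : ∀ z ∈ N, z (delta 1) ∈ K := fun z hz => K₀.le_topologicalClosure ⟨z, hz, rfl⟩
  have : CompleteSpace K := K₀.isClosed_topologicalClosure.completeSpace_coe
  set ζ' := K.starProjection ζ with hζ'
  have hin : ∀ z ∈ N, inner ℂ (z (delta 1)) ζ = inner ℂ (z (delta 1)) ζ' := fun z hz => by
    have := (K.mem_orthogonal _).1 (K.sub_starProjection_mem_orthogonal ζ) _ (hK₀ z hz)
    rwa [inner_sub_right, sub_eq_zero] at this
  have hin' : ∀ z ∈ N, inner ℂ ζ (z (delta 1)) = inner ℂ ζ' (z (delta 1)) := fun z hz => by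
    rw [← inner_conj_symm, hin z hz, inner_conj_symm]
  suffices h0 : ζ' = 0 by
    intro z hz
    have := hin z hz
    rwa [h0, inner_zero_right, hζ, inner_sub_right, sub_eq_zero] at this
  -- ζ' is the part of ξ − yδ_1 that N can see. Approximate it by zδ_1 with z = w k k, and test the
  -- variational inequality for y against the competitor x = c w. By hypothesis x pairs with z at
  -- least as well as ξ does, up to 2cη, so ζ' is small.
  have key : ∀ η : ℝ, 0 < η → ‖ζ'‖ ^ 2 ≤ η * (4 * c + ‖ζ'‖) := by
    intro η hη
    have hmem : ζ' ∈ closure (K₀ : Set (Ell2 Γ)) := K.starProjection_apply_mem ζ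
    obtain ⟨_, ⟨z, hz, rfl⟩, hd⟩ := Metric.mem_closure_iff.1 hmem η hη
    rw [dist_eq_norm] at hd
    obtain ⟨w, hw, k, hk, hsk, hw1, hzw, hkv⟩ := exists_polar hz hη
    have h1 : (inner ℂ (z (delta 1)) ξ).re ≤ c * ((inner ℂ (z (delta 1)) (w (delta 1))).re + 2 * η) := by
      have e1 := h w hw k hk hsk hw1
      rw [← hzw] at e1
      have e2 := hkv (delta 1)
      rw [norm_delta, one_pow, mul_one] at e2
      exact ((Complex.re_le_norm _).trans e1).trans (mul_le_mul_of_nonneg_left e2 hc)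
    set x := (c : ℂ) • w with hx
    have hxN : x ∈ N := vn_smul_mem N _ hw
    have hxc : ‖x‖ ≤ c := by
      rw [hx, norm_smul, Complex.norm_of_nonneg hc]
      exact mul_le_of_le_one_right hc hw1
    have h2 := hv (x (delta 1)) ⟨x, hxN, hxc, rfl⟩
    rw [← sub_apply, hin' _ (sub_mem hxN hyN)] at h2
    have h3 : (inner ℂ (z (delta 1)) (x (delta 1))).re
        = c * (inner ℂ (z (delta 1)) (w (delta 1))).re := by
      rw [hx, smul_apply, inner_smul_right, Complex.re_ofReal_mul]
    have h4 : |(inner ℂ (ζ' - z (delta 1)) ((x - y) (delta 1))).re| ≤ η * (2 * c) := by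
      refine (Complex.abs_re_le_norm _).trans ((norm_inner_le_norm _ _).trans ?_)
      refine mul_le_mul hd.le ?_ (norm_nonneg _) hη.le
      refine ((x - y).le_opNorm _).trans ?_
      rw [norm_delta, mul_one]
      refine (norm_sub_le _ _).trans ?_
      linarith
    have h5 : |(inner ℂ (ζ' - z (delta 1)) ζ').re| ≤ η * ‖ζ'‖ := by
      refine (Complex.abs_re_le_norm _).trans ((norm_inner_le_norm _ _).trans ?_)
      gcongr
    have h6 : (inner ℂ (z (delta 1)) ζ').re = (inner ℂ (z (delta 1)) ξ).re
        - (inner ℂ (z (delta 1)) (y (delta 1))).re := by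
      rw [← hin z hz, hζ, inner_sub_right, Complex.sub_re]
    have h7 : (inner ℂ ζ' ζ').re = ‖ζ'‖ ^ 2 := by
      rw [inner_self_eq_norm_sq_to_K]; norm_cast
    simp only [inner_sub_left, inner_sub_right, sub_apply, Complex.sub_re]
      at h2 h4 h5
    rw [abs_le] at h4 h5
    nlinarith
  by_contra hne
  have hp : 0 < ‖ζ'‖ := norm_pos_iff.2 hne
  -- This η makes the right side of `key` equal to half of ‖ζ'‖².
  have := key (‖ζ'‖ ^ 2 / (2 * (4 * c + ‖ζ'‖))) (by positivity)
  have h8 : ‖ζ'‖ ^ 2 / (2 * (4 * c + ‖ζ'‖)) * (4 * c + ‖ζ'‖) = ‖ζ'‖ ^ 2 / 2 := by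
    field_simp
  rw [h8] at this
  have : 0 < ‖ζ'‖ ^ 2 := by positivity
  linarith

end Group

end

/-! ### Conditional expectations and independence of a factor from its relative commutant -/

section

variable {Γ : Type*} [Group Γ]

/-- Traciality moves one k across: the pairing of w k k with x is that of w k with x k, hence at
most ‖x‖ ‖kδ_1‖², which is the bound that produces an element of P. -/
theorem exists_isCondExp {P : VonNeumannAlgebra (Ell2 Γ)} (hP : P ≤ LG Γ)
    {x : Ell2 Γ →L[ℂ] Ell2 Γ} (hx : x ∈ LG Γ) : ∃ y, IsCondExp P x y ∧ ‖y‖ ≤ ‖x‖ := by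
  obtain ⟨y, hy, hyx, h⟩ := exists_mem_of_bound hP (x (delta 1)) (norm_nonneg x) (by
    intro w hw k hk hsk hw1
    have e : inner ℂ ((w * k * k) (delta 1)) (x (delta 1))
        = inner ℂ (w (k (delta 1))) (x (k (delta 1))) := by
      have e1 := tau_star_mul (w * k * k) x
      have e2 := tau_star_mul (w * k) (x * k)
      rw [star_mul, hsk.star_eq, mul_assoc, tau_comm (hP hk)
        (mul_mem (star_mem (mul_mem (hP hw) (hP hk))) hx), mul_assoc, e2] at e1
      exact e1.symm
    rw [e]
    refine (norm_inner_le_norm _ _).trans ?_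
    calc ‖w (k (delta 1))‖ * ‖x (k (delta 1))‖ ≤ (1 * ‖k (delta 1)‖) * (‖x‖ * ‖k (delta 1)‖) := by
          gcongr
          · exact w.le_of_opNorm_le hw1 _
          · exact x.le_opNorm _
      _ = ‖x‖ * ‖k (delta 1)‖ ^ 2 := by ring)
  refine ⟨y, ⟨hy, fun z hz => ?_⟩, hyx⟩
  rw [tau_comm (hP hy) (hP hz), tau_comm hx (hP hz), tau_mul, tau_mul, h _ (star_mem hz)]

theorem IsCondExp.unique {P : VonNeumannAlgebra (Ell2 Γ)} (hP : P ≤ LG Γ)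
    {x y z : Ell2 Γ →L[ℂ] Ell2 Γ} (hy : IsCondExp P x y) (hz : IsCondExp P x z) : y = z :=
  eq_of_tau hP hy.1 hz.1 fun a ha => (hy.2 a ha).trans (hz.2 a ha).symm

open scoped Classical in
/-- The trace-preserving conditional expectation of `L(Γ)` onto `P`. -/
noncomputable def condExp (P : VonNeumannAlgebra (Ell2 Γ)) (x : Ell2 Γ →L[ℂ] Ell2 Γ) :
    Ell2 Γ →L[ℂ] Ell2 Γ :=
  if h : ∃ y, IsCondExp P x y then h.choose else 0

section

variable {P : VonNeumannAlgebra (Ell2 Γ)} (hP : P ≤ LG Γ) {x y a : Ell2 Γ →L[ℂ] Ell2 Γ}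

include hP

theorem isCondExp_condExp (hx : x ∈ LG Γ) : IsCondExp P x (condExp P x) := by
  obtain ⟨y, hy, -⟩ := exists_isCondExp hP hx
  have h : ∃ y, IsCondExp P x y := ⟨y, hy⟩
  rw [condExp, dif_pos h]
  exact h.choose_spec

theorem condExp_eq (h : IsCondExp P x y) : condExp P x = y := by
  have h' : ∃ y, IsCondExp P x y := ⟨y, h⟩
  rw [condExp, dif_pos h']
  exact h'.choose_spec.unique hP h

theorem condExp_mem (hx : x ∈ LG Γ) : condExp P x ∈ P := (isCondExp_condExp hP hx).1

theorem tau_condExp_mul (hx : x ∈ LG Γ) (ha : a ∈ P) : τ (condExp P x * a) = τ (x * a) :=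
  (isCondExp_condExp hP hx).2 a ha

theorem tau_condExp (hx : x ∈ LG Γ) : τ (condExp P x) = τ x := by
  simpa using tau_condExp_mul hP hx (one_mem P)

theorem condExp_of_mem (hx : x ∈ P) : condExp P x = x :=
  condExp_eq hP ⟨hx, fun _ _ => rfl⟩

theorem condExp_add (hx : x ∈ LG Γ) (hy : y ∈ LG Γ) :
    condExp P (x + y) = condExp P x + condExp P y :=
  condExp_eq hP ⟨add_mem (condExp_mem hP hx) (condExp_mem hP hy), fun z hz => by
    rw [add_mul, add_mul, tau_add, tau_add, tau_condExp_mul hP hx hz, tau_condExp_mul hP hy hz]⟩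

theorem condExp_sub (hx : x ∈ LG Γ) (hy : y ∈ LG Γ) :
    condExp P (x - y) = condExp P x - condExp P y :=
  condExp_eq hP ⟨sub_mem (condExp_mem hP hx) (condExp_mem hP hy), fun z hz => by
    rw [sub_mul, sub_mul, tau_sub, tau_sub, tau_condExp_mul hP hx hz, tau_condExp_mul hP hy hz]⟩

theorem condExp_mul_right (hx : x ∈ LG Γ) (ha : a ∈ P) :
    condExp P (x * a) = condExp P x * a :=
  condExp_eq hP ⟨mul_mem (condExp_mem hP hx) ha, fun z hz => by
    rw [mul_assoc, mul_assoc, tau_condExp_mul hP hx (mul_mem ha hz)]⟩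

theorem condExp_mul_left (hx : x ∈ LG Γ) (ha : a ∈ P) :
    condExp P (a * x) = a * condExp P x :=
  condExp_eq hP ⟨mul_mem ha (condExp_mem hP hx), fun z hz => by
    rw [mul_assoc, mul_assoc, tau_comm (hP ha) (hP (mul_mem (condExp_mem hP hx) hz)),
      tau_comm (hP ha) (mul_mem hx (hP hz)), mul_assoc, mul_assoc,
      tau_condExp_mul hP hx (mul_mem hz ha)]⟩

theorem condExp_star (hx : x ∈ LG Γ) : condExp P (star x) = star (condExp P x) :=
  condExp_eq hP ⟨star_mem (condExp_mem hP hx), fun z hz => by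
    have h := tau_condExp_mul hP hx (star_mem hz)
    have e : ∀ y ∈ LG Γ, τ (star y * z) = star (τ (y * star z)) := fun y hy => by
      rw [tau_comm hy (hP (star_mem hz)), ← tau_star, star_mul, star_star]
    rw [e _ (hP (condExp_mem hP hx)), e _ hx, h]⟩

end

/-- By bimodularity the expectation of b commutes with N, so it is central, hence a scalar; the
trace identifies it. -/
theorem condExp_relCommutant {N : VonNeumannAlgebra (Ell2 Γ)} (hN : N ≤ LG Γ) (hf : IsFactor N)
    {b : Ell2 Γ →L[ℂ] Ell2 Γ} (hb : b ∈ relCommutant N (LG Γ)) : condExp N b = τ b • 1 := by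
  obtain ⟨hbM, hbc⟩ := mem_relCommutant.1 hb
  obtain ⟨c, hc⟩ := hf _ (condExp_mem hN hbM) (VonNeumannAlgebra.mem_commutant_iff.2 fun a ha => by
    rw [← condExp_mul_left hN hbM ha, hbc a ha, condExp_mul_right hN hbM ha])
  have h := tau_condExp hN hbM
  rw [hc, tau_smul, tau_one, mul_one] at h
  rw [hc, h]

/-- A factor and its relative commutant are independent with respect to the trace. -/
theorem tau_mul_of_mem_relCommutant {N : VonNeumannAlgebra (Ell2 Γ)} (hN : N ≤ LG Γ)
    (hf : IsFactor N) {b x : Ell2 Γ →L[ℂ] Ell2 Γ} (hb : b ∈ relCommutant N (LG Γ)) (hx : x ∈ N) :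
    τ (b * x) = τ b * τ x := by
  rw [← tau_condExp_mul hN (mem_relCommutant.1 hb).1 hx, condExp_relCommutant hN hf hb,
    smul_mul_assoc, one_mul, tau_smul]

end

/-! ### The normal subgroup Λ and the inclusions N ⊆ L(Λ) = N ∨ (N' ∩ L(Λ)) -/

section

variable {Γ : Type*} [Group Γ]

theorem mem_unitary_iff {R : Type*} [Monoid R] [StarMul R] {x : R} :
    x ∈ unitary R ↔ star x * x = 1 ∧ x * star x = 1 := Iff.rfl

theorem star_u_mul_u (γ : Γ) : star (u γ) * u γ = 1 := by
  rw [u_star, ← u_mul, inv_mul_cancel, u_one]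

theorem u_mul_star_u (γ : Γ) : u γ * star (u γ) = 1 := by
  rw [u_star, ← u_mul, mul_inv_cancel, u_one]

theorem u_mem_unitary (γ : Γ) : u γ ∈ unitary (Ell2 Γ →L[ℂ] Ell2 Γ) :=
  ⟨star_u_mul_u γ, u_mul_star_u γ⟩

/-- The group of all `γ` such that `u_γ = v w` for a unitary `v ∈ N` and some `w ∈ N'`. -/
noncomputable def innerSubgroup (N : VonNeumannAlgebra (Ell2 Γ)) : Subgroup Γ where
  carrier := {γ | ∃ v ∈ N, v ∈ unitary (Ell2 Γ →L[ℂ] Ell2 Γ) ∧ star v * u γ ∈ N.commutant}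
  mul_mem' := by
    rintro a b ⟨v, hv, hvu, hw⟩ ⟨v', hv', hvu', hw'⟩
    refine ⟨v * v', mul_mem hv hv', mul_mem hvu hvu', ?_⟩
    have h := commute_of_mem hv' hw
    have e : star (v * v') * u (a * b) = (star v * u a) * (star v' * u b) := by
      calc star (v * v') * u (a * b) = star v' * ((star v * u a) * (v' * star v')) * u b := by
            rw [hvu'.2, star_mul, u_mul]; simp only [mul_assoc, one_mul]
        _ = (star v' * v') * (star v * u a) * (star v' * u b) := by
            rw [← mul_assoc (star v * u a), ← h]; simp only [mul_assoc]
        _ = _ := by rw [hvu'.1, one_mul]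
    rw [e]
    exact mul_mem hw hw'
  one_mem' := ⟨1, one_mem N, one_mem _, by rw [u_one, star_one, one_mul]; exact one_mem _⟩
  inv_mem' := by
    rintro a ⟨v, hv, hvu, hw⟩
    refine ⟨star v, star_mem hv, Unitary.star_mem hvu, ?_⟩
    have h := commute_of_mem hv (star_mem hw : star (star v * u a) ∈ N.commutant)
    have e : star (star v) * u a⁻¹ = star (star v * u a) := by
      calc star (star v) * u a⁻¹ = v * star (star v * u a) * star v := by
            rw [star_mul, star_star, u_star, mul_assoc, mul_assoc, hvu.2, mul_one]
        _ = star (star v * u a) := by rw [h, mul_assoc, hvu.2, mul_one]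
    rw [e]
    exact star_mem hw

theorem mem_innerSubgroup {N : VonNeumannAlgebra (Ell2 Γ)} {γ : Γ} :
    γ ∈ innerSubgroup N ↔
      ∃ v ∈ N, v ∈ unitary (Ell2 Γ →L[ℂ] Ell2 Γ) ∧ star v * u γ ∈ N.commutant := Iff.rfl

theorem conj_mem_of_normalizer {N M : VonNeumannAlgebra (Ell2 Γ)} {γ : Γ}
    (h : u γ ∈ normalizer N M) {x : Ell2 Γ →L[ℂ] Ell2 Γ} (hx : x ∈ N) : u γ * x * u γ⁻¹ ∈ N := by
  rw [← u_star]
  have := h.2.2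
  rw [← SetLike.mem_coe, ← this]
  exact ⟨x, hx, rfl⟩

theorem conj_mem_commutant {N : VonNeumannAlgebra (Ell2 Γ)}
    (hΓ : ∀ γ : Γ, ∀ x ∈ N, u γ * x * u γ⁻¹ ∈ N) (γ : Γ) {x : Ell2 Γ →L[ℂ] Ell2 Γ}
    (hx : x ∈ N.commutant) : u γ * x * u γ⁻¹ ∈ N.commutant := by
  have h1 : u γ⁻¹ * u γ = 1 := by rw [← u_star, star_u_mul_u]
  have h2 : u γ * u γ⁻¹ = 1 := by rw [← u_star, u_mul_star_u]
  refine VonNeumannAlgebra.mem_commutant_iff.2 fun a ha => ?_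
  have h3 := hΓ γ⁻¹ a ha
  rw [inv_inv] at h3
  have h4 := commute_of_mem h3 hx
  calc a * (u γ * x * u γ⁻¹) = u γ * (u γ⁻¹ * a * u γ * x) * u γ⁻¹ := by
        simp only [← mul_assoc, h2, one_mul]
    _ = u γ * x * u γ⁻¹ * a := by
        rw [h4]; simp only [mul_assoc, h2, mul_one]

theorem innerSubgroup_normal {N : VonNeumannAlgebra (Ell2 Γ)}
    (hΓ : ∀ γ : Γ, ∀ x ∈ N, u γ * x * u γ⁻¹ ∈ N) : (innerSubgroup N).Normal := by
  refine ⟨fun a ⟨v, hv, hvu, hw⟩ γ => ?_⟩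
  have h1 : u γ⁻¹ * u γ = 1 := by rw [← u_star, star_u_mul_u]
  have hg : u γ⁻¹ ∈ unitary (Ell2 Γ →L[ℂ] Ell2 Γ) := u_mem_unitary _
  refine ⟨u γ * v * u γ⁻¹, hΓ γ v hv, mul_mem (mul_mem (u_mem_unitary γ) hvu) hg, ?_⟩
  have e : star (u γ * v * u γ⁻¹) * u (γ * a * γ⁻¹) = u γ * (star v * u a) * u γ⁻¹ := by
    rw [star_mul, star_mul, u_mul, u_mul, u_star, u_star, inv_inv]
    simp only [mul_assoc]
    rw [← mul_assoc (u γ⁻¹) (u γ), h1, one_mul]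
  rw [e]
  exact conj_mem_commutant hΓ γ hw

/-- The expectation e of u_γ intertwines the identity of N with conjugation by u_γ. This makes e*e
and ee* scalars, and rescaling e gives the unitary required in the definition of Λ. -/
theorem mem_innerSubgroup_of_condExp_ne_zero {N : VonNeumannAlgebra (Ell2 Γ)} (hN : N ≤ LG Γ)
    (hf : IsFactor N) (hΓ : ∀ γ : Γ, ∀ x ∈ N, u γ * x * u γ⁻¹ ∈ N) {γ : Γ}
    (h : condExp N (u γ) ≠ 0) : γ ∈ innerSubgroup N := by
  set e := condExp N (u γ) with he
  have heN : e ∈ N := condExp_mem hN (u_mem γ)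
  have h1 : u γ⁻¹ * u γ = 1 := by rw [← u_star, star_u_mul_u]
  have h2 : u γ * u γ⁻¹ = 1 := by rw [← u_star, u_mul_star_u]
  have hu : ∀ x, u γ * x * u γ⁻¹ * u γ = u γ * x := fun x => by rw [mul_assoc, h1, mul_one]
  have hs : ∀ x, star (u γ * x * u γ⁻¹) = u γ * star x * u γ⁻¹ := fun x => by
    rw [star_mul, star_mul, u_star, u_star, inv_inv, mul_assoc]
  have hex : ∀ x ∈ N, e * x = u γ * x * u γ⁻¹ * e := fun x hx => by
    rw [he, ← condExp_mul_right hN (u_mem γ) hx, ← condExp_mul_left hN (u_mem γ) (hΓ γ x hx), hu]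
  have hex' : ∀ x ∈ N, star e * (u γ * x * u γ⁻¹) = x * star e := fun x hx => by
    have := congrArg star (hex _ (star_mem hx))
    rw [star_mul, star_mul, star_star, hs, star_star] at this
    exact this.symm
  obtain ⟨c, hc⟩ := hf (star e * e) (mul_mem (star_mem heN) heN)
    (VonNeumannAlgebra.mem_commutant_iff.2 fun x hx => by
      rw [mul_assoc, hex x hx, ← mul_assoc, ← mul_assoc, hex' x hx])
  obtain ⟨c', hc'⟩ := hf (e * star e) (mul_mem heN (star_mem heN))
    (VonNeumannAlgebra.mem_commutant_iff.2 fun x hx => by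
      have hy := hΓ γ⁻¹ x hx
      rw [inv_inv] at hy
      have hxy : u γ * (u γ⁻¹ * x * u γ) * u γ⁻¹ = x := by
        simp only [mul_assoc, h2, mul_one]
        rw [← mul_assoc, h2, one_mul]
      have a1 := hex _ hy
      have a2 := hex' _ hy
      rw [hxy] at a1 a2
      rw [← mul_assoc, ← a1, mul_assoc e, ← a2, ← mul_assoc])
  have hτ : c = ((‖e (delta 1)‖ ^ 2 : ℝ) : ℂ) := by
    rw [← tau_star_mul_self, hc, tau_smul, tau_one, mul_one]
  -- The trace property equates the two scalars, so one rescaling makes e both an isometry and a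
  -- coisometry.
  have hτ' : c' = c := by
    have := tau_comm (hN heN) (hN (star_mem heN))
    rw [hc, hc', tau_smul, tau_smul, tau_one, mul_one, mul_one] at this
    exact this
  set r := ‖e (delta 1)‖ with hr
  have hr0 : r ≠ 0 := fun h0 => h (ext_of_mem (hN heN) (zero_mem _) (by simpa [hr] using h0))
  have hrc : (r : ℂ) ≠ 0 := by exact_mod_cast hr0
  refine ⟨((r⁻¹ : ℝ) : ℂ) • e, vn_smul_mem N _ heN, mem_unitary_iff.2 ⟨?_, ?_⟩, ?_⟩
  · rw [star_smul, smul_mul_smul_comm, hc, smul_smul, hτ]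
    simp only [Complex.star_def, Complex.conj_ofReal]
    push_cast
    field_simp
    simp
  · rw [star_smul, smul_mul_smul_comm, hc', hτ', smul_smul, hτ]
    simp only [Complex.star_def, Complex.conj_ofReal]
    push_cast
    field_simp
    simp
  · rw [star_smul, smul_mul_assoc]
    refine vn_smul_mem _ _ (VonNeumannAlgebra.mem_commutant_iff.2 fun x hx => ?_)
    rw [← mul_assoc, ← hex' x hx, mul_assoc, hu, mul_assoc]

theorem inner_delta_apply (γ : Γ) (x : Ell2 Γ →L[ℂ] Ell2 Γ) :
    inner ℂ (delta γ) (x (delta 1)) = τ (star (u γ) * x) := by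
  rw [tau_star_mul, u_delta, mul_one]

theorem coeff_eq_zero_of_mem_L {Λ : Subgroup Γ} {x : Ell2 Γ →L[ℂ] Ell2 Γ} (hx : x ∈ L Λ) {γ : Γ}
    (hγ : γ ∉ Λ) : x (delta 1) γ = 0 := by
  let K : Submodule ℂ (Ell2 Γ) :=
    { carrier := {ξ | ∀ γ ∉ Λ, inner ℂ (delta γ) ξ = 0}
      add_mem' := fun {a b} ha hb γ hγ => by rw [inner_add_right, ha γ hγ, hb γ hγ, add_zero]
      zero_mem' := fun γ _ => inner_zero_right _
      smul_mem' := fun c a ha γ hγ => by rw [inner_smul_right, ha γ hγ, mul_zero] }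
  have hK : IsClosed (K : Set (Ell2 Γ)) := by
    change IsClosed {ξ : Ell2 Γ | ∀ γ ∉ Λ, inner ℂ (delta γ) ξ = 0}
    simp only [Set.ofPred_forall]
    exact isClosed_iInter fun γ => isClosed_iInter fun _ =>
      isClosed_eq (by fun_prop) continuous_const
  have hu : ∀ η ∈ Λ, ∀ v ∈ K, u η v ∈ K := fun η hη v hv γ hγ => by
    have := hv (η⁻¹ * γ) fun h => hγ (by simpa using Λ.mul_mem hη h)
    rw [inner_delta] at this ⊢
    exact this
  have h1 : x (delta 1) ∈ K := by
    refine generated_invariant K hK ?_ ?_ hx ?_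
    · rintro _ ⟨η, hη, rfl⟩
      exact hu η hη
    · rintro _ ⟨η, hη, rfl⟩
      rw [u_star]
      exact hu _ (Λ.inv_mem hη)
    · intro γ hγ
      exact inner_delta_delta_ne fun h => hγ (h ▸ Λ.one_mem)
  rw [← inner_delta]
  exact h1 γ hγ

/-- x and its expectation onto L(Λ) have the same coefficients: on Λ the coefficient is a trace
against an element of L(Λ), and off Λ both vanish. -/
theorem mem_L_of_coeff {Λ : Subgroup Γ} {x : Ell2 Γ →L[ℂ] Ell2 Γ} (hx : x ∈ LG Γ)
    (h : ∀ γ ∉ Λ, x (delta 1) γ = 0) : x ∈ L Λ := by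
  have hy := condExp_mem (L_le Λ) hx
  suffices e : x = condExp (L Λ) x by rwa [e]
  refine ext_of_mem hx (L_le Λ hy) (ext_delta fun γ => ?_)
  by_cases hγ : γ ∈ Λ
  · have hu := star_mem (u_mem_L hγ)
    rw [inner_delta_apply, inner_delta_apply, tau_comm (L_le Λ hu) hx,
      tau_comm (L_le Λ hu) (L_le Λ hy), tau_condExp_mul (L_le Λ) hx hu]
  · rw [inner_delta, inner_delta, h γ hγ, coeff_eq_zero_of_mem_L hy hγ]

/-- The coefficient of x in N at γ is the trace of u_γ* x, which depends on u_γ only through its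
expectation onto N. -/
theorem le_L_innerSubgroup {N : VonNeumannAlgebra (Ell2 Γ)} (hN : N ≤ LG Γ)
    (hf : IsFactor N) (hΓ : ∀ γ : Γ, ∀ x ∈ N, u γ * x * u γ⁻¹ ∈ N) : N ≤ L (innerSubgroup N) := by
  intro x hx
  refine mem_L_of_coeff (hN hx) fun γ hγ => ?_
  have h0 : condExp N (u γ) = 0 := by
    by_contra h
    exact hγ (mem_innerSubgroup_of_condExp_ne_zero hN hf hΓ h)
  have h1 : τ (star x * u γ) = 0 := by
    rw [tau_comm (hN (star_mem hx)) (u_mem γ), ← tau_condExp_mul hN (u_mem γ) (star_mem hx), h0,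
      zero_mul, tau_zero]
  rw [← inner_delta, inner_delta_apply, ← star_star (star (u γ) * x), tau_star, star_mul,
    star_star, h1, star_zero]

/-- Each generator splits as u_γ = v (v*u_γ), and both factors lie in L(Λ) because N does. -/
theorem L_innerSubgroup_eq {N : VonNeumannAlgebra (Ell2 Γ)} (hN : N ≤ L (innerSubgroup N)) :
    L (innerSubgroup N) = join N (relCommutant N (L (innerSubgroup N))) := by
  refine le_antisymm (generated_le ?_) (join_le hN (relCommutant_le _ _))
  rintro _ ⟨γ, ⟨v, hv, hvu, hw⟩, rfl⟩
  have h1 : star v * u γ ∈ relCommutant N (L (innerSubgroup N)) :=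
    mem_relCommutant.2 ⟨mul_mem (star_mem (hN hv)) (u_mem_L ⟨v, hv, hvu, hw⟩),
      fun a ha => commute_of_mem ha hw⟩
  have h2 : u γ = v * (star v * u γ) := by rw [← mul_assoc, hvu.2, one_mul]
  rw [h2]
  exact mul_mem (le_join_left N _ hv) (le_join_right N _ h1)

end

/-! ### Gram-Schmidt over a finite dimensional subalgebra -/

section

section General

variable {H : Type*} [NormedAddCommGroup H] [InnerProductSpace ℂ H]

theorem closure_span_invariant {G : Set H} (s : H →L[ℂ] H) (h : ∀ g ∈ G, s g ∈ G) {v : H}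
    (hv : v ∈ (Submodule.span ℂ G).topologicalClosure) :
    s v ∈ (Submodule.span ℂ G).topologicalClosure := by
  have h1 : ∀ w ∈ Submodule.span ℂ G, s w ∈ Submodule.span ℂ G := fun w hw => by
    have : Submodule.span ℂ G ≤ (Submodule.span ℂ G).comap (s : H →ₗ[ℂ] H) :=
      Submodule.span_le.2 fun g hg => Submodule.subset_span (h g hg)
    exact this hw
  exact map_mem_closure s.continuous hv h1

variable [CompleteSpace H]

theorem finite_spectrum_of_isFinDim {B : VonNeumannAlgebra H} (hB : IsFinDim B)
    {a : H →L[ℂ] H} (ha : a ∈ B) : (spectrum ℝ a).Finite := by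
  have : FiniteDimensional ℂ B.toStarSubalgebra := hB
  have hint : IsIntegral ℂ (⟨a, ha⟩ : B.toStarSubalgebra) := IsIntegral.of_finite ℂ _
  set p := minpoly ℂ (⟨a, ha⟩ : B.toStarSubalgebra) with hp
  have hp0 : p ≠ 0 := minpoly.ne_zero hint
  have hpa : Polynomial.aeval a p = 0 := by
    have h1 := Polynomial.aeval_algHom_apply B.toStarSubalgebra.subtype
      (⟨a, ha⟩ : B.toStarSubalgebra) p
    rw [hp, minpoly.aeval, map_zero] at h1
    exact h1
  rw [← spectrum.preimage_algebraMap ℂ]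
  refine Set.Finite.preimage (RingHom.injective _).injOn (p.roots.toFinset.finite_toSet.subset ?_)
  intro t ht
  have h2 := spectrum.subset_polynomial_aeval a p ⟨t, ht, rfl⟩
  rw [hpa] at h2
  rw [Finset.mem_coe, Multiset.mem_toFinset, Polynomial.mem_roots hp0]
  cases subsingleton_or_nontrivial (H →L[ℂ] H) with
  | inl h => rw [spectrum.of_subsingleton] at h2; exact h2.elim
  | inr h => rw [spectrum.zero_eq] at h2; exact h2

/-- q is the square root of the negative part of a. The identity for a q² yields positivity of a
once a trace argument has shown q² = 0. -/
theorem exists_sqrt_negPart {P : VonNeumannAlgebra H} {a : H →L[ℂ] H} (haP : a ∈ P)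
    (hsa : IsSelfAdjoint a) : ∃ q ∈ P, IsSelfAdjoint q ∧ a * (q * q) = -((q * q) * (q * q)) ∧
      (q * q = 0 → ∀ t ∈ spectrum ℝ a, 0 ≤ t) := by
  set q := cfc (fun t : ℝ => Real.sqrt (-t)) a with hq
  have c1 : ContinuousOn (fun t : ℝ => Real.sqrt (-t)) (spectrum ℝ a) := by fun_prop
  have c2 : ContinuousOn (fun t : ℝ => t) (spectrum ℝ a) := continuousOn_id
  have c3 : ContinuousOn (fun t : ℝ => Real.sqrt (-t) * Real.sqrt (-t)) (spectrum ℝ a) := c1.mul c1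
  have hqq : q * q = cfc (fun t : ℝ => Real.sqrt (-t) * Real.sqrt (-t)) a :=
    (cfc_mul _ _ a c1 c1).symm
  refine ⟨q, isSelfAdjoint_cfc_mem haP hsa _, cfc_predicate _ a, ?_, fun h0 t ht => ?_⟩
  · rw [hqq, ← cfc_mul _ _ a c3 c3, ← cfc_neg]
    nth_rewrite 1 [← cfc_id' ℝ a]
    rw [← cfc_mul _ _ a c2 c3]
    refine cfc_congr fun s _ => ?_
    rcases le_total 0 s with h | h
    · simp [Real.sqrt_eq_zero_of_nonpos (neg_nonpos.2 h)]
    · simp only [Real.mul_self_sqrt (neg_nonneg.2 h)]; ring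
  · have h10 : Real.sqrt (-t) * Real.sqrt (-t) ∈ spectrum ℝ (q * q) := by
      rw [hqq, cfc_map_spectrum _ a hsa c3]
      exact ⟨t, ht, rfl⟩
    cases subsingleton_or_nontrivial (H →L[ℂ] H) with
    | inl h => rw [spectrum.of_subsingleton] at ht; exact ht.elim
    | inr h =>
      rw [h0, spectrum.zero_eq] at h10
      by_contra hneg
      rw [Real.mul_self_sqrt (by linarith), Set.mem_singleton_iff] at h10
      linarith

/-- A positive element with finite spectrum is invertible on its support projection. -/
theorem exists_partial_inverse {C : VonNeumannAlgebra H} {a : H →L[ℂ] H} (haC : a ∈ C)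
    (hsa : IsSelfAdjoint a) (hspec : ∀ t ∈ spectrum ℝ a, 0 ≤ t) (hfin : (spectrum ℝ a).Finite) :
    ∃ k ∈ C, IsSelfAdjoint k ∧ ∃ r ∈ C, IsStarProjection r ∧ k * a * k = r ∧ a * k * k = r ∧
      a * (1 - r) = 0 := by
  have hc : ∀ f : ℝ → ℝ, ContinuousOn f (spectrum ℝ a) := fun f => hfin.continuousOn f
  -- On a finite spectrum every function is continuous. Since 0⁻¹ = 0, k is the inverse square root
  -- of a on its support and 0 elsewhere, and r is the support projection.
  set k := cfc (fun t : ℝ => (Real.sqrt t)⁻¹) a with hk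
  set r := cfc (fun t : ℝ => t * (t)⁻¹) a with hr
  have hsq : ∀ t ∈ spectrum ℝ a, (Real.sqrt t)⁻¹ * (Real.sqrt t)⁻¹ = t⁻¹ := fun t ht => by
    rw [← mul_inv, Real.mul_self_sqrt (hspec t ht)]
  have hak : a * k = cfc (fun t : ℝ => t * (Real.sqrt t)⁻¹) a := by
    rw [hk]
    nth_rewrite 1 [← cfc_id' ℝ a]
    rw [← cfc_mul _ _ a (hc _) (hc _)]
  refine ⟨k, isSelfAdjoint_cfc_mem haC hsa _, cfc_predicate _ a, r,
    isSelfAdjoint_cfc_mem haC hsa _, ⟨?_, cfc_predicate _ a⟩, ?_, ?_, ?_⟩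
  · rw [IsIdempotentElem, hr, ← cfc_mul _ _ a (hc _) (hc _)]
    refine cfc_congr fun t _ => ?_
    by_cases h : t = 0
    · simp [h]
    · simp [h]
  · rw [mul_assoc, hak, hk, ← cfc_mul _ _ a (hc _) (hc _)]
    refine cfc_congr fun t ht => ?_
    rw [mul_left_comm, hsq t ht]
  · rw [hak, hk, ← cfc_mul _ _ a (hc _) (hc _)]
    exact cfc_congr fun t ht => by simp only [mul_assoc, hsq t ht]
  · rw [mul_sub, mul_one, sub_eq_zero, hr]
    nth_rewrite 2 [← cfc_id' ℝ a]
    rw [← cfc_mul _ _ a (hc _) (hc _)]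
    conv_lhs => rw [← cfc_id' ℝ a]
    refine cfc_congr fun t _ => ?_
    by_cases h : t = 0
    · simp [h]
    · simp [h]

end General

variable {Γ : Type*} [Group Γ]

/-- As C and N commute, the vectors (c n)δ_1 form a set stable under both algebras; its closed span
contains δ_1, so it contains (N ∨ C)δ_1. -/
theorem tau_eq_zero_of_mem_join {N C : VonNeumannAlgebra (Ell2 Γ)}
    (hC : C ≤ relCommutant N (LG Γ)) {y : Ell2 Γ →L[ℂ] Ell2 Γ}
    (h : ∀ c ∈ C, ∀ n ∈ N, τ (y * (c * n)) = 0) {z : Ell2 Γ →L[ℂ] Ell2 Γ} (hz : z ∈ join N C) :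
    τ (y * z) = 0 := by
  have hcomm : ∀ c ∈ C, ∀ n ∈ N, n * c = c * n := fun c hc n hn =>
    (mem_relCommutant.1 (hC hc)).2 n hn
  let G : Set (Ell2 Γ) := {ξ | ∃ c ∈ C, ∃ n ∈ N, ξ = (c * n) (delta 1)}
  have hG : ∀ s ∈ (N : Set (Ell2 Γ →L[ℂ] Ell2 Γ)) ∪ C, ∀ g ∈ G, s g ∈ G := by
    rintro s (hs | hs) _ ⟨c, hc, n, hn, rfl⟩
    · refine ⟨c, hc, s * n, mul_mem hs hn, ?_⟩
      rw [← mul_assoc, ← hcomm c hc s hs, mul_assoc]; rfl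
    · refine ⟨s * c, mul_mem hs hc, n, hn, ?_⟩
      rw [mul_assoc]; rfl
  have hstar : ∀ s ∈ (N : Set (Ell2 Γ →L[ℂ] Ell2 Γ)) ∪ C,
      star s ∈ (N : Set (Ell2 Γ →L[ℂ] Ell2 Γ)) ∪ C := by
    rintro s (hs | hs)
    · exact Or.inl (star_mem hs : star s ∈ N)
    · exact Or.inr (star_mem hs : star s ∈ C)
  have h1 : z (delta 1) ∈ (Submodule.span ℂ G).topologicalClosure := by
    refine generated_invariant _ (Submodule.isClosed_topologicalClosure _) ?_ ?_ hz ?_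
    · exact fun s hs v hv => closure_span_invariant s (hG s hs) hv
    · exact fun s hs v hv => closure_span_invariant _ (hG _ (hstar s hs)) hv
    · exact Submodule.le_topologicalClosure _
        (Submodule.subset_span ⟨1, one_mem C, 1, one_mem N, by simp⟩)
  have h2 : (Submodule.span ℂ G).topologicalClosure
      ≤ LinearMap.ker (innerSL ℂ (star y (delta 1)) : Ell2 Γ →L[ℂ] ℂ).toLinearMap := by
    refine Submodule.topologicalClosure_minimal _ (Submodule.span_le.2 ?_)
      (ContinuousLinearMap.isClosed_ker (innerSL ℂ (star y (delta 1))))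
    rintro _ ⟨c, hc, n, hn, rfl⟩
    change inner ℂ (star y (delta 1)) ((c * n) (delta 1)) = 0
    rw [← tau_mul]
    exact h c hc n hn
  rw [tau_mul]
  exact h2 h1

/-- Let q² be the negative part of the expectation a of xx*. Then τ(a q²) equals ‖x*qδ_1‖² and also
−‖q²δ_1‖², so q² = 0. -/
theorem nonneg_of_mem_spectrum_condExp {P : VonNeumannAlgebra (Ell2 Γ)} (hP : P ≤ LG Γ)
    {x : Ell2 Γ →L[ℂ] Ell2 Γ} (hx : x ∈ LG Γ) {t : ℝ}
    (ht : t ∈ spectrum ℝ (condExp P (x * star x))) : 0 ≤ t := by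
  have hxx : x * star x ∈ LG Γ := mul_mem hx (star_mem hx)
  set a := condExp P (x * star x) with ha
  have haP : a ∈ P := condExp_mem hP hxx
  have hsa : IsSelfAdjoint a := by
    rw [IsSelfAdjoint, ha, ← condExp_star hP hxx, star_mul, star_star]
  obtain ⟨q, hqP, hsq, h1, hsp⟩ := exists_sqrt_negPart haP hsa
  have h2 : τ (a * (q * q)) = ((‖(star x * q) (delta 1)‖ ^ 2 : ℝ) : ℂ) := by
    rw [ha, tau_condExp_mul hP hxx (mul_mem hqP hqP), ← tau_star_mul_self, star_mul, star_star,
      hsq.star_eq, ← mul_assoc, tau_comm (mul_mem hxx (hP hqP)) (hP hqP)]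
    simp only [mul_assoc]
  have h3 : τ ((q * q) * (q * q)) = ((‖(q * q) (delta 1)‖ ^ 2 : ℝ) : ℂ) := by
    rw [← tau_star_mul_self, star_mul, hsq.star_eq]
  have h4 : ‖(q * q) (delta 1)‖ ^ 2 = 0 := by
    have h5 : τ (-((q * q) * (q * q))) = -τ ((q * q) * (q * q)) := by
      rw [← zero_sub, tau_sub, tau_zero, zero_sub]
    rw [h1, h5, h3] at h2
    have h6 : -(‖(q * q) (delta 1)‖ ^ 2) = ‖(star x * q) (delta 1)‖ ^ 2 := by exact_mod_cast h2
    have h7 := sq_nonneg ‖(star x * q) (delta 1)‖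
    have h8 := sq_nonneg ‖(q * q) (delta 1)‖
    linarith
  have h9 : q * q = 0 := ext_of_mem (hP (mul_mem hqP hqP)) (zero_mem _) (by simpa using h4)
  exact hsp h9 t ht

/-- The hypothesis gives (1 − r)mm*(1 − r) trace zero, and the trace is faithful. -/
theorem eq_mul_of_condExp_mul_star {P : VonNeumannAlgebra (Ell2 Γ)} (hP : P ≤ LG Γ)
    {m r : Ell2 Γ →L[ℂ] Ell2 Γ} (hm : m ∈ LG Γ) (hr : r ∈ P) (hrs : IsSelfAdjoint r)
    (h : condExp P (m * star m) * (1 - r) = 0) : r * m = m := by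
  have hmm : m * star m ∈ LG Γ := mul_mem hm (star_mem hm)
  have h1r : 1 - r ∈ P := sub_mem (one_mem P) hr
  have hsr : star (1 - r) = 1 - r := by rw [star_sub, star_one, hrs.star_eq]
  have h1 : star ((1 - r) * m) = 0 := by
    refine eq_zero_of_tau (star_mem (mul_mem (hP h1r) hm)) ?_
    have e : star (star ((1 - r) * m)) * star ((1 - r) * m)
        = (1 - r) * (m * star m * (1 - r)) := by
      rw [star_star, star_mul, hsr]; simp only [mul_assoc]
    rw [e, tau_comm (hP h1r) (mul_mem hmm (hP h1r)), mul_assoc,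
      ← tau_condExp_mul hP hmm (mul_mem h1r h1r), ← mul_assoc, h, zero_mul, tau_zero]
  have h2 := star_eq_zero.1 h1
  rw [sub_mul, one_mul, sub_eq_zero] at h2
  exact h2.symm

/-- Normalization of one element in the Gram-Schmidt process over a finite dimensional algebra. -/
theorem exists_normalize {C : VonNeumannAlgebra (Ell2 Γ)} (hC : C ≤ LG Γ) (hfd : IsFinDim C)
    {x : Ell2 Γ →L[ℂ] Ell2 Γ} (hx : x ∈ LG Γ) :
    ∃ k ∈ C, IsSelfAdjoint k ∧ ∃ r ∈ C, IsStarProjection r ∧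
      k * condExp C (x * star x) * k = r ∧ condExp C (x * star x) * k * k * x = x := by
  have hxx : x * star x ∈ LG Γ := mul_mem hx (star_mem hx)
  have hspec : ∀ t ∈ spectrum ℝ (condExp C (x * star x)), 0 ≤ t := fun t ht =>
    nonneg_of_mem_spectrum_condExp hC hx ht
  set a := condExp C (x * star x) with ha
  have haC : a ∈ C := condExp_mem hC hxx
  have hsa : IsSelfAdjoint a := by
    rw [IsSelfAdjoint, ha, ← condExp_star hC hxx, star_mul, star_star]
  have hfin := finite_spectrum_of_isFinDim hfd haC
  obtain ⟨k, hk, hsk, r, hr, hrp, h1, h2, h3⟩ := exists_partial_inverse haC hsa hspec hfin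
  refine ⟨k, hk, hsk, r, hr, hrp, h1, ?_⟩
  rw [h2]
  exact eq_mul_of_condExp_mul_star hC hx hr hrp.isSelfAdjoint h3

/-- Gram-Schmidt for the C-valued inner product E_C(x y*). Each new vector loses its component along
the old ones and is normalized by a partial inverse square root; its length is then a projection of
C rather than 1. -/
theorem exists_orthogonal_family {C B : VonNeumannAlgebra (Ell2 Γ)} (hB : B ≤ LG Γ) (hCB : C ≤ B)
    (hfd : IsFinDim C) (l : List (Ell2 Γ →L[ℂ] Ell2 Γ)) (hl : ∀ x ∈ l, x ∈ B) :
    ∃ (n : ℕ) (m p : Fin n → (Ell2 Γ →L[ℂ] Ell2 Γ)), (∀ i, m i ∈ B) ∧ (∀ i, p i ∈ C) ∧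
      (∀ i, IsStarProjection (p i)) ∧
      (∀ i j, condExp C (m i * star (m j)) = if i = j then p i else 0) ∧
      ∀ x ∈ l, x = ∑ i, condExp C (x * star (m i)) * m i := by
  have hC : C ≤ LG Γ := hCB.trans hB
  induction l with
  | nil => exact ⟨0, Fin.elim0, Fin.elim0, by simp, by simp, by simp, by simp, by simp⟩
  | cons x l ih =>
    obtain ⟨n, m, p, hm, hp, hpp, horth, hrep⟩ := ih fun y hy => hl y (List.mem_cons_of_mem _ hy)
    have hxB : x ∈ B := hl x List.mem_cons_self
    have hcm : ∀ y ∈ B, ∀ i, y * star (m i) ∈ LG Γ := fun y hy i =>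
      hB (mul_mem hy (star_mem (hm i)))
    have hpm : ∀ i, p i * m i = m i := fun i => by
      refine eq_mul_of_condExp_mul_star hC (hB (hm i)) (hp i) (hpp i).isSelfAdjoint ?_
      rw [horth, if_pos rfl, mul_sub, mul_one, (hpp i).isIdempotentElem, sub_self]
    set s := ∑ i, condExp C (x * star (m i)) * m i with hs
    have hsB : s ∈ B := sum_mem fun i _ => mul_mem (hCB (condExp_mem hC (hcm x hxB i))) (hm i)
    have hEsum : ∀ (y : Ell2 Γ →L[ℂ] Ell2 Γ), y ∈ LG Γ → ∀ c : Fin n → (Ell2 Γ →L[ℂ] Ell2 Γ),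
        (∀ i, c i ∈ C) → condExp C ((∑ i, c i * m i) * y) = ∑ i, c i * condExp C (m i * y) := by
      intro y hy c hc
      have : ∀ t : Finset (Fin n), condExp C ((∑ i ∈ t, c i * m i) * y)
          = ∑ i ∈ t, c i * condExp C (m i * y) := by
        intro t
        induction t using Finset.induction_on with
        | empty => simpa using condExp_of_mem hC (zero_mem C)
        | insert i t hi iht =>
          rw [Finset.sum_insert hi, Finset.sum_insert hi, add_mul, condExp_add hC, iht, mul_assoc,
            condExp_mul_left hC (mul_mem (hB (hm i)) hy) (hc i)]
          · exact mul_mem (mul_mem (hC (hc i)) (hB (hm i))) hy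
          · exact mul_mem (sum_mem fun j _ => mul_mem (hC (hc j)) (hB (hm j))) hy
      exact this Finset.univ
    have hx' : ∀ j, condExp C ((x - s) * star (m j)) = 0 := fun j => by
      rw [sub_mul, condExp_sub hC (hcm x hxB j) (hcm s hsB j), hs,
        hEsum _ (star_mem (hB (hm j))) _ fun i => condExp_mem hC (hcm x hxB i)]
      simp only [horth, mul_ite, mul_zero, Finset.sum_ite_eq', Finset.mem_univ, if_true]
      rw [← condExp_mul_right hC (hcm x hxB j) (hp j), sub_eq_zero]
      nth_rewrite 1 [← hpm j]
      rw [star_mul, (hpp j).isSelfAdjoint.star_eq, mul_assoc]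
    -- The remainder, orthogonal to all m_j; its normalization k x' is put in front of the family.
    set x' := x - s with hx'def
    have hx'B : x' ∈ B := sub_mem hxB hsB
    obtain ⟨k, hk, hsk, r, hr, hrp, hkr, hrx⟩ := exists_normalize hC hfd (hB hx'B)
    have hkx : k * x' ∈ B := mul_mem (hCB hk) hx'B
    have e1 : ∀ j, condExp C (k * x' * star (m j)) = 0 := fun j => by
      rw [mul_assoc, condExp_mul_left hC (hcm x' hx'B j) hk, hx', mul_zero]
    have e2 : ∀ j, condExp C (m j * star (k * x')) = 0 := fun j => by
      have := congrArg star (e1 j)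
      rw [← condExp_star hC (hcm _ hkx j), star_mul, star_star, star_zero] at this
      exact this
    have e3 : ∀ y ∈ B, y = ∑ i, condExp C (y * star (m i)) * m i →
        condExp C (y * star (k * x')) = 0 := fun y hy hrep => by
      rw [hrep, hEsum _ (star_mem (hB hkx)) _ fun i => condExp_mem hC (hcm y hy i)]
      simp only [e2, mul_zero, Finset.sum_const_zero]
    refine ⟨n + 1, Fin.cons (k * x') m, Fin.cons r p, ?_, ?_, ?_, ?_, ?_⟩
    · exact Fin.cases hkx hm
    · exact Fin.cases hr hp
    · exact Fin.cases hrp hpp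
    · intro i j
      refine Fin.cases ?_ (fun i => ?_) i <;> refine Fin.cases ?_ (fun j => ?_) j
      · simp only [Fin.cons_zero, if_true]
        rw [star_mul, hsk.star_eq, ← hkr]
        have : k * x' * (star x' * k) = k * (x' * star x' * k) := by simp only [mul_assoc]
        have hxx : x' * star x' ∈ LG Γ := hB (mul_mem hx'B (star_mem hx'B))
        rw [this, condExp_mul_left hC (mul_mem hxx (hC hk)) hk, condExp_mul_right hC hxx hk,
          mul_assoc]
      · simp [-star_mul, e1, (Fin.succ_ne_zero _).symm]
      · simp [-star_mul, e2]
      · simp [horth]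
    · intro y hy
      rw [Fin.sum_univ_succ]
      simp only [Fin.cons_zero, Fin.cons_succ]
      rcases List.mem_cons.1 hy with rfl | hy
      -- For the new element, only the component x' contributes to the new coefficient; the old
      -- terms recombine to s.
      · have h1 : condExp C (y * star (k * x')) = condExp C (x' * star x') * k := by
          have h2 : y = x' + s := by rw [hx'def]; abel
          have h3 : condExp C (s * star (k * x')) = 0 := by
            rw [hs, hEsum _ (star_mem (hB hkx)) _ fun i => condExp_mem hC (hcm y hxB i)]
            simp only [e2, mul_zero, Finset.sum_const_zero]
          have hxx : x' * star x' ∈ LG Γ := hB (mul_mem hx'B (star_mem hx'B))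
          conv_lhs => rw [h2]
          rw [add_mul, condExp_add hC (hB (mul_mem hx'B (star_mem hkx)))
            (hB (mul_mem hsB (star_mem hkx))), h3, add_zero, star_mul, hsk.star_eq, ← mul_assoc,
            condExp_mul_right hC hxx hk]
        rw [h1, ← mul_assoc, hrx, hx'def, ← hs]
        abel
      · have hyB := hl y (List.mem_cons_of_mem _ hy)
        rw [e3 y hyB (hrep y hy), zero_mul, zero_add]
        exact hrep y hy

end

/-! ### Finite index of N ∨ C ⊆ N ∨ B -/

section

section General

variable {H : Type*} [NormedAddCommGroup H] [InnerProductSpace ℂ H] [CompleteSpace H]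

theorem isFinDim_of_subset (M : VonNeumannAlgebra H) (W : Submodule ℂ (H →L[ℂ] H))
    [FiniteDimensional ℂ W] (h : ∀ x ∈ M, x ∈ W) : IsFinDim M := by
  let f : M.toStarSubalgebra →ₗ[ℂ] W :=
    { toFun := fun x => ⟨x.1, h x.1 x.2⟩
      map_add' := fun _ _ => rfl
      map_smul' := fun _ _ => rfl }
  exact FiniteDimensional.of_injective f fun x y hxy =>
    Subtype.ext (congrArg (fun z : W => z.1) hxy)

theorem isFinDim_of_le {C B : VonNeumannAlgebra H} (h : C ≤ B) (hB : IsFinDim B) : IsFinDim C := by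
  have : FiniteDimensional ℂ B.toStarSubalgebra := hB
  let f : C.toStarSubalgebra →ₗ[ℂ] B.toStarSubalgebra :=
    { toFun := fun x => ⟨x.1, h x.2⟩
      map_add' := fun _ _ => rfl
      map_smul' := fun _ _ => rfl }
  exact FiniteDimensional.of_injective f fun x y hxy =>
    Subtype.ext (congrArg (fun z : B.toStarSubalgebra => z.1) hxy)

theorem exists_spanning_list {B : VonNeumannAlgebra H} (hB : IsFinDim B) :
    ∃ l : List (H →L[ℂ] H), (∀ x ∈ l, x ∈ B) ∧
      ∀ x ∈ B, x ∈ Submodule.span ℂ {y | y ∈ l} := by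
  classical
  have : FiniteDimensional ℂ B.toStarSubalgebra := hB
  obtain ⟨S, hS⟩ := (Module.Finite.fg_top : (⊤ : Submodule ℂ B.toStarSubalgebra).FG)
  refine ⟨(S.image Subtype.val).toList, fun x hx => ?_, fun x hx => ?_⟩
  · rw [Finset.mem_toList, Finset.mem_image] at hx
    obtain ⟨y, -, rfl⟩ := hx
    exact y.2
  · have h1 : (⟨x, hx⟩ : B.toStarSubalgebra) ∈ Submodule.span ℂ (S : Set B.toStarSubalgebra) :=
      hS ▸ Submodule.mem_top
    have h2 := Submodule.mem_map_of_mem (f := B.toStarSubalgebra.subtype.toAlgHom.toLinearMap) h1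
    rw [Submodule.map_span] at h2
    refine Submodule.span_mono ?_ h2
    rintro _ ⟨y, hy, rfl⟩
    exact Finset.mem_toList.2 (Finset.mem_image_of_mem _ hy)

theorem join_relCommutant_self {N : VonNeumannAlgebra H} :
    join N (relCommutant N N) = N :=
  le_antisymm (join_le le_rfl (relCommutant_le N N)) (le_join_left _ _)

end General

variable {Γ : Type*} [Group Γ]

/-- Tested against c n with c in C and n in N, independence splits off τ(n) and leaves a trace over
C, where E_C(b) and b agree. -/
theorem isCondExp_join {N C : VonNeumannAlgebra (Ell2 Γ)} (hN : N ≤ LG Γ) (hf : IsFactor N)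
    (hC : C ≤ relCommutant N (LG Γ)) {b : Ell2 Γ →L[ℂ] Ell2 Γ}
    (hb : b ∈ relCommutant N (LG Γ)) : IsCondExp (join N C) b (condExp C b) := by
  have hCM : C ≤ LG Γ := hC.trans (relCommutant_le _ _)
  have hbM : b ∈ LG Γ := relCommutant_le _ _ hb
  refine ⟨le_join_right N C (condExp_mem hCM hbM), fun z hz => ?_⟩
  rw [← sub_eq_zero, ← tau_sub, ← sub_mul]
  refine tau_eq_zero_of_mem_join hC (fun c hc n hn => ?_) hz
  have h1 : condExp C b - b ∈ relCommutant N (LG Γ) := sub_mem (hC (condExp_mem hCM hbM)) hb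
  rw [← mul_assoc, tau_mul_of_mem_relCommutant hN hf (mul_mem h1 (hC hc)) hn, sub_mul, tau_sub,
    tau_condExp_mul hCM hbM hc, sub_self, zero_mul]

/-- A basis of B over C obtained by Gram-Schmidt stays orthogonal over N ∨ C, because the two
expectations agree on B. The products b a with b in B and a in N have dense span, so the expansion
formula need only be checked in trace against them. -/
theorem hasFiniteIndex_join {N C B : VonNeumannAlgebra (Ell2 Γ)} (hN : N ≤ LG Γ) (hf : IsFactor N)
    (hCB : C ≤ B) (hB : B ≤ relCommutant N (LG Γ)) (hfd : IsFinDim B) :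
    HasFiniteIndex (join N C) (join N B) := by
  have hBM : B ≤ LG Γ := hB.trans (relCommutant_le _ _)
  have hCM : C ≤ LG Γ := hCB.trans hBM
  have hPM : join N C ≤ LG Γ := join_le hN hCM
  have hQM : join N B ≤ LG Γ := join_le hN hBM
  obtain ⟨l, hl, hspan⟩ := exists_spanning_list hfd
  obtain ⟨n, m, p, hm, hp, hpp, horth, hrep⟩ :=
    exists_orthogonal_family hBM hCB (isFinDim_of_le hCB hfd) l hl
  have hEx : ∀ x ∈ B, IsCondExp (join N C) x (condExp C x) := fun x hx =>
    isCondExp_join hN hf (hCB.trans hB) (hB hx)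
  have hpm : ∀ i, p i * m i = m i := fun i => by
    refine eq_mul_of_condExp_mul_star hCM (hBM (hm i)) (hp i) (hpp i).isSelfAdjoint ?_
    rw [horth, if_pos rfl, mul_sub, mul_one, (hpp i).isIdempotentElem, sub_self]
  have hmem : ∀ x ∈ B, ∃ c : Fin n → (Ell2 Γ →L[ℂ] Ell2 Γ), (∀ i, c i ∈ C) ∧
      x = ∑ i, c i * m i := by
    intro x hx
    refine Submodule.span_induction (p := fun x _ => ∃ c : Fin n → (Ell2 Γ →L[ℂ] Ell2 Γ),
      (∀ i, c i ∈ C) ∧ x = ∑ i, c i * m i) ?_ ?_ ?_ ?_ (hspan x hx)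
    · exact fun y hy => ⟨_, fun i => condExp_mem hCM
        (hBM (mul_mem (hl y hy) (star_mem (hm i)))), hrep y hy⟩
    · exact ⟨fun _ => 0, fun _ => zero_mem C, by simp⟩
    · rintro _ _ _ _ ⟨c, hc, rfl⟩ ⟨d, hd, rfl⟩
      exact ⟨fun i => c i + d i, fun i => add_mem (hc i) (hd i), by
        simp [add_mul, Finset.sum_add_distrib]⟩
    · rintro a _ _ ⟨c, hc, rfl⟩
      exact ⟨fun i => a • c i, fun i => vn_smul_mem C a (hc i), by
        simp [Finset.smul_sum]⟩
  have hmQ : ∀ i, m i ∈ join N B := fun i => le_join_right N B (hm i)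
  refine ⟨join_mono_right N hCB, n, m, p, hmQ, hpp, ?_, ?_⟩
  · intro i j
    rw [← horth]
    exact hEx _ (mul_mem (hm i) (star_mem (hm j)))
  · intro x hx
    have hxm : ∀ i, x * star (m i) ∈ LG Γ := fun i => hQM (mul_mem hx (star_mem (hmQ i)))
    refine ⟨fun i => condExp (join N C) (x * star (m i)), fun i =>
      isCondExp_condExp hPM (hxm i), ?_⟩
    set y : Fin n → (Ell2 Γ →L[ℂ] Ell2 Γ) := fun i => condExp (join N C) (x * star (m i)) with hy
    have hyP : ∀ i, y i ∈ join N C := fun i => condExp_mem hPM (hxm i)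
    have hyp : ∀ i, y i * p i = y i := fun i => by
      rw [hy]
      simp only
      rw [← condExp_mul_right hPM (hxm i) (le_join_right N C (hp i)), mul_assoc]
      nth_rewrite 1 [← (hpp i).isSelfAdjoint.star_eq]
      rw [← star_mul, hpm]
    set x' := ∑ i, y i * m i with hx'
    have hx'Q : x' ∈ join N B := sum_mem fun i _ =>
      mul_mem (join_mono_right N hCB (hyP i)) (hmQ i)
    refine eq_of_tau hQM hx hx'Q fun z hz => ?_
    rw [← sub_eq_zero, ← tau_sub, ← sub_mul]
    refine tau_eq_zero_of_mem_join hB (fun b hb a ha => ?_) hz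
    -- Expanding b* rather than b puts m_i* on the left, where it meets x and produces E(x m_i*).
    obtain ⟨c, hc, hbc⟩ := hmem (star b) (star_mem hb)
    have hb' : b = ∑ i, star (m i) * star (c i) := by
      rw [← star_star b, hbc, star_sum]
      simp
    rw [hb', Finset.sum_mul, Finset.mul_sum, tau_sum]
    refine Finset.sum_eq_zero fun i _ => ?_
    have hw : star (c i) * a ∈ join N C :=
      mul_mem (le_join_right N C (star_mem (hc i))) (le_join_left N C ha)
    set w := star (c i) * a with hw'
    rw [mul_assoc (star (m i)), ← hw', sub_mul, tau_sub, sub_eq_zero, ← mul_assoc,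
      ← tau_condExp_mul hPM (hxm i) hw, hx', Finset.sum_mul, tau_sum]
    have hj : ∀ j, τ (y j * m j * (star (m i) * w)) = if j = i then τ (y i * w) else 0 := by
      intro j
      have hmm : m j * star (m i) ∈ B := mul_mem (hm j) (star_mem (hm i))
      have e1 : y j * m j * (star (m i) * w) = y j * (m j * star (m i) * w) := by
        simp only [mul_assoc]
      rw [e1, tau_comm (hPM (hyP j)) (mul_mem (hBM hmm) (hPM hw)), mul_assoc,
        ← (hEx _ hmm).2 _ (mul_mem hw (hyP j)), horth]
      split_ifs with h
      · subst h
        rw [← mul_assoc, tau_comm (mul_mem (hCM (hp j)) (hPM hw)) (hPM (hyP j)), ← mul_assoc, hyp]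
      · rw [zero_mul, tau_zero]
    rw [Finset.sum_congr rfl fun j _ => hj j, Finset.sum_ite_eq' Finset.univ i,
      if_pos (Finset.mem_univ i)]

theorem hasFiniteIndex_self (P : VonNeumannAlgebra (Ell2 Γ)) : HasFiniteIndex P P := by
  refine ⟨le_rfl, 1, fun _ => 1, fun _ => 1, fun _ => one_mem P, fun _ => .one _, fun i j => ?_,
    fun x hx => ⟨fun _ => x, fun _ => ?_, by simp⟩⟩
  · rw [if_pos (Subsingleton.elim i j), star_one, mul_one]
    exact ⟨one_mem P, fun _ _ => rfl⟩
  · rw [star_one, mul_one]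
    exact ⟨hx, fun _ _ => rfl⟩

end

/-! ### Minimal projections, matrix units and central supports -/

section

section General

variable {H : Type*} [NormedAddCommGroup H] [InnerProductSpace ℂ H] [CompleteSpace H]

/-- `q` is a minimal projection of `D`. -/
def IsMinProj (D : VonNeumannAlgebra H) (q : H →L[ℂ] H) : Prop :=
  q ∈ D ∧ IsStarProjection q ∧ q ≠ 0 ∧ ∀ r ∈ D, IsStarProjection r → q * r = r → r = 0 ∨ r = q

theorem exists_isMinProj_of_not_isDiffuse {D : VonNeumannAlgebra H} (h : ¬ IsDiffuse D) :
    ∃ q, IsMinProj D q := by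
  unfold IsDiffuse at h
  push Not at h
  obtain ⟨q, hq, hqp, hq0, h⟩ := h
  refine ⟨q, hq, hqp, hq0, fun r hr hrp hqr => ?_⟩
  by_contra! hc
  exact h r hr hrp hc.1 hc.2 hqr

/-- s and t are the square roots of the positive and negative parts of a. -/
theorem exists_sq_sub_sq {D : VonNeumannAlgebra H} {a : H →L[ℂ] H} (ha : a ∈ D)
    (hsa : IsSelfAdjoint a) : ∃ s ∈ D, ∃ t ∈ D, IsSelfAdjoint s ∧ IsSelfAdjoint t ∧
      a = s * s - t * t ∧ s * t = 0 ∧ t * s = 0 := by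
  have c1 : ContinuousOn (fun t : ℝ => Real.sqrt t) (spectrum ℝ a) := by fun_prop
  have c2 : ContinuousOn (fun t : ℝ => Real.sqrt (-t)) (spectrum ℝ a) := by fun_prop
  have c3 : ContinuousOn (fun t : ℝ => Real.sqrt t * Real.sqrt t) (spectrum ℝ a) := c1.mul c1
  have c4 : ContinuousOn (fun t : ℝ => Real.sqrt (-t) * Real.sqrt (-t)) (spectrum ℝ a) := c2.mul c2
  have h0 : ∀ t : ℝ, Real.sqrt t * Real.sqrt (-t) = 0 := fun t => by
    rcases le_total 0 t with h | h
    · rw [Real.sqrt_eq_zero_of_nonpos (neg_nonpos.2 h), mul_zero]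
    · rw [Real.sqrt_eq_zero_of_nonpos h, zero_mul]
  refine ⟨cfc (fun t : ℝ => Real.sqrt t) a, isSelfAdjoint_cfc_mem ha hsa _,
    cfc (fun t : ℝ => Real.sqrt (-t)) a, isSelfAdjoint_cfc_mem ha hsa _, cfc_predicate _ a,
    cfc_predicate _ a, ?_, ?_, ?_⟩
  · rw [← cfc_mul _ _ a c1 c1, ← cfc_mul _ _ a c2 c2, ← cfc_sub _ _ a c3 c4]
    conv_lhs => rw [← cfc_id' ℝ a]
    refine cfc_congr fun t _ => ?_
    rcases le_total 0 t with h | h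
    · simp [Real.sqrt_eq_zero_of_nonpos (neg_nonpos.2 h), Real.mul_self_sqrt h]
    · simp [Real.sqrt_eq_zero_of_nonpos h, Real.mul_self_sqrt (neg_nonneg.2 h)]
  · rw [← cfc_mul _ _ a c1 c2]
    simp only [h0, cfc_const_zero]
  · rw [← cfc_mul _ _ a c2 c1]
    simp only [mul_comm (Real.sqrt (-_)), h0, cfc_const_zero]

/-- The closed range of s is invariant under the commutant of D, so its projection lies in D. -/
theorem exists_range_projection {D : VonNeumannAlgebra H} {s : H →L[ℂ] H} (hs : s ∈ D) :
    ∃ r ∈ D, IsStarProjection r ∧ r * s = s ∧ ∀ x : H →L[ℂ] H, x * s = 0 → x * r = 0 := by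
  let K : Submodule ℂ H := s.range.topologicalClosure
  have hK : IsClosed (K : Set H) := Submodule.isClosed_topologicalClosure _
  have : CompleteSpace K := hK.completeSpace_coe
  have hsK : ∀ v, s v ∈ K := fun v => Submodule.le_topologicalClosure _ ⟨v, rfl⟩
  have hp : IsStarProjection K.starProjection := isStarProjection_starProjection
  refine ⟨K.starProjection, ?_, hp, ?_, ?_⟩
  · rw [VonNeumannAlgebra.IsStarProjection.mem_iff hp]
    intro y hy
    rw [Module.End.mem_invtSubmodule, Submodule.range_starProjection]
    intro v hv
    refine map_mem_closure y.continuous hv ?_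
    rintro _ ⟨w, rfl⟩
    exact ⟨y w, congrArg (fun f : H →L[ℂ] H => f w) (commute_of_mem hs hy)⟩
  · ext v
    exact Submodule.starProjection_eq_self_iff.2 (hsK v)
  · intro x hx
    ext v
    have h1 : K ≤ LinearMap.ker x.toLinearMap := by
      refine Submodule.topologicalClosure_minimal _ ?_ (ContinuousLinearMap.isClosed_ker x)
      rintro _ ⟨w, rfl⟩
      exact congrArg (fun f : H →L[ℂ] H => f w) hx
    exact h1 (K.starProjection_apply_mem v)

theorem eq_zero_of_star_mul_self {x : H →L[ℂ] H} (h : star x * x = 0) : x = 0 :=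
  CStarRing.star_mul_self_eq_zero_iff x |>.1 h

/-- The square roots of the positive and negative parts of `a` have the support of `a`. -/
theorem mul_eq_self_of_sq_sub_sq {a s t q : H →L[ℂ] H} (hs : IsSelfAdjoint s)
    (ha : a = s * s - t * t) (hst : s * t = 0) (hq : IsSelfAdjoint q) (haq : a * q = a) :
    s * q = s := by
  have hsq : star (1 - q) = 1 - q := by rw [star_sub, star_one, hq.star_eq]
  have h0 : a * (1 - q) = 0 := by rw [mul_sub, mul_one, haq, sub_self]
  have h1 : s * s * (s * s) * (1 - q) = 0 := by
    have : s * s * (s * s) = s * s * a := by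
      rw [ha, mul_sub, mul_assoc s s (t * t), ← mul_assoc s t t, hst, zero_mul, mul_zero, sub_zero]
    rw [this, mul_assoc, h0, mul_zero]
  have h2 : s * s * (1 - q) = 0 := by
    refine eq_zero_of_star_mul_self ?_
    rw [star_mul, star_mul, hs.star_eq, hsq]
    calc (1 - q) * (s * s) * (s * s * (1 - q)) = (1 - q) * (s * s * (s * s) * (1 - q)) := by
          simp only [mul_assoc]
      _ = 0 := by rw [h1, mul_zero]
  have h3 : s * (1 - q) = 0 := by
    refine eq_zero_of_star_mul_self ?_
    rw [star_mul, hs.star_eq, hsq, mul_assoc, ← mul_assoc s s, h2, mul_zero]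
  rw [mul_sub, mul_one, sub_eq_zero] at h3
  exact h3.symm

/-- The range projection of the root s of the positive part lies under q, so it is 0 or q. In the
first case s vanishes; in the second the root t of the negative part does, as t s = 0. -/
theorem IsMinProj.sqrt_eq_zero {D : VonNeumannAlgebra H} {q a : H →L[ℂ] H} (h : IsMinProj D q)
    (ha : a ∈ D) (hsa : IsSelfAdjoint a) (haq : a * q = a) :
    ∃ s ∈ D, IsSelfAdjoint s ∧ (a = s * s ∨ a = -(s * s)) := by
  obtain ⟨hq, hqp, hq0, hmin⟩ := h
  obtain ⟨s, hs, t, ht, hss, hst, hast, hst0, hts0⟩ := exists_sq_sub_sq ha hsa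
  have hsq : s * q = s := mul_eq_self_of_sq_sub_sq hss hast hst0 hqp.isSelfAdjoint haq
  have htq : t * q = t := by
    refine mul_eq_self_of_sq_sub_sq (a := -a) hst (by rw [hast, neg_sub]) hts0 hqp.isSelfAdjoint ?_
    rw [neg_mul, haq]
  have hqs : q * s = s := by
    have := congrArg star hsq
    rwa [star_mul, hss.star_eq, hqp.isSelfAdjoint.star_eq] at this
  obtain ⟨r, hr, hrp, hrs, hrx⟩ := exists_range_projection hs
  have hqr : q * r = r := by
    have := hrx (1 - q) (by rw [sub_mul, one_mul, hqs, sub_self])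
    rw [sub_mul, one_mul, sub_eq_zero] at this
    exact this.symm
  rcases hmin r hr hrp hqr with h0 | h0
  · refine ⟨t, ht, hst, Or.inr ?_⟩
    rw [h0, zero_mul] at hrs
    rw [hast, ← hrs, zero_mul, zero_sub]
  · refine ⟨s, hs, hss, Or.inl ?_⟩
    have := hrx t hts0
    rw [h0, htq] at this
    rw [hast, this, zero_mul, sub_zero]

end General

variable {Γ : Type*} [Group Γ]

theorem tau_projection {p : Ell2 Γ →L[ℂ] Ell2 Γ} (hp : IsStarProjection p) :
    τ p = ((‖p (delta 1)‖ ^ 2 : ℝ) : ℂ) := by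
  rw [← tau_star_mul_self, hp.isSelfAdjoint.star_eq, hp.isIdempotentElem]

theorem norm_projection_pos {p : Ell2 Γ →L[ℂ] Ell2 Γ} (hpM : p ∈ LG Γ) (hp0 : p ≠ 0) :
    0 < ‖p (delta 1)‖ := by
  refine norm_pos_iff.2 fun h => hp0 (ext_of_mem hpM (zero_mem _) (by simpa using h))

theorem norm_projection_le {p : Ell2 Γ →L[ℂ] Ell2 Γ} (hp : IsStarProjection p) :
    ‖p (delta 1)‖ ^ 2 ≤ 1 := by
  have h1 : ‖τ p‖ ≤ ‖p (delta 1)‖ := by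
    rw [tau_eq]
    refine (norm_inner_le_norm _ _).trans ?_
    rw [norm_delta, one_mul]
  rw [tau_projection hp, Complex.norm_of_nonneg (by positivity)] at h1
  nlinarith [norm_nonneg (p (delta 1))]

/-- Subtract from q x q the multiple of q with the same trace. The difference has a constant sign
and trace zero, so it vanishes. -/
theorem IsMinProj.exists_smul_of_selfAdjoint {D : VonNeumannAlgebra (Ell2 Γ)} (hD : D ≤ LG Γ)
    {q x : Ell2 Γ →L[ℂ] Ell2 Γ} (h : IsMinProj D q) (hx : x ∈ D) (hsx : IsSelfAdjoint x) :
    ∃ c : ℂ, q * x * q = c • q := by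
  obtain ⟨hq, hqp, hq0, hmin⟩ := id h
  have hqq : q * q = q := hqp.isIdempotentElem
  have hsq : star q = q := hqp.isSelfAdjoint.star_eq
  have hn := norm_projection_pos (hD hq) hq0
  set t := ‖q (delta 1)‖ ^ 2 with ht
  have ht0 : (t : ℂ) ≠ 0 := by
    have : t ≠ 0 := by positivity
    exact_mod_cast this
  have hy : IsSelfAdjoint (q * x * q) := by
    rw [IsSelfAdjoint, star_mul, star_mul, hsq, hsx.star_eq, mul_assoc]
  have hyD : q * x * q ∈ D := mul_mem (mul_mem hq hx) hq
  have hτ : τ (q * x * q) = ((τ (q * x * q)).re : ℂ) := by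
    have h1 := tau_star (q * x * q)
    rw [hy.star_eq] at h1
    exact (Complex.conj_eq_iff_re.1 h1.symm).symm
  set c : ℝ := (τ (q * x * q)).re / t with hc
  refine ⟨(c : ℂ), ?_⟩
  set a := q * x * q - (c : ℂ) • q with ha
  have hscq : IsSelfAdjoint ((c : ℂ) • q) := by
    rw [IsSelfAdjoint, star_smul, hsq, Complex.star_def, Complex.conj_ofReal]
  have haD : a ∈ D := sub_mem hyD (vn_smul_mem D _ hq)
  have haq : a * q = a := by
    rw [ha, sub_mul, smul_mul_assoc, hqq, mul_assoc, hqq]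
  have hτa : τ a = 0 := by
    rw [ha, tau_sub, tau_smul, tau_projection hqp, ← ht, hτ, hc]
    push_cast
    rw [div_mul_cancel₀ _ ht0, sub_self]
  obtain ⟨s, hs, hss, has⟩ := h.sqrt_eq_zero haD (hy.sub hscq) haq
  have hss' : τ (s * s) = ((‖s (delta 1)‖ ^ 2 : ℝ) : ℂ) := by
    rw [← tau_star_mul_self, hss.star_eq]
  have hs0 : τ (s * s) = 0 := by
    rcases has with h1 | h1
    · rw [← h1, hτa]
    · rw [← neg_neg (s * s), ← h1, ← zero_sub, tau_sub, hτa, tau_zero, sub_zero]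
  have hs1 : s = 0 := eq_zero_of_tau (hD hs) (by rw [hss.star_eq, hs0])
  have ha0 : a = 0 := by
    rcases has with h1 | h1 <;> rw [h1, hs1] <;> simp
  rwa [ha, sub_eq_zero] at ha0

theorem IsMinProj.exists_smul {D : VonNeumannAlgebra (Ell2 Γ)} (hD : D ≤ LG Γ)
    {q x : Ell2 Γ →L[ℂ] Ell2 Γ} (h : IsMinProj D q) (hx : x ∈ D) :
    ∃ c : ℂ, q * x * q = c • q := by
  have hsx : star x ∈ D := star_mem hx
  obtain ⟨c, hc⟩ := h.exists_smul_of_selfAdjoint hD (add_mem hx hsx)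
    (by rw [IsSelfAdjoint, star_add, star_star, add_comm])
  obtain ⟨d, hd⟩ := h.exists_smul_of_selfAdjoint hD (vn_smul_mem D Complex.I (sub_mem hx hsx))
    (by rw [IsSelfAdjoint, star_smul, star_sub, star_star, Complex.star_def, Complex.conj_I,
      neg_smul, ← smul_neg, neg_sub])
  refine ⟨(c - Complex.I * d) / 2, ?_⟩
  have hx2 : x = (2⁻¹ : ℂ) • ((x + star x) - Complex.I • (Complex.I • (x - star x))) := by
    rw [smul_smul, Complex.I_mul_I, neg_one_smul, sub_neg_eq_add, add_add_sub_cancel, ← two_smul ℂ x,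
      smul_smul]
    norm_num
  have e : q * x * q = (2⁻¹ : ℂ) • (q * (x + star x) * q
      - Complex.I • (q * (Complex.I • (x - star x)) * q)) := by
    conv_lhs => rw [hx2]
    simp only [mul_smul_comm, smul_mul_assoc, mul_sub, sub_mul]
  rw [e, hc, hd, smul_smul, ← sub_smul, smul_smul]
  congr 1
  ring

/-- Since q D q is scalar, D q is a Hilbert space whose inner product can be read off from the
operators themselves. -/
theorem IsMinProj.star_mul_eq {D : VonNeumannAlgebra (Ell2 Γ)} (hD : D ≤ LG Γ)
    {q x y : Ell2 Γ →L[ℂ] Ell2 Γ} (h : IsMinProj D q) (hx : x ∈ D) (hy : y ∈ D) :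
    star (x * q) * (y * q) =
      (inner ℂ ((x * q) (delta 1)) ((y * q) (delta 1)) / ((‖q (delta 1)‖ ^ 2 : ℝ) : ℂ)) • q := by
  obtain ⟨c, hc⟩ := h.exists_smul hD (mul_mem (star_mem hx) hy)
  have hq := h.2.1
  have hn := norm_projection_pos (hD h.1) h.2.2.1
  have hn0 : ((‖q (delta 1)‖ ^ 2 : ℝ) : ℂ) ≠ 0 := by
    have : ‖q (delta 1)‖ ^ 2 ≠ 0 := by positivity
    exact_mod_cast this
  have e : star (x * q) * (y * q) = c • q := by
    rw [← hc, star_mul, hq.isSelfAdjoint.star_eq]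
    simp only [mul_assoc]
  rw [← tau_star_mul, e, tau_smul, tau_projection hq, mul_div_cancel_right₀ _ hn0]

/-- The number of orthogonal translates of a projection is bounded by the inverse of its trace. -/
theorem card_mul_le_one {q : Ell2 Γ →L[ℂ] Ell2 Γ} (hq : IsStarProjection q)
    {n : ℕ} (v : Fin n → Ell2 Γ →L[ℂ] Ell2 Γ) (hv : ∀ i, v i ∈ LG Γ) (hvq : ∀ i, v i * q = v i)
    (horth : ∀ i j, star (v i) * v j = if i = j then q else 0) :
    n * ‖q (delta 1)‖ ^ 2 ≤ 1 ∧ IsStarProjection (∑ i, v i * star (v i)) := by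
  have hP : IsStarProjection (∑ i, v i * star (v i)) := by
    refine ⟨?_, ?_⟩
    · rw [IsIdempotentElem, Finset.sum_mul]
      refine Finset.sum_congr rfl fun i _ => ?_
      rw [Finset.mul_sum]
      have : ∀ j, v i * star (v i) * (v j * star (v j)) = if i = j then v i * star (v i) else 0 := by
        intro j
        rw [mul_assoc, ← mul_assoc (star (v i)), horth]
        split_ifs with h
        · subst h; rw [← mul_assoc, hvq]
        · simp
      rw [Finset.sum_congr rfl fun j _ => this j, Finset.sum_ite_eq Finset.univ i,
        if_pos (Finset.mem_univ i)]
    · rw [IsSelfAdjoint, star_sum]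
      exact Finset.sum_congr rfl fun i _ => by rw [star_mul, star_star]
  refine ⟨?_, hP⟩
  have h1 : τ (∑ i, v i * star (v i)) = ((n * ‖q (delta 1)‖ ^ 2 : ℝ) : ℂ) := by
    rw [tau_sum, Finset.sum_congr rfl fun i _ => by
      rw [tau_comm (hv i) (star_mem (hv i)), horth, if_pos rfl, tau_projection hq]]
    simp
  rw [tau_projection hP] at h1
  have h2 := norm_projection_le hP
  have h3 : ‖(∑ i, v i * star (v i)) (delta 1)‖ ^ 2 = n * ‖q (delta 1)‖ ^ 2 := by
    exact_mod_cast h1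
  rwa [h3] at h2

/-- Orthonormal vectors in D q give partial isometries with initial projection q and orthogonal
ranges, all of trace τ(q). Their number is at most 1/τ(q), so D q is finite dimensional and the v_i
come from an orthonormal basis of it. -/
theorem IsMinProj.exists_matrix_units {D : VonNeumannAlgebra (Ell2 Γ)} (hD : D ≤ LG Γ)
    {q : Ell2 Γ →L[ℂ] Ell2 Γ} (h : IsMinProj D q) :
    ∃ (n : ℕ) (v : Fin n → Ell2 Γ →L[ℂ] Ell2 Γ), (∀ i, v i ∈ D) ∧ (∀ i, v i * q = v i) ∧
      (∀ i j, star (v i) * v j = if i = j then q else 0) ∧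
      ∀ x ∈ D, ∃ c : Fin n → ℂ, x * q = ∑ i, c i • v i := by
  have hq := h.2.1
  have hqq : q * q = q := hq.isIdempotentElem
  have hqD := h.1
  have hn := norm_projection_pos (hD h.1) h.2.2.1
  set t := ‖q (delta 1)‖ ^ 2 with ht
  have ht0 : 0 < t := by positivity
  let W : Submodule ℂ (Ell2 Γ) :=
    { carrier := {ξ | ∃ x ∈ D, (x * q) (delta 1) = ξ}
      add_mem' := by
        rintro _ _ ⟨x, hx, rfl⟩ ⟨y, hy, rfl⟩
        exact ⟨x + y, add_mem hx hy, rfl⟩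
      zero_mem' := ⟨0, zero_mem D, rfl⟩
      smul_mem' := by
        rintro c _ ⟨x, hx, rfl⟩
        exact ⟨c • x, vn_smul_mem D c hx, rfl⟩ }
  have key : ∀ (n : ℕ) (f : Fin n → W), Orthonormal ℂ f →
      ∃ v : Fin n → Ell2 Γ →L[ℂ] Ell2 Γ, (∀ i, v i ∈ D) ∧ (∀ i, v i * q = v i) ∧
        (∀ i j, star (v i) * v j = if i = j then q else 0) ∧
        ∀ i, v i (delta 1) = ((Real.sqrt t : ℝ) : ℂ) • (f i : Ell2 Γ) := by
    intro n f hf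
    have hx : ∀ i, ∃ x ∈ D, (x * q) (delta 1) = (f i : Ell2 Γ) := fun i => (f i).2
    choose x hxD hxf using hx
    -- The factor √t turns a unit vector into one of norm ‖qδ_1‖, as v_i* v_i = q demands.
    refine ⟨fun i => ((Real.sqrt t : ℝ) : ℂ) • (x i * q), fun i =>
      vn_smul_mem D _ (mul_mem (hxD i) hqD), fun i => ?_, fun i j => ?_, fun i => ?_⟩
    · rw [smul_mul_assoc, mul_assoc, hqq]
    · rw [star_smul, smul_mul_smul_comm, h.star_mul_eq hD (hxD i) (hxD j), hxf, hxf, smul_smul,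
        Complex.star_def, Complex.conj_ofReal, ← Complex.ofReal_mul, Real.mul_self_sqrt ht0.le, ← ht]
      have h1 := orthonormal_iff_ite.1 hf i j
      rw [Submodule.coe_inner] at h1
      have ht1 : (t : ℂ) ≠ 0 := by exact_mod_cast ht0.ne'
      rw [h1]
      split_ifs
      · rw [mul_one_div_cancel ht1, one_smul]
      · simp
    · rw [smul_apply, hxf]
  have hrank : Module.rank ℂ W ≤ (⌊1 / t⌋₊ : ℕ) := by
    refine rank_le fun s hs => ?_
    have hfd : FiniteDimensional ℂ (Submodule.span ℂ (s : Set W)) :=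
      FiniteDimensional.span_finset ℂ s
    have hcard : Module.finrank ℂ (Submodule.span ℂ (s : Set W)) = s.card :=
      finrank_span_finset_eq_card hs
    let b := stdOrthonormalBasis ℂ (Submodule.span ℂ (s : Set W))
    have hb : Orthonormal ℂ fun i => (b i : W) :=
      b.orthonormal.comp_linearIsometry (Submodule.span ℂ (s : Set W)).subtypeₗᵢ
    obtain ⟨v, hvD, hvq, horth, -⟩ := key _ _ hb
    have h1 := (card_mul_le_one hq v (fun i => hD (hvD i)) hvq horth).1
    rw [hcard, ← ht] at h1
    exact Nat.le_floor ((le_div_iff₀ ht0).2 h1)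
  have hfin : FiniteDimensional ℂ W :=
    Module.rank_lt_aleph0_iff.1 (hrank.trans_lt (Cardinal.natCast_lt_aleph0))
  let b := stdOrthonormalBasis ℂ W
  obtain ⟨v, hvD, hvq, horth, hvb⟩ := key _ b b.orthonormal
  refine ⟨_, v, hvD, hvq, horth, fun x hx => ?_⟩
  have hst : ((Real.sqrt t : ℝ) : ℂ) ≠ 0 := by
    exact_mod_cast (Real.sqrt_pos.2 ht0).ne'
  let w : W := ⟨(x * q) (delta 1), x, hx, rfl⟩
  refine ⟨fun i => b.repr w i / ((Real.sqrt t : ℝ) : ℂ), ?_⟩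
  refine ext_of_mem (hD (mul_mem hx hqD)) (sum_mem fun i _ =>
    vn_smul_mem _ _ (hD (hvD i))) ?_
  have h1 := congrArg Subtype.val (b.sum_repr w)
  rw [Submodule.coe_sum] at h1
  rw [sum_apply]
  refine h1.symm.trans (Finset.sum_congr rfl fun i _ => ?_)
  rw [smul_apply, hvb, smul_smul, div_mul_cancel₀ _ hst]
  rfl

/-- The v_i span D q, a left D-module, so the range of their sum of range projections z is
D-invariant; D being star-closed, z is central. Cutting by z leaves only the matrix units v_i v_j*.
-/
theorem IsMinProj.central_support {D : VonNeumannAlgebra (Ell2 Γ)} (hD : D ≤ LG Γ)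
    {q : Ell2 Γ →L[ℂ] Ell2 Γ} (h : IsMinProj D q) {n : ℕ} {v : Fin n → Ell2 Γ →L[ℂ] Ell2 Γ}
    (hv : ∀ i, v i ∈ D) (hvq : ∀ i, v i * q = v i)
    (horth : ∀ i j, star (v i) * v j = if i = j then q else 0)
    (hspan : ∀ x ∈ D, ∃ c : Fin n → ℂ, x * q = ∑ i, c i • v i) :
    (∀ x ∈ D, x * (∑ i, v i * star (v i)) = (∑ i, v i * star (v i)) * x) ∧
      (∑ i, v i * star (v i)) * q = q ∧
      ∀ x ∈ D, x * (∑ i, v i * star (v i)) ∈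
        Submodule.span ℂ (Set.range fun a : Fin n × Fin n => v a.1 * star (v a.2)) := by
  set z := ∑ i, v i * star (v i) with hz
  have hzp : IsStarProjection z :=
    (card_mul_le_one h.2.1 v (fun i => hD (hv i)) hvq horth).2
  have hzv : ∀ j, z * v j = v j := fun j => by
    rw [hz, Finset.sum_mul, Finset.sum_congr rfl fun i _ => by rw [mul_assoc, horth]]
    simp [hvq]
  have hzxv : ∀ x ∈ D, ∀ j, ∃ c : Fin n → ℂ, x * v j = ∑ i, c i • v i := fun x hx j => by
    obtain ⟨c, hc⟩ := hspan _ (mul_mem hx (hv j))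
    rw [mul_assoc, hvq] at hc
    exact ⟨c, hc⟩
  have hzxz : ∀ x ∈ D, z * (x * z) = x * z := fun x hx => by
    have e : x * z = ∑ j, x * v j * star (v j) := by
      rw [hz, Finset.mul_sum]; simp only [mul_assoc]
    rw [e, Finset.mul_sum]
    refine Finset.sum_congr rfl fun j _ => ?_
    obtain ⟨c, hc⟩ := hzxv x hx j
    rw [← mul_assoc, hc, Finset.mul_sum]
    simp only [mul_smul_comm, hzv]
  refine ⟨fun x hx => ?_, ?_, fun x hx => ?_⟩
  · have h1 := congrArg star (hzxz _ (star_mem hx))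
    simp only [star_mul, star_star, hzp.isSelfAdjoint.star_eq] at h1
    rw [← hzxz x hx, ← mul_assoc, h1]
  · obtain ⟨c, hc⟩ := hspan 1 (one_mem D)
    rw [one_mul] at hc
    nth_rewrite 2 [hc]
    rw [hc, Finset.mul_sum]
    simp only [mul_smul_comm, hzv]
  · have e : x * z = ∑ j, x * v j * star (v j) := by
      rw [hz, Finset.mul_sum]; simp only [mul_assoc]
    rw [e]
    refine Submodule.sum_mem _ fun j _ => ?_
    obtain ⟨c, hc⟩ := hzxv x hx j
    rw [hc, Finset.sum_mul]
    refine Submodule.sum_mem _ fun i _ => ?_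
    rw [smul_mul_assoc]
    exact Submodule.smul_mem _ _ (Submodule.subset_span ⟨(i, j), rfl⟩)

/-- In a factor with a minimal projection, the central support is `1`. -/
theorem sum_eq_one_of_isFactor {N : VonNeumannAlgebra (Ell2 Γ)} (hN : N ≤ LG Γ) (hf : IsFactor N)
    {q : Ell2 Γ →L[ℂ] Ell2 Γ} (h : IsMinProj N q) {n : ℕ} {v : Fin n → Ell2 Γ →L[ℂ] Ell2 Γ}
    (hv : ∀ i, v i ∈ N) (hvq : ∀ i, v i * q = v i)
    (horth : ∀ i j, star (v i) * v j = if i = j then q else 0)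
    (hspan : ∀ x ∈ N, ∃ c : Fin n → ℂ, x * q = ∑ i, c i • v i) :
    ∑ i, v i * star (v i) = 1 := by
  obtain ⟨h1, h2, -⟩ := h.central_support hN hv hvq horth hspan
  obtain ⟨c, hc⟩ := hf _ (sum_mem fun i _ => mul_mem (hv i) (star_mem (hv i)))
    (VonNeumannAlgebra.mem_commutant_iff.2 h1)
  rw [hc, smul_mul_assoc, one_mul] at h2
  have h3 : (c - 1) • q = 0 := by rw [sub_smul, one_smul, h2, sub_self]
  rcases smul_eq_zero.1 h3 with h4 | h4
  · rw [hc, sub_eq_zero.1 h4, one_smul]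
  · exact absurd h4 h.2.2.1

theorem isFinDim_of_isMinProj {N : VonNeumannAlgebra (Ell2 Γ)} (hN : N ≤ LG Γ) (hf : IsFactor N)
    {q : Ell2 Γ →L[ℂ] Ell2 Γ} (h : IsMinProj N q) : IsFinDim N := by
  obtain ⟨n, v, hv, hvq, horth, hspan⟩ := h.exists_matrix_units hN
  have h1 := sum_eq_one_of_isFactor hN hf h hv hvq horth hspan
  have h3 := (h.central_support hN hv hvq horth hspan).2.2
  let W := Submodule.span ℂ (Set.range fun a : Fin n × Fin n => v a.1 * star (v a.2))
  have : FiniteDimensional ℂ W := FiniteDimensional.span_of_finite ℂ (Set.finite_range _)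
  refine isFinDim_of_subset N W fun x hx => ?_
  have := h3 x hx
  rwa [h1, mul_one] at this

end

/-! ### Amenability of abelian algebras by averaging -/

section

open Filter Topology

section General

variable {H : Type*} [NormedAddCommGroup H] [InnerProductSpace ℂ H] [CompleteSpace H]

/-- The weak limit of a bounded family of maps along an ultrafilter. -/
theorem exists_weak_limit {ι : Type*} (𝒰 : Ultrafilter ι)
    (G : ι → (H →L[ℂ] H) →ₗ[ℂ] (H →L[ℂ] H)) (hG : ∀ i T, ‖G i T‖ ≤ ‖T‖) :
    ∃ F : (H →L[ℂ] H) →ₗ[ℂ] (H →L[ℂ] H), (∀ T, ‖F T‖ ≤ ‖T‖) ∧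
      ∀ T v w, Tendsto (fun i => inner ℂ (G i T v) w) 𝒰 (𝓝 (inner ℂ (F T v) w)) := by
  have hlim : ∀ T v w, ∃ l : ℂ, Tendsto (fun i => inner ℂ (G i T v) w) 𝒰 (𝓝 l) := by
    intro T v w
    have hb : ∀ i, inner ℂ (G i T v) w ∈ Metric.closedBall (0 : ℂ) (‖T‖ * ‖v‖ * ‖w‖) := fun i => by
      rw [mem_closedBall_zero_iff]
      refine (norm_inner_le_norm _ _).trans ?_
      gcongr
      exact (G i T).le_of_opNorm_le (hG i T) v
    obtain ⟨l, -, hl⟩ := (isCompact_closedBall (0 : ℂ) (‖T‖ * ‖v‖ * ‖w‖)).ultrafilter_le_nhds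
      (𝒰.map fun i => inner ℂ (G i T v) w)
      (le_principal_iff.2 (Eventually.of_forall (f := (𝒰 : Filter ι)) hb))
    exact ⟨l, hl⟩
  choose ℓ hℓ using hlim
  have hbound : ∀ T v w, ‖ℓ T v w‖ ≤ ‖T‖ * ‖v‖ * ‖w‖ := fun T v w => by
    refine le_of_tendsto (hℓ T v w).norm (Eventually.of_forall fun i => ?_)
    refine (norm_inner_le_norm _ _).trans ?_
    gcongr
    exact (G i T).le_of_opNorm_le (hG i T) v
  have huniq : ∀ {T v w l}, Tendsto (fun i => inner ℂ (G i T v) w) 𝒰 (𝓝 l) → ℓ T v w = l :=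
    fun h => tendsto_nhds_unique (hℓ _ _ _) h
  let B : (H →L[ℂ] H) → H →L⋆[ℂ] H →L[ℂ] ℂ := fun T =>
    LinearMap.mkContinuous₂ (LinearMap.mk₂'ₛₗ (starRingEnd ℂ) (RingHom.id ℂ) (ℓ T)
      (fun v v' w => huniq (by
        simpa only [map_add, inner_add_left] using (hℓ T v w).add (hℓ T v' w)))
      (fun c v w => huniq (by
        simpa only [map_smul, inner_smul_left, smul_eq_mul] using
          (hℓ T v w).const_mul ((starRingEnd ℂ) c)))
      (fun v w w' => huniq (by
        simpa only [inner_add_right] using (hℓ T v w).add (hℓ T v w')))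
      (fun c v w => huniq (by
        simpa only [inner_smul_right, smul_eq_mul, RingHom.id_apply] using
          (hℓ T v w).const_mul c))) ‖T‖ (hbound T)
  have hB : ∀ T v w, inner ℂ (InnerProductSpace.continuousLinearMapOfBilin (B T) v) w = ℓ T v w :=
    fun T v w => InnerProductSpace.continuousLinearMapOfBilin_apply (B T) v w
  refine ⟨{ toFun := fun T => InnerProductSpace.continuousLinearMapOfBilin (B T)
            map_add' := fun T T' => ?_
            map_smul' := fun c T => ?_ }, fun T => ?_, fun T v w => ?_⟩
  · ext v
    refine ext_inner_right ℂ fun w => ?_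
    rw [add_apply, inner_add_left, hB, hB, hB]
    refine huniq ?_
    simpa only [map_add, add_apply, inner_add_left] using (hℓ T v w).add (hℓ T' v w)
  · ext v
    refine ext_inner_right ℂ fun w => ?_
    rw [RingHom.id_apply, smul_apply, inner_smul_left, hB, hB]
    refine huniq ?_
    simpa only [map_smul, smul_apply, inner_smul_left] using
      (hℓ T v w).const_mul ((starRingEnd ℂ) c)
  · refine ContinuousLinearMap.opNorm_le_bound _ (norm_nonneg _) fun v => ?_
    set y := InnerProductSpace.continuousLinearMapOfBilin (B T) v with hy
    have h1 : ‖y‖ * ‖y‖ ≤ ‖T‖ * ‖v‖ * ‖y‖ := by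
      have h2 := hbound T v y
      have h3 : ‖inner ℂ y y‖ = ‖y‖ * ‖y‖ := by
        rw [inner_self_eq_norm_sq_to_K]; simp [sq]
      rw [← hB, ← hy, h3] at h2
      exact h2
    rcases eq_or_lt_of_le (norm_nonneg y) with h0 | h0
    · change ‖y‖ ≤ _
      rw [← h0]; positivity
    · exact le_of_mul_le_mul_right h1 h0
  · change Tendsto _ _ (𝓝 (inner ℂ (InnerProductSpace.continuousLinearMapOfBilin (B T) v) w))
    rw [hB]
    exact hℓ T v w

theorem norm_two_mul_sub_one_le {e : H →L[ℂ] H} (he : IsStarProjection e) :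
    ‖(2 : ℂ) • e - 1‖ ≤ 1 := by
  have h1 : star ((2 : ℂ) • e - 1) * ((2 : ℂ) • e - 1) = 1 := by
    rw [star_sub, star_smul, he.isSelfAdjoint.star_eq, star_one]
    simp only [sub_mul, mul_sub, smul_mul_assoc, mul_smul_comm, he.isIdempotentElem.eq, mul_one,
      one_mul, smul_sub, smul_smul]
    have h2 : star (2 : ℂ) = 2 := by simp
    rw [h2]
    module
  have h2 := CStarRing.norm_star_mul_self (x := (2 : ℂ) • e - 1)
  rw [h1] at h2
  have h3 : ‖(1 : H →L[ℂ] H)‖ ≤ 1 := ContinuousLinearMap.norm_id_le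
  nlinarith [norm_nonneg ((2 : ℂ) • e - 1)]

/-- Averaging over finitely many commuting projections. -/
theorem exists_finite_average (S : Set (H →L[ℂ] H)) (hp : ∀ s ∈ S, IsStarProjection s)
    (hc : ∀ s ∈ S, ∀ t ∈ S, s * t = t * s) (I : Finset S) :
    ∃ G : (H →L[ℂ] H) →ₗ[ℂ] (H →L[ℂ] H), (∀ T, ‖G T‖ ≤ ‖T‖) ∧
      (∀ T, ∀ s ∈ I, (s : H →L[ℂ] H) * G T = G T * s) ∧
      ∀ T, (∀ s ∈ S, s * T = T * s) → G T = T := by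
  classical
  induction I using Finset.induction_on with
  | empty => exact ⟨LinearMap.id, fun _ => le_rfl, by simp, fun _ _ => rfl⟩
  | insert e I _ ih =>
    obtain ⟨G, hG1, hG2, hG3⟩ := ih
    have he := hp e e.2
    set f : H →L[ℂ] H := e.1 with hf
    have hff : f * f = f := he.isIdempotentElem
    let A : (H →L[ℂ] H) →ₗ[ℂ] (H →L[ℂ] H) :=
      { toFun := fun T => f * T * f + (1 - f) * T * (1 - f)
        map_add' := fun T T' => by simp only [mul_add, add_mul]; abel
        map_smul' := fun c T => by
          simp only [mul_smul_comm, smul_mul_assoc, smul_add, RingHom.id_apply] }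
    have hA : ∀ T, A T = f * T * f + (1 - f) * T * (1 - f) := fun _ => rfl
    refine ⟨A ∘ₗ G, fun T => ?_, fun T s hs => ?_, fun T hT => ?_⟩
    · refine le_trans ?_ (hG1 T)
      rw [LinearMap.comp_apply]
      generalize G T = X
      -- The pinching is the mean of X and its conjugate by the symmetry 2f − 1, hence a
      -- contraction.
      have h1 : A X = (2⁻¹ : ℂ) • (X + ((2 : ℂ) • f - 1) * X * ((2 : ℂ) • f - 1)) := by
        rw [hA]
        simp only [sub_mul, mul_sub, smul_mul_assoc, mul_smul_comm, mul_one, one_mul]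
        module
      rw [h1, norm_smul]
      have h2 : ‖((2 : ℂ) • f - 1) * X * ((2 : ℂ) • f - 1)‖ ≤ 1 * ‖X‖ * 1 := by
        refine (norm_mul_le _ _).trans ?_
        refine mul_le_mul ((norm_mul_le _ _).trans ?_) (norm_two_mul_sub_one_le he)
          (norm_nonneg _) (by positivity)
        exact mul_le_mul_of_nonneg_right (norm_two_mul_sub_one_le he) (norm_nonneg _)
      have h3 := norm_add_le X (((2 : ℂ) • f - 1) * X * ((2 : ℂ) • f - 1))
      have h4 : ‖(2⁻¹ : ℂ)‖ = 2⁻¹ := by simp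
      rw [h4]
      linarith
    · rw [LinearMap.comp_apply, hA]
      rcases Finset.mem_insert.1 hs with rfl | hs
      · simp only [← hf, mul_add, add_mul, sub_mul, mul_sub, one_mul, mul_one, ← mul_assoc, hff]
        simp only [mul_assoc, hff]
        abel
      · have h1 := hG2 T s hs
        have h2 : s.1 * f = f * s.1 := hc _ s.2 _ e.2
        have h3 : s.1 * (1 - f) = (1 - f) * s.1 := by rw [mul_sub, sub_mul, h2, one_mul, mul_one]
        have h4 : ∀ g : H →L[ℂ] H, s.1 * g = g * s.1 → s.1 * (g * G T * g) = g * G T * g * s.1 := by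
          intro g hg
          rw [← mul_assoc, ← mul_assoc, hg, mul_assoc g, h1, mul_assoc, mul_assoc, hg]
          simp only [mul_assoc]
        rw [mul_add, add_mul, h4 _ h2, h4 _ h3]
    · rw [LinearMap.comp_apply, hG3 T hT, hA]
      have h1 : f * T = T * f := hT f e.2
      have h2 : (1 - f) * T = T * (1 - f) := by rw [mul_sub, sub_mul, h1, one_mul, mul_one]
      have h3 : (1 - f) * (1 - f) = 1 - f := by
        rw [mul_sub, mul_one, sub_mul, one_mul, hff, sub_self, sub_zero]
      rw [h1, h2, mul_assoc, hff, mul_assoc, h3, ← mul_add, add_sub_cancel, mul_one]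

/-- A contraction of `B(H)` onto the commutant of a set of commuting projections. -/
theorem exists_average (S : Set (H →L[ℂ] H)) (hp : ∀ s ∈ S, IsStarProjection s)
    (hc : ∀ s ∈ S, ∀ t ∈ S, s * t = t * s) :
    ∃ F : (H →L[ℂ] H) →ₗ[ℂ] (H →L[ℂ] H), (∀ T, ‖F T‖ ≤ ‖T‖) ∧
      (∀ T, ∀ s ∈ S, s * F T = F T * s) ∧ ∀ T, (∀ s ∈ S, s * T = T * s) → F T = T := by
  choose G hG1 hG2 hG3 using exists_finite_average S hp hc
  obtain ⟨F, hF1, hF2⟩ := exists_weak_limit (Ultrafilter.of (atTop : Filter (Finset S))) G hG1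
  refine ⟨F, hF1, fun T s hs => ?_, fun T hT => ?_⟩
  · ext v
    refine ext_inner_right ℂ fun w => ?_
    have hsa : star s = s := (hp s hs).isSelfAdjoint.star_eq
    have h1 := hF2 T v (s w)
    have h2 := hF2 T (s v) w
    have h3 : inner ℂ ((s * F T) v) w = inner ℂ (F T v) (s w) := by
      conv_lhs => rw [← hsa]
      exact inner_star_left s _ _
    rw [h3]
    refine tendsto_nhds_unique h1 (h2.congr' ?_)
    -- From the stage {s} on, all averages commute with s, and the ultrafilter refines the order
    -- filter.
    have h4 : ∀ᶠ I in (atTop : Filter (Finset S)), {⟨s, hs⟩} ≤ I := eventually_ge_atTop _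
    filter_upwards [Ultrafilter.of_le _ h4] with I hI
    have h5 := hG2 I T ⟨s, hs⟩ (hI (Finset.mem_singleton_self _))
    rw [← inner_star_left, hsa]
    exact congrArg (fun f : H →L[ℂ] H => inner ℂ (f v) w) h5.symm
  · ext v
    refine ext_inner_right ℂ fun w => ?_
    refine tendsto_nhds_unique (hF2 T v w) ?_
    simp only [hG3 _ T hT]
    exact tendsto_const_nhds

end General

variable {Γ : Type*} [Group Γ]

/-- A criterion for amenability that only needs vectors: a linear assignment T ↦ Ψ T bounded in the
`L¹` sense is represented by elements of P of norm at most ‖T‖, and uniqueness of the representing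
element makes the result linear. -/
theorem isAmenable_of_map {P : VonNeumannAlgebra (Ell2 Γ)} (hP : P ≤ LG Γ)
    (Ψ : (Ell2 Γ →L[ℂ] Ell2 Γ) →ₗ[ℂ] Ell2 Γ)
    (hb : ∀ T, ∀ w ∈ P, ∀ k ∈ P, IsSelfAdjoint k → ‖w‖ ≤ 1 →
      ‖inner ℂ ((w * k * k) (delta 1)) (Ψ T)‖ ≤ ‖T‖ * ‖k (delta 1)‖ ^ 2)
    (hid : ∀ T ∈ P, ∀ z ∈ P, inner ℂ (z (delta 1)) (Ψ T) = inner ℂ (z (delta 1)) (T (delta 1))) :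
    IsAmenable P := by
  have h1 : ∀ T, ∃ y ∈ P, ‖y‖ ≤ ‖T‖ ∧
      ∀ z ∈ P, inner ℂ (z (delta 1)) (Ψ T) = inner ℂ (z (delta 1)) (y (delta 1)) := fun T =>
    exists_mem_of_bound hP (Ψ T) (norm_nonneg T) (hb T)
  choose E hE1 hE2 hE3 using h1
  have huniq : ∀ y ∈ P, ∀ y' ∈ P, (∀ z ∈ P, inner ℂ (z (delta 1)) (y (delta 1))
      = inner ℂ (z (delta 1)) (y' (delta 1))) → y = y' := fun y hy y' hy' h => by
    have h2 := h (y - y') (sub_mem hy hy')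
    have h3 : (y - y') (delta 1) = 0 := by
      rw [← sub_eq_zero, ← inner_sub_right, ← sub_apply] at h2
      exact inner_self_eq_zero.1 h2
    rw [sub_apply, sub_eq_zero] at h3
    exact ext_of_mem (hP hy) (hP hy') h3
  refine ⟨{ toFun := E, map_add' := fun T T' => ?_, map_smul' := fun c T => ?_ }, hE1, ?_, hE2⟩
  · refine huniq _ (hE1 _) _ (add_mem (hE1 _) (hE1 _)) fun z hz => ?_
    rw [← hE3 _ z hz, map_add, inner_add_right, add_apply, inner_add_right, hE3 _ z hz, hE3 _ z hz]
  · refine huniq _ (hE1 _) _ (vn_smul_mem P c (hE1 _)) fun z hz => ?_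
    rw [← hE3 _ z hz, map_smul, inner_smul_right, smul_apply, inner_smul_right, hE3 _ z hz,
      RingHom.id_apply]
  · exact fun T hT => huniq _ (hE1 _) _ hT fun z hz => by rw [← hE3 _ z hz, hid T hT z hz]

theorem generated_comm {H : Type*} [NormedAddCommGroup H] [InnerProductSpace ℂ H] [CompleteSpace H]
    {S : Set (H →L[ℂ] H)} (hp : ∀ s ∈ S, IsStarProjection s)
    (hc : ∀ s ∈ S, ∀ t ∈ S, s * t = t * s) {x y : H →L[ℂ] H} (hx : x ∈ generated S)
    (hy : y ∈ generated S) : x * y = y * x := by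
  refine (mem_generated.1 hx y fun s hs => ?_).symm
  have hs' : s * y = y * s := mem_generated.1 hy s fun t ht => by
    rw [(hp t ht).isSelfAdjoint.star_eq]
    exact ⟨hc t ht s hs, hc t ht s hs⟩
  rw [(hp s hs).isSelfAdjoint.star_eq]
  exact ⟨hs', hs'⟩

/-- An abelian von Neumann algebra generated by projections is amenable. -/
theorem isAmenable_generated {S : Set (Ell2 Γ →L[ℂ] Ell2 Γ)} (hS : S ⊆ (LG Γ : Set _))
    (hp : ∀ s ∈ S, IsStarProjection s) (hc : ∀ s ∈ S, ∀ t ∈ S, s * t = t * s) :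
    IsAmenable (generated S) := by
  obtain ⟨F, hF1, hF2, hF3⟩ := exists_average S hp hc
  have hcomm : ∀ T, ∀ x ∈ generated S, x * F T = F T * x := fun T x hx =>
    (mem_generated.1 hx (F T) fun s hs => by
      rw [(hp s hs).isSelfAdjoint.star_eq]
      exact ⟨hF2 T s hs, hF2 T s hs⟩).symm
  refine isAmenable_of_map (generated_le hS)
    { toFun := fun T => F T (delta 1)
      map_add' := fun T T' => by rw [map_add, add_apply]
      map_smul' := fun c T => by rw [map_smul, smul_apply, RingHom.id_apply] } ?_ ?_
  · intro T w hw k hk hsk hw1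
    change ‖inner ℂ ((w * k * k) (delta 1)) (F T (delta 1))‖ ≤ _
    have e : inner ℂ ((w * k * k) (delta 1)) (F T (delta 1))
        = inner ℂ (w (k (delta 1))) (F T (k (delta 1))) := by
      have h1 : w * k * k = k * (w * k) := generated_comm hp hc (mul_mem hw hk) hk
      have h2 : F T (k (delta 1)) = k (F T (delta 1)) :=
        congrArg (fun f : Ell2 Γ →L[ℂ] Ell2 Γ => f (delta 1)) (hcomm T k hk).symm
      rw [h1, h2]
      change inner ℂ (k (w (k (delta 1)))) _ = _
      rw [← inner_star_right, hsk.star_eq]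
    rw [e]
    refine (norm_inner_le_norm _ _).trans ?_
    calc ‖w (k (delta 1))‖ * ‖F T (k (delta 1))‖
        ≤ (1 * ‖k (delta 1)‖) * (‖T‖ * ‖k (delta 1)‖) := by
          gcongr
          · exact w.le_of_opNorm_le hw1 _
          · exact (F T).le_of_opNorm_le (hF1 T) _
      _ = ‖T‖ * ‖k (delta 1)‖ ^ 2 := by ring
  · intro T hT z _
    change inner ℂ _ (F T (delta 1)) = _
    rw [hF3 T fun s hs => generated_comm hp hc (subset_generated hs) hT]

end

/-! ### Unitaries, diffuse abelian subalgebras and vanishing of coefficients at infinity -/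

section

open Filter Topology

section General

variable {H : Type*} [NormedAddCommGroup H] [InnerProductSpace ℂ H] [CompleteSpace H]

/-- Take v = a + i(1 − a²)^{1/2}. -/
theorem exists_unitary_add_star {D : VonNeumannAlgebra H} {a : H →L[ℂ] H} (ha : a ∈ D)
    (hsa : IsSelfAdjoint a) (h1 : ‖a‖ ≤ 1) :
    ∃ v ∈ D, v ∈ unitary (H →L[ℂ] H) ∧ a = (2⁻¹ : ℂ) • (v + star v) := by
  set s := cfc (fun t : ℝ => Real.sqrt (1 - t ^ 2)) a with hs
  have hss : IsSelfAdjoint s := cfc_predicate _ a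
  have hsD : s ∈ D := isSelfAdjoint_cfc_mem ha hsa _
  have c1 : ContinuousOn (fun t : ℝ => Real.sqrt (1 - t ^ 2)) (spectrum ℝ a) := by fun_prop
  have c2 : ContinuousOn (fun t : ℝ => t) (spectrum ℝ a) := continuousOn_id
  have c3 : ContinuousOn (fun t : ℝ => t * t) (spectrum ℝ a) := c2.mul c2
  have c4 : ContinuousOn (fun t : ℝ => Real.sqrt (1 - t ^ 2) * Real.sqrt (1 - t ^ 2))
    (spectrum ℝ a) := c1.mul c1
  have hcomm : a * s = s * a := (hsa.commute_cfc (Commute.refl a) _).symm.eq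
  have hsum : a * a + s * s = 1 := by
    rw [hs, ← cfc_mul _ _ a c1 c1]
    nth_rewrite 1 [← cfc_id' ℝ a]
    nth_rewrite 2 [← cfc_id' ℝ a]
    rw [← cfc_mul _ _ a c2 c2, ← cfc_add _ _ _ c3 c4, ← cfc_const_one ℝ a]
    refine cfc_congr fun t ht => ?_
    have h2 : ‖t‖ ≤ 1 := (spectrum.norm_le_norm_mul_of_mem ht).trans (by
      have h3 : ‖(1 : H →L[ℂ] H)‖ ≤ 1 := ContinuousLinearMap.norm_id_le
      nlinarith [norm_nonneg a, norm_nonneg (1 : H →L[ℂ] H)])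
    have h3 : t ^ 2 ≤ 1 := by
      rw [Real.norm_eq_abs] at h2
      exact (sq_le_one_iff_abs_le_one t).2 h2
    rw [Real.mul_self_sqrt (by linarith)]
    ring
  have hI : star (Complex.I • s) = -(Complex.I • s) := by
    rw [star_smul, hss.star_eq, Complex.star_def, Complex.conj_I, neg_smul]
  have hII : Complex.I • Complex.I • (s * s) = -(s * s) := by
    rw [smul_smul, Complex.I_mul_I, neg_one_smul]
  refine ⟨a + Complex.I • s, add_mem ha (vn_smul_mem D _ hsD), ⟨?_, ?_⟩, ?_⟩
  · rw [star_add, hsa.star_eq, hI]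
    simp only [mul_add, add_mul, neg_mul, mul_smul_comm, smul_mul_assoc, hcomm, smul_add,
      smul_neg, hII]
    rw [← hsum]; abel
  · rw [star_add, hsa.star_eq, hI]
    simp only [mul_add, add_mul, mul_neg, mul_smul_comm, smul_mul_assoc, hcomm, smul_add,
      hII]
    rw [← hsum]; abel
  · rw [star_add, hsa.star_eq, hI]
    module

/-- A von Neumann algebra is generated by its unitaries. -/
theorem le_of_unitary_mem {D G : VonNeumannAlgebra H}
    (h : ∀ v ∈ D, v ∈ unitary (H →L[ℂ] H) → v ∈ G) : D ≤ G := by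
  have hsmall : ∀ a ∈ D, IsSelfAdjoint a → a ∈ G := by
    intro a ha hsa
    rcases eq_or_ne a 0 with rfl | h0
    · exact zero_mem G
    have hn : ‖a‖ ≠ 0 := norm_ne_zero_iff.2 h0
    obtain ⟨v, hv, hvu, hav⟩ := exists_unitary_add_star
      (vn_smul_mem D ((‖a‖⁻¹ : ℝ) : ℂ) ha) (by
        rw [IsSelfAdjoint, star_smul, hsa.star_eq, Complex.star_def, Complex.conj_ofReal]) (by
        rw [norm_smul, Complex.norm_of_nonneg (by positivity), inv_mul_cancel₀ hn])
    have h1 : ((‖a‖⁻¹ : ℝ) : ℂ) • a ∈ G := by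
      rw [hav]
      exact vn_smul_mem G _ (add_mem (h v hv hvu) (star_mem (h v hv hvu)))
    have h2 := vn_smul_mem G (‖a‖ : ℂ) h1
    rwa [smul_smul, ← Complex.ofReal_mul, mul_inv_cancel₀ hn, Complex.ofReal_one, one_smul] at h2
  intro x hx
  have hsx : star x ∈ D := star_mem hx
  have h1 := hsmall _ (add_mem hx hsx) (by rw [IsSelfAdjoint, star_add, star_star, add_comm])
  have h2 := hsmall _ (vn_smul_mem D Complex.I (sub_mem hx hsx))
    (by rw [IsSelfAdjoint, star_smul, star_sub, star_star, Complex.star_def, Complex.conj_I,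
      neg_smul, ← smul_neg, neg_sub])
  have hx2 : x = (2⁻¹ : ℂ) • ((x + star x) - Complex.I • (Complex.I • (x - star x))) := by
    rw [smul_smul, Complex.I_mul_I, neg_one_smul, sub_neg_eq_add, add_add_sub_cancel, ← two_smul ℂ x,
      smul_smul]
    norm_num
  rw [hx2]
  exact vn_smul_mem G _ (sub_mem h1 (vn_smul_mem G _ h2))

theorem mem_normalizer_of_commute {A M : VonNeumannAlgebra H} {v : H →L[ℂ] H} (hvM : v ∈ M)
    (hvu : v ∈ unitary (H →L[ℂ] H)) (h : ∀ a ∈ A, a * v = v * a) : v ∈ normalizer A M := by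
  refine ⟨hvM, hvu, ?_⟩
  have h1 : ∀ a ∈ A, v * a * star v = a := fun a ha => by
    rw [← h a ha, mul_assoc, hvu.2, mul_one]
  ext x
  constructor
  · rintro ⟨a, ha, rfl⟩
    change v * a * star v ∈ A
    rw [h1 a ha]; exact ha
  · exact fun hx => ⟨x, hx, h1 x hx⟩

/-- A diffuse von Neumann algebra contains a diffuse abelian one which is generated by its
projections. -/
theorem IsDiffuse.exists_abelian {D : VonNeumannAlgebra H} (hD : IsDiffuse D) :
    ∃ S : Set (H →L[ℂ] H), S ⊆ D ∧ (∀ s ∈ S, IsStarProjection s) ∧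
      (∀ s ∈ S, ∀ t ∈ S, s * t = t * s) ∧ IsDiffuse (generated S) := by
  -- S is a maximal commuting family of projections of D.
  obtain ⟨S, hS⟩ := zorn_subset
    {S : Set (H →L[ℂ] H) | S ⊆ D ∧ (∀ s ∈ S, IsStarProjection s) ∧
      ∀ s ∈ S, ∀ t ∈ S, s * t = t * s} (by
    intro c hc hchain
    refine ⟨⋃₀ c, ⟨Set.sUnion_subset fun S hS => (hc hS).1, ?_, ?_⟩,
      fun S hS => Set.subset_sUnion_of_mem hS⟩
    · rintro s ⟨S, hS, hs⟩
      exact (hc hS).2.1 s hs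
    · rintro s ⟨S, hS, hs⟩ t ⟨T, hT, ht⟩
      rcases hchain.total hS hT with h | h
      · exact (hc hT).2.2 s (h hs) t ht
      · exact (hc hS).2.2 s hs t (h ht))
  obtain ⟨⟨hSD, hSp, hSc⟩, hmax⟩ := hS
  have hins : ∀ r ∈ D, IsStarProjection r → (∀ s ∈ S, r * s = s * r) → r ∈ S := by
    intro r hr hrp hrc
    refine hmax (y := insert r S) ⟨Set.insert_subset hr hSD, ?_, ?_⟩ (Set.subset_insert r S)
      (Set.mem_insert r S)
    · rintro s (rfl | hs)
      · exact hrp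
      · exact hSp s hs
    · rintro s (rfl | hs) t (rfl | ht)
      · rfl
      · exact hrc t ht
      · exact (hrc s hs).symm
      · exact hSc s hs t ht
  refine ⟨S, hSD, hSp, hSc, fun r hr hrp hr0 => ?_⟩
  obtain ⟨r', hr', hrp', hr0', hne, hrr'⟩ := hD r (generated_le hSD hr) hrp hr0
  by_contra hcon
  push Not at hcon
  have hr'r : r' * r = r' := by
    have := congrArg star hrr'
    rwa [star_mul, hrp'.isSelfAdjoint.star_eq, hrp.isSelfAdjoint.star_eq] at this
  -- If r were minimal in the algebra of S, each s in S would act on r as 0 or as the identity. A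
  -- projection r' of D under r would then commute with S and belong to S by maximality.
  refine hcon r' (subset_generated (hins r' hr' hrp' fun s hs => ?_)) hrp' hr0' hne hrr'
  have hsA : s ∈ generated S := subset_generated hs
  have hrs : r * s = s * r := generated_comm hSp hSc hr hsA
  have hsp := hSp s hs
  have hrsp : IsStarProjection (r * s) := hrp.mul hsp hrs
  have hrrs : r * (r * s) = r * s := by rw [← mul_assoc, hrp.isIdempotentElem]
  by_cases h0 : r * s = 0
  · rw [← hr'r, mul_assoc, h0, mul_zero, hr'r, ← hrr', ← mul_assoc, ← hrs, h0, zero_mul]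
  · have h1 : r * s = r := by
      by_contra h1
      exact hcon _ (mul_mem hr hsA) hrsp h0 h1 hrrs
    rw [← hr'r, mul_assoc, h1, hr'r]
    rw [← hrr', ← mul_assoc, ← hrs, h1]

end General

section Coefficients

variable {Γ : Type*} [Group Γ]

/-- For ξ = δ_g the coefficient is, up to conjugation, the value of η at a g, which tends to 0. The
vectors ξ with this property form a closed subspace. -/
theorem tendsto_inner_u (η ξ : Ell2 Γ) :
    Tendsto (fun a : Γ => inner ℂ η (u a ξ)) cofinite (𝓝 0) := by
  let K : Submodule ℂ (Ell2 Γ) :=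
    { carrier := {ξ | Tendsto (fun a : Γ => inner ℂ η (u a ξ)) cofinite (𝓝 0)}
      add_mem' := fun {x y} hx hy => by
        have := Tendsto.add hx hy
        change Tendsto _ _ _
        simpa only [← inner_add_right, ← map_add, add_zero] using this
      zero_mem' := by
        change Tendsto (fun a : Γ => inner ℂ η (u a (0 : Ell2 Γ))) cofinite (𝓝 0)
        simp only [map_zero, inner_zero_right, tendsto_const_nhds]
      smul_mem' := fun c x hx => by
        have := Tendsto.const_mul c hx
        change Tendsto _ _ _
        simpa only [← inner_smul_right, ← map_smul, mul_zero] using this }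
  refine mem_of_delta_mem K ?_ ?_ ξ
  · refine isClosed_of_closure_subset fun ξ hξ => ?_
    change Tendsto _ _ _
    rw [Metric.tendsto_nhds]
    intro ε hε
    obtain ⟨ζ, hζ, hd⟩ := Metric.mem_closure_iff.1 hξ (ε / (2 * (‖η‖ + 1))) (by positivity)
    have h1 := Metric.tendsto_nhds.1 (show Tendsto _ _ _ from hζ) (ε / 2) (by positivity)
    filter_upwards [h1] with a ha
    rw [dist_zero_right] at ha ⊢
    have h2 : ‖inner ℂ η (u a (ξ - ζ))‖ ≤ ε / 2 := by
      refine (norm_inner_le_norm _ _).trans ?_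
      rw [norm_u_apply, ← dist_eq_norm]
      calc ‖η‖ * dist ξ ζ ≤ (‖η‖ + 1) * (ε / (2 * (‖η‖ + 1))) := by
            gcongr
            linarith
        _ = ε / 2 := by field_simp
    have h3 : inner ℂ η (u a ξ) = inner ℂ η (u a ζ) + inner ℂ η (u a (ξ - ζ)) := by
      rw [← inner_add_right, ← map_add, add_sub_cancel]
    rw [h3]
    exact (norm_add_le _ _).trans_lt (by linarith)
  · intro g
    have h2 : 0 < (2 : ENNReal).toReal := by norm_num
    have h1 := ((lp.memℓp η).summable h2).tendsto_cofinite_zero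
    have h3 : Tendsto (fun a : Γ => ‖η (a * g)‖ ^ (2 : ENNReal).toReal) cofinite (𝓝 0) :=
      h1.comp (mul_left_injective g).tendsto_cofinite
    change Tendsto (fun a : Γ => inner ℂ η (u a (delta g))) cofinite (𝓝 0)
    rw [Metric.tendsto_nhds] at h3 ⊢
    intro ε hε
    filter_upwards [h3 (ε ^ 2) (by positivity)] with a ha
    rw [u_delta, ← inner_conj_symm, inner_delta, dist_zero_right, RCLike.norm_conj]
    rw [dist_zero_right, Real.norm_of_nonneg (by positivity)] at ha
    norm_num at ha
    exact lt_of_pow_lt_pow_left₀ 2 hε.le ha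

/-- An algebra which contains infinitely many group elements, locally under `q`, has no minimal
projection `q`. -/
theorem IsMinProj.false_of_infinite {D : VonNeumannAlgebra (Ell2 Γ)} (hD : D ≤ LG Γ)
    {q : Ell2 Γ →L[ℂ] Ell2 Γ} (h : IsMinProj D q) {S : Set Γ} (hS : S.Infinite)
    (hSD : ∀ a ∈ S, ∃ x ∈ D, u a * q = x * q) : False := by
  obtain ⟨n, v, hv, hvq, horth, hspan⟩ := h.exists_matrix_units hD
  have hq := h.2.1
  have hn := norm_projection_pos (hD h.1) h.2.2.1
  set t := ‖q (delta 1)‖ with ht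
  have hvn : ∀ i, ‖v i (delta 1)‖ = t := fun i => by
    have h1 := tau_star_mul_self (v i)
    rw [horth, if_pos rfl, tau_projection hq] at h1
    have h2 : t ^ 2 = ‖v i (delta 1)‖ ^ 2 := by exact_mod_cast h1
    exact ((sq_eq_sq₀ hn.le (norm_nonneg _)).1 h2).symm
  -- The coefficient of u_a q along v_i is this inner product divided by t². The bound keeps each of
  -- the n coefficients below 1/(n + 1), so together they cannot reach the norm t of u_a q δ_1.
  have h1 : ∀ᶠ a in cofinite, ∀ i, ‖inner ℂ (v i (delta 1)) (u a (q (delta 1)))‖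
      < t ^ 2 / (n + 1) := by
    refine eventually_all.2 fun i => ?_
    have := Metric.tendsto_nhds.1 (tendsto_inner_u (v i (delta 1)) (q (delta 1)))
      (t ^ 2 / (n + 1)) (by positivity)
    simpa only [dist_zero_right] using this
  obtain ⟨a, haS, ha⟩ := (frequently_cofinite_iff_infinite.2 hS).and_eventually h1 |>.exists
  obtain ⟨x, hx, hxq⟩ := hSD a haS
  obtain ⟨c, hc⟩ := hspan x hx
  rw [← hxq] at hc
  have hci : ∀ i, ‖c i‖ * t ^ 2 < t ^ 2 / (n + 1) := fun i => by
    have h2 : star (v i) * (u a * q) = c i • q := by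
      rw [hc, Finset.mul_sum]
      simp only [mul_smul_comm, horth, smul_ite, smul_zero, Finset.sum_ite_eq, Finset.mem_univ,
        if_true]
    have h3 : inner ℂ (v i (delta 1)) (u a (q (delta 1))) = c i * ((t ^ 2 : ℝ) : ℂ) := by
      have := tau_star_mul (v i) (u a * q)
      rw [h2, tau_smul, tau_projection hq] at this
      exact this.symm
    have h4 := ha i
    rwa [h3, norm_mul, Complex.norm_of_nonneg (by positivity)] at h4
  have hci' : ∀ i, ‖c i‖ ≤ 1 / (n + 1) := fun i => by
    have h2 := hci i
    rw [div_eq_mul_one_div, mul_comm] at h2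
    exact (lt_of_mul_lt_mul_left h2 (by positivity)).le
  have h5 : t ≤ ∑ _i : Fin n, 1 / ((n : ℝ) + 1) * t := by
    calc t = ‖(u a * q) (delta 1)‖ := (norm_u_apply a _).symm
      _ ≤ ∑ i, ‖c i‖ * t := by
          rw [hc, sum_apply]
          refine (norm_sum_le _ _).trans (Finset.sum_le_sum fun i _ => ?_)
          rw [smul_apply, norm_smul, hvn]
      _ ≤ _ := Finset.sum_le_sum fun i _ => mul_le_mul_of_nonneg_right (hci' i) hn.le
  rw [Finset.sum_const, Finset.card_univ, Fintype.card_fin, nsmul_eq_mul] at h5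
  have h6 : (n : ℝ) * (1 / ((n : ℝ) + 1) * t) = t - t / (n + 1) := by field_simp; ring
  rw [h6] at h5
  have : 0 < t / (n + 1) := by positivity
  linarith

end Coefficients

end

/-! ### Solidity makes the relative commutant of a nonamenable factor atomic -/

section

section General

variable {H : Type*} [NormedAddCommGroup H] [InnerProductSpace ℂ H] [CompleteSpace H]

theorem IsSolid.exists_isAmenable {M : VonNeumannAlgebra H} (h : IsSolid M)
    (A : VonNeumannAlgebra H) (hA : A ≤ M) (hd : IsDiffuse A) (_ : IsAmenable A) :
    ∃ G : VonNeumannAlgebra H, G ≤ M ∧ IsAmenable G ∧ relCommutant A M ≤ G :=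
  ⟨_, relCommutant_le _ _, h A hA hd, le_rfl⟩

/-- Unitaries commuting with A normalize it, and they generate the relative commutant. This gives
the same conclusion as for solid algebras, so one argument serves both cases. -/
theorem IsStronglySolid.exists_isAmenable {M : VonNeumannAlgebra H} (h : IsStronglySolid M)
    (A : VonNeumannAlgebra H) (hA : A ≤ M) (hd : IsDiffuse A) (ha : IsAmenable A) :
    ∃ G : VonNeumannAlgebra H, G ≤ M ∧ IsAmenable G ∧ relCommutant A M ≤ G := by
  refine ⟨_, generated_le fun v hv => hv.1, h A hA hd ha, le_of_unitary_mem fun v hv hvu => ?_⟩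
  obtain ⟨hvM, hvc⟩ := mem_relCommutant.1 hv
  exact subset_generated (mem_normalizer_of_commute hvM hvu hvc)

end General

section Amenable

variable {Γ : Type*} [Group Γ]

theorem norm_mul_apply_le {H : Type*} [NormedAddCommGroup H] [InnerProductSpace ℂ H]
    (x y : H →L[ℂ] H) (v : H) : ‖(x * y) v‖ ≤ ‖x‖ * ‖y v‖ := by
  rw [mul_apply_eq_comp]
  exact x.le_opNorm _

/-- A factor is amenable if its compression by a projection commuting with it is contained in an
amenable von Neumann algebra. -/
theorem isAmenable_of_compression {G N : VonNeumannAlgebra (Ell2 Γ)} (hG : G ≤ LG Γ)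
    (hGa : IsAmenable G) (hN : N ≤ LG Γ) (hf : IsFactor N) {p : Ell2 Γ →L[ℂ] Ell2 Γ}
    (hp : p ∈ relCommutant N (LG Γ)) (hpp : IsStarProjection p) (hp0 : p ≠ 0)
    (hx : ∀ x ∈ N, x * p ∈ G) : IsAmenable N := by
  obtain ⟨E, hEm, hEi, hEn⟩ := hGa
  obtain ⟨hpM, hpc⟩ := mem_relCommutant.1 hp
  have htpos := norm_projection_pos hpM hp0
  have hτ := tau_projection hpp
  set t : ℝ := ‖p (delta 1)‖ ^ 2 with ht
  have ht0 : 0 < t := by positivity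
  have htC : (t : ℂ) ≠ 0 := by exact_mod_cast ht0.ne'
  have hnorm : ∀ k ∈ N, IsSelfAdjoint k → ‖(p * k) (delta 1)‖ ^ 2 = t * ‖k (delta 1)‖ ^ 2 := by
    intro k hk hks
    have h1 := tau_star_mul_self (p * k)
    have h2 : star (p * k) * (p * k) = k * (p * k) := by
      rw [star_mul, hks.star_eq, hpp.isSelfAdjoint.star_eq, mul_assoc, ← mul_assoc p,
        hpp.isIdempotentElem]
    rw [h2, tau_comm (hN hk) (mul_mem hpM (hN hk)), mul_assoc,
      tau_mul_of_mem_relCommutant hN hf hp (mul_mem hk hk), hτ] at h1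
    have h3 := tau_star_mul_self k
    rw [hks.star_eq] at h3
    rw [h3] at h1
    exact_mod_cast h1.symm
  -- Compress T by p, apply the expectation E onto G, compress again, and divide by t = τ(p).
  -- Independence of p from N makes ‖p k δ_1‖² equal to t‖kδ_1‖², which gives the bound, and makes
  -- the map the identity on N.
  refine isAmenable_of_map hN
    { toFun := fun T => (t : ℂ)⁻¹ • (p * E (p * T * p) * p) (delta 1)
      map_add' := fun S T => by
        simp only [mul_add, add_mul, map_add, add_apply, smul_add]
      map_smul' := fun c T => by
        simp only [mul_smul_comm, smul_mul_assoc, map_smul, smul_apply, RingHom.id_apply]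
        rw [smul_comm] } ?_ ?_
  · intro T w hw k hk hks hw1
    set y := E (p * T * p) with hy
    have hyM : y ∈ LG Γ := hG (hEm _)
    have hyn : ‖y‖ ≤ ‖T‖ := by
      refine (hEn _).trans ((norm_mul_le _ _).trans ?_)
      have h1 := hpp.norm_le
      have h2 := norm_mul_le p T
      have h3 : ‖p * T‖ ≤ ‖T‖ := h2.trans (mul_le_of_le_one_left (norm_nonneg _) h1)
      exact (mul_le_of_le_one_right (norm_nonneg _) h1).trans h3
    have hkM := hN hk
    have hwM := hN hw
    have h1 : inner ℂ ((w * k * k) (delta 1)) ((p * y * p) (delta 1)) =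
        inner ℂ ((w * (p * k)) (delta 1)) ((y * (p * k)) (delta 1)) := by
      rw [← tau_star_mul, ← tau_star_mul]
      have h2 : star (w * k * k) * (p * y * p) = k * (k * star w * (p * y * p)) := by
        simp only [star_mul, hks.star_eq, mul_assoc]
      rw [h2, tau_comm hkM (mul_mem (mul_mem hkM (star_mem hwM)) (mul_mem (mul_mem hpM hyM) hpM))]
      congr 1
      have h3 : k * star w * p = k * p * star w := by
        rw [mul_assoc, hpc _ (star_mem hw), mul_assoc]
      simp only [star_mul, hks.star_eq, hpp.isSelfAdjoint.star_eq]
      rw [← h3]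
      simp only [mul_assoc]
    have h4 := hnorm k hk hks
    have h5 : ‖inner ℂ ((w * (p * k)) (delta 1)) ((y * (p * k)) (delta 1))‖ ≤
        ‖T‖ * (t * ‖k (delta 1)‖ ^ 2) := by
      rw [← h4]
      refine (norm_inner_le_norm _ _).trans ?_
      calc _ ≤ (‖w‖ * ‖(p * k) (delta 1)‖) * (‖y‖ * ‖(p * k) (delta 1)‖) := by
            gcongr <;> exact norm_mul_apply_le _ _ _
        _ ≤ (1 * ‖(p * k) (delta 1)‖) * (‖T‖ * ‖(p * k) (delta 1)‖) := by gcongr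
        _ = _ := by ring
    change ‖inner ℂ ((w * k * k) (delta 1)) ((t : ℂ)⁻¹ • (p * y * p) (delta 1))‖ ≤ _
    rw [inner_smul_right, norm_mul, h1, norm_inv, Complex.norm_of_nonneg ht0.le]
    calc _ ≤ t⁻¹ * (‖T‖ * (t * ‖k (delta 1)‖ ^ 2)) := by gcongr
      _ = _ := by field_simp
  · intro T hT z hz
    have h1 : p * T * p = T * p := by
      rw [← hpc T hT, mul_assoc, hpp.isIdempotentElem]
    change inner ℂ (z (delta 1)) ((t : ℂ)⁻¹ • (p * E (p * T * p) * p) (delta 1)) = _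
    rw [h1, hEi _ (hx T hT), ← mul_assoc, h1, mul_assoc, hpp.isIdempotentElem, inner_smul_right,
      ← tau_star_mul, ← tau_star_mul, ← mul_assoc, tau_comm
      (mul_mem (star_mem (hN hz)) (hN hT)) hpM,
      tau_mul_of_mem_relCommutant hN hf hp (mul_mem (star_mem hz) hT), hτ, ← mul_assoc,
      inv_mul_cancel₀ htC, one_mul]

theorem isDiffuse_LG [Infinite Γ] : IsDiffuse (LG Γ) := by
  by_contra h
  obtain ⟨q, hq⟩ := exists_isMinProj_of_not_isDiffuse h
  exact hq.false_of_infinite le_rfl Set.infinite_univ fun a _ => ⟨u a, u_mem a, rfl⟩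

/-- If every diffuse amenable subalgebra of `L(Γ)` has its relative commutant in an amenable
subalgebra, then the relative commutant of a nonamenable factor is atomic. -/
theorem exists_isMinProj_le [Infinite Γ] {N : VonNeumannAlgebra (Ell2 Γ)} (hN : N ≤ LG Γ)
    (hf : IsFactor N) (hNa : ¬ IsAmenable N)
    (hS : ∀ A : VonNeumannAlgebra (Ell2 Γ), A ≤ LG Γ → IsDiffuse A → IsAmenable A →
      ∃ G : VonNeumannAlgebra (Ell2 Γ), G ≤ LG Γ ∧ IsAmenable G ∧ relCommutant A (LG Γ) ≤ G)
    {p : Ell2 Γ →L[ℂ] Ell2 Γ} (hp : p ∈ relCommutant N (LG Γ)) (hpp : IsStarProjection p)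
    (hp0 : p ≠ 0) : ∃ q, IsMinProj (relCommutant N (LG Γ)) q ∧ p * q = q := by
  by_contra! hcon
  obtain ⟨hpM, hpc⟩ := mem_relCommutant.1 hp
  -- Including p itself makes D split along p: under p it consists of elements commuting with N, and
  -- under 1 − p of everything in L(Γ).
  set X : Set (Ell2 Γ →L[ℂ] Ell2 Γ) := insert p ((fun x => x * p) '' (N : Set _)) with hX
  set D := relCommutant (generated X) (LG Γ) with hD
  have hXg := subset_generated (S := X)
  have hXp : p ∈ generated X := hXg (Set.mem_insert _ _)
  have hXx : ∀ x ∈ N, x * p ∈ generated X := fun x hx =>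
    hXg (Set.mem_insert_of_mem _ ⟨x, hx, rfl⟩)
  have hmemD : ∀ r ∈ LG Γ, p * r = r * p → (∀ x ∈ N, x * p * r = r * (x * p)) → r ∈ D := by
    intro r hr h1 h2
    refine mem_relCommutant.2 ⟨hr, fun y hy => ?_⟩
    refine (mem_generated.1 hy r ?_).symm
    rintro s (rfl | ⟨x, hx, rfl⟩)
    · exact ⟨h1, by rw [hpp.isSelfAdjoint.star_eq, h1]⟩
    · refine ⟨h2 x hx, ?_⟩
      have : star (x * p) = star x * p := by
        rw [star_mul, hpp.isSelfAdjoint.star_eq, hpc _ (star_mem hx)]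
      change star (x * p) * r = r * star (x * p)
      rw [this]
      exact h2 _ (star_mem hx)
  have hproj : ∀ {r s : Ell2 Γ →L[ℂ] Ell2 Γ}, IsStarProjection r → IsStarProjection s →
      s * r = r → r * s = r := fun hr hs h => by
    have := congrArg star h
    rwa [star_mul, hr.isSelfAdjoint.star_eq, hs.isSelfAdjoint.star_eq] at this
  have hdiff : IsDiffuse D := by
    intro r hr hrp hr0
    obtain ⟨hrM, hrc⟩ := mem_relCommutant.1 hr
    have hpr := hrc p hXp
    -- If r is orthogonal to p, diffuseness of L(Γ) gives a smaller projection. Otherwise r p is a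
    -- projection of N' ∩ L(Γ) under p, hence not minimal there by assumption.
    by_cases h0 : r * p = 0
    · obtain ⟨s, hs, hsp, hs0, hsr, hrs⟩ := isDiffuse_LG r hrM hrp hr0
      have hps : p * s = 0 := by rw [← hrs, ← mul_assoc, hpr, h0, zero_mul]
      have hsp' : s * p = 0 := by rw [← hproj hsp hrp hrs, mul_assoc, h0, mul_zero]
      refine ⟨s, hmemD s hs (hps.trans hsp'.symm) fun x hx => ?_, hsp, hs0, hsr, hrs⟩
      rw [mul_assoc, hps, hpc x hx, ← mul_assoc, hsp', mul_zero, zero_mul]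
    · have hrpp : IsStarProjection (r * p) := hrp.mul hpp hpr.symm
      have hrpB : r * p ∈ relCommutant N (LG Γ) := by
        refine mem_relCommutant.2 ⟨mul_mem hrM hpM, fun y hy => ?_⟩
        rw [← hpr, ← mul_assoc, hrc _ (hXx y hy), hpc y hy, ← mul_assoc, hpr]
      have hnot : ¬ IsMinProj (relCommutant N (LG Γ)) (r * p) := fun h =>
        hcon _ h (by rw [← mul_assoc, hpr, mul_assoc, hpp.isIdempotentElem])
      unfold IsMinProj at hnot
      push Not at hnot
      obtain ⟨s, hs, hsp, hrs, hs0, hsr⟩ := hnot hrpB hrpp h0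
      obtain ⟨hsM, hsc⟩ := mem_relCommutant.1 hs
      have hps : p * s = s := by
        rw [← hrs, ← mul_assoc, ← mul_assoc, hpr, mul_assoc r, hpp.isIdempotentElem]
      have hsp' := hproj hsp hpp hps
      have hrs' : r * s = s := by
        rw [← hrs, ← mul_assoc, ← mul_assoc, hrp.isIdempotentElem]
      refine ⟨s, hmemD s hsM (hps.trans hsp'.symm) fun x hx => ?_, hsp, hs0, ?_, hrs'⟩
      · rw [mul_assoc, hps, hpc x hx, ← mul_assoc, hsp', hsc x hx]
      · rintro rfl
        exact hsr hsp'.symm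
  obtain ⟨S, hSD, hSp, hSc, hSd⟩ := hdiff.exists_abelian
  have hAD : generated S ≤ D := generated_le hSD
  have hDM : D ≤ LG Γ := relCommutant_le _ _
  obtain ⟨G, hGM, hGa, hG⟩ := hS _ (hAD.trans hDM) hSd
    (isAmenable_generated (fun s hs => hDM (hSD hs)) hSp hSc)
  refine hNa (isAmenable_of_compression hGM hGa hN hf hp hpp hp0 fun x hx => hG ?_)
  exact mem_relCommutant.2 ⟨mul_mem (hN hx) hpM, fun y hy =>
    ((mem_relCommutant.1 (hAD hy)).2 _ (hXx x hx)).symm⟩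

end Amenable

end

/-! ### Polynomial growth of conjugation invariant finite sets -/

section

open Filter Topology

section Growth

variable {Γ : Type*}

theorem norm_sum_delta_sq (F : Finset Γ) : ‖∑ g ∈ F, delta g‖ ^ 2 = F.card := by
  classical
  have h1 : inner ℂ (∑ g ∈ F, delta g) (∑ g ∈ F, delta g) = ((F.card : ℝ) : ℂ) := by
    rw [sum_inner, Finset.sum_congr rfl fun g hg => by
      rw [inner_sum, Finset.sum_eq_single g (fun h _ hh => inner_delta_delta_ne hh.symm)
        (fun h => absurd hg h), inner_delta_delta_self], Finset.sum_const, nsmul_eq_mul, mul_one,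
      Complex.ofReal_natCast]
  rw [norm_sq_eq_re_inner (𝕜 := ℂ), h1]
  exact Complex.ofReal_re _

variable [Group Γ]

open scoped Pointwise in
/-- Products of elements of a finite set which is invariant under conjugation grow polynomially. -/
theorem card_pow_le [DecidableEq Γ] {S : Finset Γ} (hS : ∀ b ∈ S, ∀ c ∈ S, c⁻¹ * b * c ∈ S)
    (n : ℕ) : (S ^ n).card ≤ (n + 1) ^ S.card := by
  classical
  -- Count the words of length n that cannot begin with any letter outside T, by induction on T; T =
  -- S gives the claim.
  suffices h : ∀ T : Finset Γ, T ⊆ S → ∀ n : ℕ, ((S ^ n).filter fun g =>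
      ∀ b ∈ S, b ∉ T → ∀ m, n = m + 1 → b⁻¹ * g ∉ S ^ m).card ≤ (n + 1) ^ T.card by
    have h1 := h S subset_rfl n
    rwa [Finset.filter_true_of_mem fun g _ b hb hb' => absurd hb hb'] at h1
  intro T
  induction T using Finset.induction with
  | empty =>
    intro _ n
    rw [Finset.card_empty, pow_zero]
    refine (Finset.card_le_card (t := {1}) fun g hg => ?_).trans_eq (Finset.card_singleton _)
    obtain ⟨hg1, hg2⟩ := Finset.mem_filter.1 hg
    cases n with
    | zero => simpa using hg1
    | succ m =>
      rw [pow_succ'] at hg1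
      obtain ⟨b, hb, w, hw, rfl⟩ := Finset.mem_mul.1 hg1
      exact absurd (by rwa [inv_mul_cancel_left]) (hg2 b hb (Finset.notMem_empty _) m rfl)
  | insert b T hbT ih =>
    intro hTS n
    obtain ⟨hbS, hTS⟩ := Finset.insert_subset_iff.1 hTS
    rw [Finset.card_insert_of_notMem hbT]
    calc _ ≤ ((Finset.range (n + 1)).biUnion fun k => ((S ^ (n - k)).filter fun g =>
          ∀ b ∈ S, b ∉ T → ∀ m, n - k = m + 1 → b⁻¹ * g ∉ S ^ m).image fun g => b ^ k * g).card := by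
          refine Finset.card_le_card fun g hg => ?_
          obtain ⟨hg1, hg2⟩ := Finset.mem_filter.1 hg
          have hP0 : (b ^ 0)⁻¹ * g ∈ S ^ (n - 0) := by simpa using hg1
          -- Split off the largest power of b. What remains cannot begin with b, and there are n + 1
          -- possible exponents.
          obtain ⟨k, hk⟩ : ∃ k, k = Nat.findGreatest (fun k => (b ^ k)⁻¹ * g ∈ S ^ (n - k)) n :=
            ⟨_, rfl⟩
          have hkn : k ≤ n := hk ▸ Nat.findGreatest_le n
          have hkP : (b ^ k)⁻¹ * g ∈ S ^ (n - k) := by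
            rw [hk]
            exact Nat.findGreatest_spec (P := fun k => (b ^ k)⁻¹ * g ∈ S ^ (n - k)) n.zero_le hP0
          refine Finset.mem_biUnion.2 ⟨k, Finset.mem_range.2 (by omega),
            Finset.mem_image.2 ⟨(b ^ k)⁻¹ * g, Finset.mem_filter.2 ⟨hkP, ?_⟩, by group⟩⟩
          intro c hc hcT m hm hcm
          by_cases hcb : c = b
          · subst hcb
            have h1 := Nat.le_findGreatest (P := fun k => (c ^ k)⁻¹ * g ∈ S ^ (n - k))
              (show k + 1 ≤ n by omega) (by
                have h2 : n - (k + 1) = m := by omega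
                rwa [h2, pow_succ, mul_inv_rev, mul_assoc])
            omega
          · refine hg2 c hc (by simp [hcb, hcT]) (k + m) (by omega) ?_
            -- A letter c that could begin the remainder can be moved in front of b^k at the price
            -- of conjugating b, which stays in S; so g itself could begin with c.
            have h1 : c⁻¹ * g = (c⁻¹ * b * c) ^ k * (c⁻¹ * ((b ^ k)⁻¹ * g)) := by
              have h2 : (c⁻¹ * b * c) ^ k = c⁻¹ * b ^ k * c := by
                simpa using conj_pow (i := k) (a := c⁻¹) (b := b)
              rw [h2]
              group
            rw [h1, pow_add]
            exact Finset.mul_mem_mul (Finset.pow_mem_pow (hS b hbS c hc)) hcm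
      _ ≤ ∑ k ∈ Finset.range (n + 1), (n + 1) ^ T.card := by
          refine Finset.card_biUnion_le.trans (Finset.sum_le_sum fun k _ => ?_)
          refine Finset.card_image_le.trans ((ih hTS (n - k)).trans ?_)
          exact Nat.pow_le_pow_left (by omega) _
      _ = (n + 1) ^ (T.card + 1) := by
          rw [Finset.sum_const, Finset.card_range, smul_eq_mul, pow_succ']

-- The n-th power of the sum of the u_b, applied to δ_h, is the sum of δ_{wh} over all |S|^n words
-- w, repetitions counted; F contains all their endpoints.
open scoped Pointwise in
theorem inner_sum_delta_pow [DecidableEq Γ] (S : Finset Γ) (n : ℕ) (h : Γ) (F : Finset Γ)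
    (hF : ∀ g ∈ S ^ n, g * h ∈ F) :
    inner ℂ (∑ g ∈ F, delta g) (((∑ b ∈ S, u b) ^ n) (delta h)) = ((S.card ^ n : ℕ) : ℂ) := by
  induction n generalizing h with
  | zero =>
    have hh : h ∈ F := by simpa using hF
    rw [pow_zero, pow_zero, one_apply_eq_self, sum_inner, Finset.sum_eq_single h,
      inner_delta_delta_self, Nat.cast_one]
    · exact fun g _ hg => inner_delta_delta_ne hg
    · exact fun h' => absurd hh h'
  | succ n ih =>
    rw [pow_succ, mul_apply_eq_comp, sum_apply, map_sum, inner_sum, Finset.sum_congr rfl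
      fun b hb => by
        rw [u_delta, ih (b * h) fun g hg => by
          rw [← mul_assoc]
          exact hF _ (by rw [pow_succ]; exact Finset.mul_mem_mul hg hb)]]
    rw [Finset.sum_const, nsmul_eq_mul, pow_succ', Nat.cast_mul]

open scoped Pointwise in
/-- The sum of a finite conjugation invariant set in the left regular representation has the
largest possible norm. -/
theorem card_le_norm_sum_u {S : Finset Γ} (hS : ∀ b ∈ S, ∀ c ∈ S, c⁻¹ * b * c ∈ S) :
    (S.card : ℝ) ≤ ‖∑ b ∈ S, u b‖ := by
  classical
  rcases S.eq_empty_or_nonempty with rfl | hne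
  · simp
  have hc : (0 : ℝ) < S.card := by exact_mod_cast hne.card_pos
  set V := ∑ b ∈ S, u b with hV
  by_contra! hlt
  -- Cauchy-Schwarz gives |S|^n ≤ |S^n|^{1/2}‖V‖^n, and |S^n| grows polynomially. If ‖V‖ were below
  -- |S|, an exponential decay would defeat the polynomial.
  have hmain : ∀ n : ℕ, ((S.card : ℝ) ^ 2) ^ n ≤ ((n + 1 : ℕ) : ℝ) ^ S.card * (‖V‖ ^ 2) ^ n := by
    intro n
    have h1 := inner_sum_delta_pow S n 1 (S ^ n) (by simp)
    have h2 := norm_inner_le_norm (𝕜 := ℂ) (∑ g ∈ S ^ n, delta g) ((V ^ n) (delta 1))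
    rw [← hV] at h1
    rw [h1, Complex.norm_natCast, Nat.cast_pow] at h2
    have h3 : ‖(V ^ n) (delta 1)‖ ≤ ‖V‖ ^ n := by
      clear h1 h2
      induction n with
      | zero => rw [pow_zero, pow_zero, one_apply_eq_self, norm_delta]
      | succ n ih =>
        rw [pow_succ', pow_succ']
        exact (norm_mul_apply_le _ _ _).trans (by gcongr)
    calc ((S.card : ℝ) ^ 2) ^ n = ((S.card : ℝ) ^ n) ^ 2 := by rw [← pow_mul, ← pow_mul, mul_comm]
      _ ≤ (‖∑ g ∈ S ^ n, delta g‖ * ‖V‖ ^ n) ^ 2 :=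
          pow_le_pow_left₀ (by positivity) (h2.trans (by gcongr)) 2
      _ = ((S ^ n).card : ℝ) * (‖V‖ ^ 2) ^ n := by
          rw [mul_pow, norm_sum_delta_sq, ← pow_mul, ← pow_mul, mul_comm 2]
      _ ≤ _ := by
          gcongr
          exact_mod_cast card_pow_le hS n
  set r := ‖V‖ ^ 2 / (S.card : ℝ) ^ 2 with hr
  have hr0 : 0 ≤ r := by positivity
  have hr1 : r < 1 := by
    rw [hr, div_lt_one (by positivity)]
    exact pow_lt_pow_left₀ hlt (norm_nonneg _) two_ne_zero
  have hmain' : ∀ n : ℕ, 1 ≤ ((n + 1 : ℕ) : ℝ) ^ S.card * r ^ n := fun n => by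
    rw [hr, div_pow, ← mul_div_assoc, one_le_div (by positivity)]
    exact hmain n
  have hlim := (tendsto_pow_const_mul_const_pow_of_abs_lt_one S.card
    (by rwa [abs_of_nonneg hr0] : |r| < 1)).comp (tendsto_add_atTop_nat 1)
  have h1 : r ≤ 0 := by
    refine ge_of_tendsto hlim (Eventually.of_forall fun n => ?_)
    change r ≤ ((n + 1 : ℕ) : ℝ) ^ S.card * r ^ (n + 1)
    rw [pow_succ, ← mul_assoc]
    exact le_mul_of_one_le_left hr0 (hmain' n)
  have h2 := hmain' 1
  rw [le_antisymm h1 hr0] at h2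
  norm_num at h2

end Growth

end

/-! ### Finite conjugacy classes in Λ -/

section

section Finite

variable {Γ : Type*} [Group Γ]

theorem norm_apply_of_mem_unitary {H : Type*} [NormedAddCommGroup H] [InnerProductSpace ℂ H]
    [CompleteSpace H] {v : H →L[ℂ] H} (hv : v ∈ unitary (H →L[ℂ] H)) (ξ : H) : ‖v ξ‖ = ‖ξ‖ := by
  have h : inner ℂ (v ξ) (v ξ) = inner ℂ ξ ξ := by
    rw [← inner_star_right, ← mul_apply_eq_comp, hv.1, one_apply_eq_self]
  rw [norm_eq_sqrt_re_inner (𝕜 := ℂ), norm_eq_sqrt_re_inner (𝕜 := ℂ), h]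

variable (Γ) in
/-- The subgroup of elements with a finite conjugacy class. -/
def fcSubgroup : Subgroup Γ where
  carrier := {a | (Set.range fun g : Γ => g * a * g⁻¹).Finite}
  one_mem' := by
    refine (Set.finite_singleton (1 : Γ)).subset ?_
    rintro _ ⟨g, rfl⟩
    simp
  mul_mem' := fun {a b} ha hb => by
    refine (Set.Finite.image2 (fun x y => x * y) ha hb).subset ?_
    rintro _ ⟨g, rfl⟩
    exact ⟨_, ⟨g, rfl⟩, _, ⟨g, rfl⟩, by simp only; group⟩
  inv_mem' := fun {a} ha => by
    refine (Set.Finite.image (fun x => x⁻¹) ha).subset ?_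
    rintro _ ⟨g, rfl⟩
    exact ⟨_, ⟨g, rfl⟩, by simp only; group⟩

theorem mem_fcSubgroup {a : Γ} :
    a ∈ fcSubgroup Γ ↔ (Set.range fun g : Γ => g * a * g⁻¹).Finite := Iff.rfl

theorem conj_mem_range (a g x : Γ) : x ∈ Set.range (fun g : Γ => g * a * g⁻¹) ↔
    g * x * g⁻¹ ∈ Set.range (fun g : Γ => g * a * g⁻¹) := by
  constructor
  · rintro ⟨h, rfl⟩
    exact ⟨g * h, by simp only; group⟩
  · rintro ⟨h, hh⟩
    refine ⟨g⁻¹ * h, ?_⟩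
    have h1 : x = g⁻¹ * (g * x * g⁻¹) * g := by group
    rw [h1, ← hh]
    group

theorem u_mul_sum_conj {C : Finset Γ} {g : Γ} (hC : ∀ x, x ∈ C ↔ g * x * g⁻¹ ∈ C) :
    u g * ∑ b ∈ C, u b = (∑ b ∈ C, u b) * u g := by
  rw [Finset.mul_sum, Finset.sum_mul]
  refine Finset.sum_bij (fun x _ => g * x * g⁻¹) (fun x hx => (hC x).1 hx)
    (fun x _ y _ h => by simpa using h) (fun y hy => ⟨g⁻¹ * y * g, (hC _).2 ?_, by group⟩)
    fun x _ => ?_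
  · have h1 : g * (g⁻¹ * y * g) * g⁻¹ = y := by group
    rwa [h1]
  · rw [← u_mul, ← u_mul]
    congr 1
    group

/-- If `u_a = v w` with `v` in a factor `N` and `w` in its commutant, and `a` has finitely many
conjugates, then `v` is a scalar. -/
theorem u_mem_relCommutant_of_finite {N : VonNeumannAlgebra (Ell2 Γ)} (hN : N ≤ LG Γ)
    (hf : IsFactor N) {a : Γ} (ha : a ∈ innerSubgroup N) (hfin : a ∈ fcSubgroup Γ) :
    u a ∈ relCommutant N (LG Γ) := by
  classical
  obtain ⟨v, hv, hvu, hw⟩ := mem_innerSubgroup.1 ha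
  set w := star v * u a with hwdef
  have hvM := hN hv
  have hwM : w ∈ LG Γ := mul_mem (star_mem hvM) (u_mem a)
  have hwc : ∀ x ∈ N, x * w = w * x := fun x hx => commute_of_mem hx hw
  have hwB : w ∈ relCommutant N (LG Γ) := mem_relCommutant.2 ⟨hwM, hwc⟩
  have hvw : u a = v * w := by rw [hwdef, ← mul_assoc, hvu.2, one_mul]
  have hwn : ∀ ξ, ‖w ξ‖ = ‖ξ‖ := fun ξ => by
    rw [hwdef, mul_apply_eq_comp, norm_apply_of_mem_unitary (Unitary.star_mem hvu), norm_u_apply]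
  set Z := relCommutant (LG Γ) (LG Γ) with hZ
  have hZM : Z ≤ LG Γ := relCommutant_le _ _
  have hZc : ∀ z ∈ Z, ∀ y ∈ LG Γ, y * z = z * y := fun z hz => (mem_relCommutant.1 hz).2
  have hZB : ∀ z ∈ Z, z ∈ relCommutant N (LG Γ) := fun z hz =>
    mem_relCommutant.2 ⟨hZM hz, fun y hy => hZc z hz y (hN hy)⟩
  -- y is the expectation of u_a = v w onto the centre Z of L(Γ). Independence pulls out the factor
  -- τ(v), which is where the bound ‖y‖ ≤ |τ(v)| comes from.
  obtain ⟨y, hyZ, hyn, hy⟩ := exists_mem_of_bound hZM (u a (delta 1)) (norm_nonneg (τ v)) (by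
    intro w' hw' k hk hks hw1
    have hz : w' * k * k ∈ Z := mul_mem (mul_mem hw' hk) hk
    have h1 : star (w' * k * k) * u a = star (w' * k * k) * w * v := by
      rw [hvw, hwc v hv, ← mul_assoc]
    rw [← tau_star_mul, h1, tau_mul_of_mem_relCommutant hN hf
      (mul_mem (hZB _ (star_mem hz)) hwB) hv, norm_mul, mul_comm]
    refine mul_le_mul_of_nonneg_left ?_ (norm_nonneg _)
    have h2 : star (w' * k * k) * w = k * (k * star w' * w) := by
      simp only [star_mul, hks.star_eq, mul_assoc]
    have h3 : k * star w' * w * k = star (w' * k) * (w * k) := by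
      simp only [star_mul, hks.star_eq, mul_assoc]
    rw [h2, tau_comm (hZM hk) (mul_mem (mul_mem (hZM hk) (star_mem (hZM hw'))) hwM), h3,
      tau_star_mul]
    refine (norm_inner_le_norm _ _).trans ?_
    rw [mul_apply_eq_comp w, hwn, sq]
    refine mul_le_mul_of_nonneg_right ((norm_mul_apply_le _ _ _).trans ?_) (norm_nonneg _)
    exact mul_le_of_le_one_left (norm_nonneg _) hw1)
  set C := (mem_fcSubgroup.1 hfin).toFinset with hC
  have hCmem : ∀ x, x ∈ C ↔ x ∈ Set.range (fun g : Γ => g * a * g⁻¹) := fun x =>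
    Set.Finite.mem_toFinset _
  have hCc : ∀ g x, x ∈ C ↔ g * x * g⁻¹ ∈ C := fun g x => by
    rw [hCmem, hCmem]
    exact conj_mem_range a g x
  have hAZ : ∑ b ∈ C, u b ∈ Z := by
    refine mem_relCommutant.2 ⟨sum_mem fun b _ => u_mem b, fun x hx => ?_⟩
    exact mem_commutant_L (fun g _ => u_mul_sum_conj (hCc g)) hx
  -- Conjugate group elements have the same trace against Z, so the central class sum is |C| times
  -- y.
  have hAy : ∑ b ∈ C, u b = (C.card : ℂ) • y := by
    rw [← sub_eq_zero]
    have hdZ : ∑ b ∈ C, u b - (C.card : ℂ) • y ∈ Z := sub_mem hAZ (vn_smul_mem Z _ hyZ)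
    have hconst : ∀ z ∈ Z, ∀ b ∈ C, τ (star z * u b) = τ (star z * y) := by
      intro z hz b hb
      obtain ⟨g, rfl⟩ := (hCmem b).1 hb
      have h1 := hy z hz
      rw [← tau_star_mul, ← tau_star_mul] at h1
      rw [← h1]
      have h2 : star z * u (g * a * g⁻¹) = u g * (star z * u a * u g⁻¹) := by
        rw [u_mul, u_mul, ← mul_assoc, ← mul_assoc, ← hZc _ (star_mem hz) _ (u_mem g)]
        simp only [mul_assoc]
      change τ (star z * u (g * a * g⁻¹)) = _
      rw [h2, tau_comm (u_mem g) (mul_mem (mul_mem (hZM (star_mem hz)) (u_mem a)) (u_mem _)),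
        mul_assoc, ← u_mul, inv_mul_cancel, u_one, mul_one]
    have hzero : ∀ z ∈ Z, τ (star z * (∑ b ∈ C, u b - (C.card : ℂ) • y)) = 0 := by
      intro z hz
      rw [mul_sub, Finset.mul_sum, tau_sub, tau_sum, Finset.sum_congr rfl (hconst z hz),
        Finset.sum_const, mul_smul_comm, tau_smul, nsmul_eq_mul, sub_self]
    exact eq_zero_of_tau (hZM hdZ) (hzero _ hdZ)
  have hgrow := card_le_norm_sum_u (S := C) fun b hb c _ => by
    simpa using (hCc c⁻¹ b).1 hb
  have hCpos : (0 : ℝ) < C.card := by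
    exact_mod_cast Finset.card_pos.2 ⟨a, (hCmem a).2 ⟨1, by simp⟩⟩
  rw [hAy, norm_smul, Complex.norm_natCast] at hgrow
  have hτ : 1 ≤ ‖τ v‖ := ((le_mul_iff_one_le_right hCpos).1 hgrow).trans hyn
  -- Equality in Cauchy-Schwarz: vδ_1 is a unit vector with inner product of modulus at least 1 with
  -- δ_1.
  have hv1 : v (delta 1) = τ v • delta 1 := by
    rw [← sub_eq_zero, ← norm_le_zero_iff]
    have h1 : ‖v (delta 1) - τ v • delta 1‖ ^ 2 = 1 - ‖τ v‖ ^ 2 := by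
      have h3 : RCLike.re (inner ℂ (v (delta 1)) (τ v • delta 1)) = ‖τ v‖ ^ 2 := by
        rw [inner_smul_right, ← inner_conj_symm, ← tau_eq, Complex.mul_conj, ← Complex.sq_norm]
        exact Complex.ofReal_re _
      rw [@norm_sub_sq ℂ, h3, norm_apply_of_mem_unitary hvu, norm_smul, norm_delta]
      ring
    have h2 : ‖v (delta 1) - τ v • delta 1‖ ^ 2 ≤ 0 := by nlinarith
    nlinarith [norm_nonneg (v (delta 1) - τ v • delta 1)]
  have hv2 : v = τ v • 1 := ext_of_mem hvM (vn_smul_mem _ _ (one_mem _)) (by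
    rw [hv1, smul_apply, one_apply_eq_self])
  rw [hvw, hv2, smul_mul_assoc, one_mul]
  exact vn_smul_mem _ _ hwB

end Finite

end

/-! ### Finiteness of the FC-centre -/

section

section Finite

variable {Γ : Type*} [Group Γ]

theorem sum_u_ne_zero {C : Finset Γ} (hC : C.Nonempty) : ∑ b ∈ C, u b ≠ 0 := by
  intro h
  have h1 := norm_sum_delta_sq C
  have h2 : ∑ g ∈ C, delta g = (∑ b ∈ C, u b) (delta 1) := by
    rw [sum_apply]
    exact Finset.sum_congr rfl fun g _ => by rw [u_delta, mul_one]
  rw [h2, h, zero_apply, norm_zero, zero_pow two_ne_zero] at h1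
  exact hC.card_pos.ne (by exact_mod_cast h1)

/-- The projection `|K|⁻¹ ∑_{k ∈ K} u_k` of a finite subgroup `K`. -/
theorem exists_projection_of_finite (K : Subgroup Γ) [hK : K.Normal] (hfin : (K : Set Γ).Finite) :
    ∃ e : Ell2 Γ →L[ℂ] Ell2 Γ, e ∈ Submodule.span ℂ (u '' (K : Set Γ)) ∧ IsStarProjection e ∧
      e ≠ 0 ∧ (∀ g, u g * e = e * u g) ∧ ∀ k ∈ K, e * u k = e := by
  set C := hfin.toFinset with hC
  have hmem : ∀ x, x ∈ C ↔ x ∈ K := fun x => hfin.mem_toFinset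
  set V := ∑ b ∈ C, u b with hV
  have hne : C.Nonempty := ⟨1, (hmem 1).2 K.one_mem⟩
  have hc : (C.card : ℂ) ≠ 0 := by exact_mod_cast hne.card_pos.ne'
  have hVk : ∀ k ∈ K, V * u k = V := fun k hk => by
    rw [hV, Finset.sum_mul]
    refine Finset.sum_bij (fun x _ => x * k) (fun x hx => (hmem _).2 (K.mul_mem ((hmem x).1 hx) hk))
      (fun x _ y _ h => mul_right_cancel h)
      (fun y hy => ⟨y * k⁻¹, (hmem _).2 (K.mul_mem ((hmem y).1 hy) (K.inv_mem hk)), by group⟩)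
      fun x _ => (u_mul x k).symm
  have hVs : star V = V := by
    rw [hV, star_sum]
    refine Finset.sum_bij (fun x _ => x⁻¹) (fun x hx => (hmem _).2 (K.inv_mem ((hmem x).1 hx)))
      (fun x _ y _ h => inv_injective h)
      (fun y hy => ⟨y⁻¹, (hmem _).2 (K.inv_mem ((hmem y).1 hy)), inv_inv y⟩) fun x _ => u_star x
  have hVV : V * V = (C.card : ℂ) • V := by
    nth_rewrite 2 [hV]
    rw [Finset.mul_sum, Finset.sum_congr rfl fun k hk => hVk k ((hmem k).1 hk), Finset.sum_const,
      Nat.cast_smul_eq_nsmul]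
  refine ⟨(C.card : ℂ)⁻¹ • V, Submodule.smul_mem _ _ (Submodule.sum_mem _ fun b hb =>
    Submodule.subset_span ⟨b, (hmem b).1 hb, rfl⟩), ⟨?_, ?_⟩, ?_, fun g => ?_, fun k hk => ?_⟩
  · rw [IsIdempotentElem, smul_mul_smul_comm, hVV, smul_smul, mul_assoc, inv_mul_cancel₀ hc, mul_one]
  · rw [IsSelfAdjoint, star_smul, hVs, star_inv₀, Complex.star_def, Complex.conj_natCast]
  · exact smul_ne_zero (inv_ne_zero hc) (sum_u_ne_zero hne)
  · rw [mul_smul_comm, smul_mul_assoc, hV, u_mul_sum_conj fun x => ?_]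
    rw [hmem, hmem]
    exact ⟨fun h => hK.conj_mem x h g, fun h => by
      have := hK.conj_mem _ h g⁻¹
      simpa [mul_assoc] using this⟩
  · rw [smul_mul_assoc, hVk k hk]

theorem fcSubgroup_normal : (fcSubgroup Γ).Normal := by
  refine ⟨fun a ha g => ?_⟩
  refine Set.Finite.subset ha ?_
  rintro _ ⟨h, rfl⟩
  exact ⟨h * g, by simp only; group⟩

/-- If the relative commutant of `N` is atomic then only finitely many elements of the group have a
finite conjugacy class. -/
theorem finite_fcSubgroup {N : VonNeumannAlgebra (Ell2 Γ)} (hN : N ≤ LG Γ)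
    (hf : IsFactor N) (hΓ : ∀ γ : Γ, ∀ x ∈ N, u γ * x * u γ⁻¹ ∈ N)
    (hat : ∀ p ∈ relCommutant N (LG Γ), IsStarProjection p → p ≠ 0 →
      ∃ q, IsMinProj (relCommutant N (LG Γ)) q ∧ p * q = q) :
    (fcSubgroup Γ : Set Γ).Finite := by
  by_contra hinf
  have hBM := relCommutant_le N (LG Γ)
  have hΛ := innerSubgroup_normal hΓ
  have hF := fcSubgroup_normal (Γ := Γ)
  have hKn : (fcSubgroup Γ ⊓ innerSubgroup N).Normal := inferInstance
  have hKB : ∀ a ∈ fcSubgroup Γ ⊓ innerSubgroup N, u a ∈ relCommutant N (LG Γ) := fun a ha =>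
    u_mem_relCommutant_of_finite hN hf ha.2 ha.1
  -- Let K be the intersection of the FC-centre with Λ. If K is infinite, N' ∩ L(Γ) contains
  -- infinitely many u_a, and no minimal projection can exist. If K is finite, the averaging
  -- projection e of K plays the role of a unit.
  by_cases hK : ((fcSubgroup Γ ⊓ innerSubgroup N : Subgroup Γ) : Set Γ).Finite
  · obtain ⟨e, heK, hep, he0, heu, hek⟩ := exists_projection_of_finite _ hK
    have heB : e ∈ relCommutant N (LG Γ) := by
      refine Submodule.span_induction (p := fun x _ => x ∈ relCommutant N (LG Γ)) ?_ (zero_mem _)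
        (fun _ _ _ _ => add_mem) (fun c _ _ => vn_smul_mem _ c) heK
      rintro _ ⟨a, ha, rfl⟩
      exact hKB a ha
    obtain ⟨q, hq, heq⟩ := hat e heB hep he0
    refine hq.false_of_infinite hBM hinf fun a ha => ⟨e * u a, ?_, ?_⟩
    · refine mem_relCommutant.2 ⟨mul_mem (hBM heB) (u_mem a), fun x hx => ?_⟩
      refine mem_commutant_L (Λ := innerSubgroup N) (fun l hl => ?_) (le_L_innerSubgroup hN hf hΓ hx)
      -- The commutator of l in Λ and a in the FC-centre lies in K and is absorbed by e. So e u_a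
      -- commutes with L(Λ) ⊇ N for every a in the FC-centre.
      have h1 : l * a = (l * a * l⁻¹ * a⁻¹) * (a * l) := by group
      have h2 : l * a * l⁻¹ * a⁻¹ ∈ fcSubgroup Γ ⊓ innerSubgroup N :=
        ⟨(fcSubgroup Γ).mul_mem (hF.conj_mem a ha l) ((fcSubgroup Γ).inv_mem ha), by
          have := (innerSubgroup N).mul_mem hl (hΛ.conj_mem _ ((innerSubgroup N).inv_mem hl) a)
          rwa [← mul_assoc, ← mul_assoc] at this⟩
      rw [← mul_assoc, heu, mul_assoc, ← u_mul, h1, u_mul, ← mul_assoc, hek _ h2, u_mul, mul_assoc]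
    · nth_rewrite 1 [← heq]
      rw [← mul_assoc, heu]
  · have h1 : (1 : Ell2 Γ →L[ℂ] Ell2 Γ) ≠ 0 := fun h => by
      have h2 := norm_delta (1 : Γ)
      have h3 : delta (1 : Γ) = 0 := congrArg (fun x : Ell2 Γ →L[ℂ] Ell2 Γ => x (delta 1)) h
      rw [h3, norm_zero] at h2
      exact zero_ne_one h2
    obtain ⟨q, hq, -⟩ := hat 1 (one_mem _) (.one _) h1
    exact hq.false_of_infinite hBM hK fun a ha => ⟨u a, hKB a ha, rfl⟩

end Finite

end

/-! ### Atomic invariant algebras are finite dimensional when the FC-centre is finite -/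

section

section Center

variable {H : Type*} [NormedAddCommGroup H] [InnerProductSpace ℂ H] [CompleteSpace H]

theorem IsMinProj.mul_eq_zero_of_ne {D : VonNeumannAlgebra H} {p q : H →L[ℂ] H}
    (hp : IsMinProj D p) (hq : IsMinProj D q) (hpq : p * q = q * p) (hne : p ≠ q) :
    p * q = 0 := by
  have h := hp.2.1.mul hq.2.1 hpq
  by_contra h0
  have h1 := (hp.2.2.2 _ (mul_mem hp.1 hq.1) h
    (by rw [← mul_assoc, hp.2.1.isIdempotentElem])).resolve_left h0
  have h2 := (hq.2.2.2 _ (mul_mem hp.1 hq.1) h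
    (by rw [hpq, ← mul_assoc, hq.2.1.isIdempotentElem])).resolve_left h0
  exact hne (h1.symm.trans h2)

theorem IsMinProj.conj {D : VonNeumannAlgebra H} {q U : H →L[ℂ] H} (hq : IsMinProj D q)
    (hU : U ∈ unitary (H →L[ℂ] H)) (h1 : ∀ x ∈ D, U * x * star U ∈ D)
    (h2 : ∀ x ∈ D, star U * x * U ∈ D) : IsMinProj D (U * q * star U) := by
  have hc : ∀ x, star U * (U * x * star U) * U = x := fun x => by
    rw [mul_assoc U, ← mul_assoc, hU.1, one_mul, mul_assoc, hU.1, mul_one]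
  have hc' : ∀ x, U * (star U * x * U) * star U = x := fun x => by
    rw [mul_assoc (star U), ← mul_assoc, hU.2, one_mul, mul_assoc, hU.2, mul_one]
  have hmul : ∀ x y, star U * x * U * (star U * y * U) = star U * (x * y) * U := fun x y => by
    calc _ = star U * x * (U * star U) * y * U := by simp only [mul_assoc]
      _ = _ := by rw [hU.2, mul_one, mul_assoc (star U)]
  have hmul' : ∀ x y, U * x * star U * (U * y * star U) = U * (x * y) * star U := fun x y => by
    calc _ = U * x * (star U * U) * y * star U := by simp only [mul_assoc]
      _ = _ := by rw [hU.1, mul_one, mul_assoc U]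
  refine ⟨h1 q hq.1, ⟨?_, ?_⟩, fun h0 => hq.2.2.1 ?_, fun r hr hrp hqr => ?_⟩
  · rw [IsIdempotentElem, hmul', hq.2.1.isIdempotentElem]
  · rw [IsSelfAdjoint, star_mul, star_mul, star_star, hq.2.1.isSelfAdjoint.star_eq, mul_assoc]
  · rw [← hc q, h0, mul_zero, zero_mul]
  · have hr' : IsStarProjection (star U * r * U) := by
      refine ⟨?_, ?_⟩
      · rw [IsIdempotentElem, hmul, hrp.isIdempotentElem]
      · rw [IsSelfAdjoint, star_mul, star_mul, star_star, hrp.isSelfAdjoint.star_eq, mul_assoc]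
    rcases hq.2.2.2 _ (h2 r hr) hr' (by nth_rewrite 1 [← hc q]; rw [hmul, hqr]) with h | h
    · left; rw [← hc' r, h, mul_zero, zero_mul]
    · right; rw [← hc' r, h]

theorem isStarProjection_sum {ι : Type*} (s : Finset ι) (z : ι → H →L[ℂ] H)
    (hp : ∀ i ∈ s, IsStarProjection (z i))
    (ho : ∀ i ∈ s, ∀ j ∈ s, i ≠ j → z i * z j = 0) : IsStarProjection (∑ i ∈ s, z i) := by
  classical
  refine ⟨?_, ?_⟩
  · rw [IsIdempotentElem, Finset.sum_mul_sum]
    refine Finset.sum_congr rfl fun i hi => ?_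
    rw [Finset.sum_eq_single i (fun j hj hji => ho i hi j hj hji.symm) (fun h => absurd hi h)]
    exact (hp i hi).isIdempotentElem
  · rw [IsSelfAdjoint, star_sum]
    exact Finset.sum_congr rfl fun i hi => (hp i hi).isSelfAdjoint

end Center

section Finite

variable {Γ : Type*}

theorem finite_setOf_le_norm (ξ : Ell2 Γ) {ε : ℝ} (hε : 0 < ε) : {a | ε ≤ ‖ξ a‖}.Finite := by
  have h2 : 0 < (2 : ENNReal).toReal := by norm_num
  have h1 := ((lp.memℓp ξ).summable h2).tendsto_cofinite_zero
  have h3 := (Metric.tendsto_nhds.1 h1 (ε ^ (2 : ENNReal).toReal) (by positivity))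
  refine Set.Finite.subset h3 fun a ha hlt => ?_
  change dist (‖ξ a‖ ^ (2 : ENNReal).toReal) 0 < _ at hlt
  rw [dist_zero_right, Real.norm_of_nonneg (by positivity)] at hlt
  exact absurd ((Real.rpow_lt_rpow_iff (norm_nonneg _) hε.le h2).1 hlt) (not_lt.2 ha)

theorem mem_span_delta {F : Set Γ} (hF : F.Finite) {ξ : Ell2 Γ} (h : ∀ a ∉ F, ξ a = 0) :
    ξ ∈ Submodule.span ℂ (delta '' F) := by
  classical
  have h1 : ξ = ∑ a ∈ hF.toFinset, ξ a • delta a := by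
    refine ext_delta fun b => ?_
    rw [inner_delta, inner_sum]
    by_cases hb : b ∈ F
    · rw [Finset.sum_eq_single b, inner_smul_right, inner_delta_delta_self, mul_one]
      · exact fun a _ hab => by rw [inner_smul_right, inner_delta_delta_ne hab.symm, mul_zero]
      · exact fun h => absurd (hF.mem_toFinset.2 hb) h
    · rw [h b hb, Finset.sum_eq_zero fun a ha => ?_]
      rw [inner_smul_right, inner_delta_delta_ne, mul_zero]
      rintro rfl
      exact hb (hF.mem_toFinset.1 ha)
  rw [h1]
  exact Submodule.sum_mem _ fun a ha => Submodule.smul_mem _ _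
    (Submodule.subset_span ⟨a, hF.mem_toFinset.1 ha, rfl⟩)

variable [Group Γ]

/-- The central support of a minimal projection is a minimal projection of the center. -/
theorem IsMinProj.exists_central {D : VonNeumannAlgebra (Ell2 Γ)} (hD : D ≤ LG Γ)
    {q : Ell2 Γ →L[ℂ] Ell2 Γ} (h : IsMinProj D q) :
    ∃ z, IsMinProj (relCommutant D D) z ∧ z * q = q ∧
      ∃ W : Submodule ℂ (Ell2 Γ →L[ℂ] Ell2 Γ), FiniteDimensional ℂ W ∧ ∀ x ∈ D, x * z ∈ W := by
  obtain ⟨n, v, hv, hvq, horth, hspan⟩ := h.exists_matrix_units hD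
  obtain ⟨hzc, hzq, hzW⟩ := h.central_support hD hv hvq horth hspan
  have hzp := (card_mul_le_one h.2.1 v (fun i => hD (hv i)) hvq horth).2
  have hzD : ∑ i, v i * star (v i) ∈ D := sum_mem fun i _ => mul_mem (hv i) (star_mem (hv i))
  refine ⟨∑ i, v i * star (v i), ⟨mem_relCommutant.2 ⟨hzD, hzc⟩, hzp, fun h0 => h.2.2.1 ?_,
    fun c hc hcp hzcc => ?_⟩, hzq, _, FiniteDimensional.span_of_finite ℂ (Set.finite_range _), hzW⟩
  · rw [← hzq, h0, zero_mul]
  · obtain ⟨hcD, hcc⟩ := mem_relCommutant.1 hc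
    have hqc := hcc q h.1
    have hcv : ∀ i, c * v i = v i * (q * c) := fun i => by
      rw [← mul_assoc, hvq, hcc _ (hv i)]
    have hcz : c * ∑ i, v i * star (v i) = c := by rw [← hcc _ hzD, hzcc]
    rcases h.2.2.2 _ (mul_mem h.1 hcD) (h.2.1.mul hcp hqc)
      (by rw [← mul_assoc, h.2.1.isIdempotentElem]) with h0 | h0
    · left
      rw [← hcz, Finset.mul_sum]
      exact Finset.sum_eq_zero fun i _ => by rw [← mul_assoc, hcv, h0, mul_zero, zero_mul]
    · right
      rw [← hcz, Finset.mul_sum]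
      exact Finset.sum_congr rfl fun i _ => by rw [← mul_assoc, hcv, h0, hvq]

/-- There are only finitely many pairwise orthogonal projections of a given positive trace. -/
theorem finite_of_tau_eq {O : Set (Ell2 Γ →L[ℂ] Ell2 Γ)} (hp : ∀ z ∈ O, IsStarProjection z)
    (ho : ∀ z ∈ O, ∀ w ∈ O, z ≠ w → z * w = 0) {t : ℝ} (ht : 0 < t) (hτ : ∀ z ∈ O, τ z = t) :
    O.Finite := by
  by_contra hinf
  obtain ⟨n, hn⟩ := exists_nat_gt (1 / t)
  obtain ⟨s, hs, hsn⟩ := Set.Infinite.exists_subset_card_eq hinf n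
  have h1 := isStarProjection_sum s id (fun z hz => hp z (hs hz))
    fun z hz w hw => ho z (hs hz) w (hs hw)
  have h2 := tau_projection h1
  have h5 : ∑ z ∈ s, τ (id z) = ∑ _z ∈ s, (t : ℂ) := Finset.sum_congr rfl fun z hz => hτ z (hs hz)
  rw [tau_sum, h5, Finset.sum_const, hsn, nsmul_eq_mul] at h2
  have h3 := norm_projection_le h1
  have h4 : (n : ℝ) * t ≤ 1 := by
    have h5 : (n : ℝ) * t = ‖(∑ z ∈ s, id z) (delta 1)‖ ^ 2 := by exact_mod_cast h2
    rw [h5]; exact h3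
  rw [div_lt_iff₀ ht] at hn
  linarith

theorem conj_apply_delta {x : Ell2 Γ →L[ℂ] Ell2 Γ} (hx : x ∈ LG Γ) (g a : Γ) :
    (u g * x * u g⁻¹) (delta 1) (g * a * g⁻¹) = x (delta 1) a := by
  rw [mul_apply_eq_comp, mul_apply_eq_comp, u_delta, mul_one, u_apply, apply_delta hx, rho_apply]
  group

/-- An element with finitely many conjugates is supported on the elements with finitely many
conjugates. -/
theorem apply_eq_zero_of_finite_orbit {z : Ell2 Γ →L[ℂ] Ell2 Γ} (hz : z ∈ LG Γ)
    (hfin : (Set.range fun g : Γ => u g * z * u g⁻¹).Finite) {a : Γ} (ha : a ∉ fcSubgroup Γ) :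
    z (delta 1) a = 0 := by
  by_contra h0
  -- Each conjugate of a is a point where one of the finitely many conjugates of zδ_1 has modulus
  -- |z(a)| > 0; an `ℓ²` vector has finitely many such points.
  refine ha ((hfin.biUnion fun x _ =>
    finite_setOf_le_norm (x (delta 1)) (norm_pos_iff.2 h0)).subset ?_)
  rintro _ ⟨g, rfl⟩
  refine Set.mem_biUnion ⟨g, rfl⟩ ?_
  change ‖z (delta 1) a‖ ≤ ‖(u g * z * u g⁻¹) (delta 1) (g * a * g⁻¹)‖
  rw [conj_apply_delta hz]

theorem conj_mem_relCommutant_self {D : VonNeumannAlgebra (Ell2 Γ)}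
    (hD : ∀ γ : Γ, ∀ x ∈ D, u γ * x * u γ⁻¹ ∈ D) (γ : Γ) {x : Ell2 Γ →L[ℂ] Ell2 Γ}
    (hx : x ∈ relCommutant D D) : u γ * x * u γ⁻¹ ∈ relCommutant D D :=
  ⟨conj_mem_commutant hD γ hx.1, hD γ x hx.2⟩

/-- An atomic algebra normalized by a group with finite FC-center is finite dimensional. -/
theorem isFinDim_of_finite_fcSubgroup {D : VonNeumannAlgebra (Ell2 Γ)} (hD : D ≤ LG Γ)
    (hDΓ : ∀ γ : Γ, ∀ x ∈ D, u γ * x * u γ⁻¹ ∈ D)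
    (hat : ∀ p ∈ D, IsStarProjection p → p ≠ 0 → ∃ q, IsMinProj D q ∧ p * q = q)
    (hF : (fcSubgroup Γ : Set Γ).Finite) : IsFinDim D := by
  classical
  set Z := relCommutant D D with hZ
  have hZD : Z ≤ D := relCommutant_le _ _
  have hZc : ∀ z ∈ Z, ∀ x ∈ D, x * z = z * x := fun z hz => (mem_relCommutant.1 hz).2
  set A : Set (Ell2 Γ →L[ℂ] Ell2 Γ) := {z | IsMinProj Z z ∧
    ∃ W : Submodule ℂ (Ell2 Γ →L[ℂ] Ell2 Γ), FiniteDimensional ℂ W ∧ ∀ x ∈ D, x * z ∈ W} with hA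
  have horth : ∀ z w, IsMinProj Z z → IsMinProj Z w → z ≠ w → z * w = 0 := fun z w hz hw hne =>
    hz.mul_eq_zero_of_ne hw (hZc w hw.1 z (hZD hz.1)) hne
  have horbit : ∀ z, IsMinProj Z z → (Set.range fun g : Γ => u g * z * u g⁻¹).Finite := by
    intro z hz
    have hzM := hD (hZD hz.1)
    have hmin : ∀ g, IsMinProj Z (u g * z * u g⁻¹) := fun g => by
      rw [← u_star]
      refine hz.conj (u_mem_unitary g) (fun x hx => ?_) fun x hx => ?_
      · rw [u_star]; exact conj_mem_relCommutant_self hDΓ g hx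
      · have := conj_mem_relCommutant_self hDΓ g⁻¹ hx
        rwa [inv_inv, ← u_star] at this
    have hpos := norm_projection_pos hzM hz.2.2.1
    refine finite_of_tau_eq (t := ‖z (delta 1)‖ ^ 2) ?_ ?_ (by positivity) ?_
    · rintro _ ⟨g, rfl⟩; exact (hmin g).2.1
    · rintro _ ⟨g, rfl⟩ _ ⟨h, rfl⟩ hne
      exact horth _ _ (hmin g) (hmin h) hne
    · rintro _ ⟨g, rfl⟩
      change τ (u g * z * u g⁻¹) = _
      rw [mul_assoc, tau_comm (u_mem g) (mul_mem hzM (u_mem _)), mul_assoc, ← u_mul,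
        inv_mul_cancel, u_one, mul_one, tau_projection hz.2.1]
  -- The vectors zδ_1 are nonzero, pairwise orthogonal and supported on the finite FC-centre.
  have hAfin : A.Finite := by
    have : FiniteDimensional ℂ (Submodule.span ℂ (delta '' (fcSubgroup Γ : Set Γ))) :=
      FiniteDimensional.span_of_finite ℂ (hF.image _)
    have hmem : ∀ z : A, z.1 (delta 1) ∈ Submodule.span ℂ (delta '' (fcSubgroup Γ : Set Γ)) :=
      fun z => mem_span_delta hF fun a ha =>
        apply_eq_zero_of_finite_orbit (hD (hZD z.2.1.1)) (horbit z.1 z.2.1) ha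
    have hli : LinearIndependent ℂ fun z : A => z.1 (delta 1) := by
      refine linearIndependent_of_ne_zero_of_inner_eq_zero (fun z hz => ?_) fun z w hzw => ?_
      · exact (norm_projection_pos (hD (hZD z.2.1.1)) z.2.1.2.2.1).ne' (by rw [hz, norm_zero])
      · change inner ℂ (z.1 (delta 1)) (w.1 (delta 1)) = 0
        rw [← tau_star_mul, z.2.1.2.1.isSelfAdjoint.star_eq,
          horth _ _ z.2.1 w.2.1 (fun h => hzw (Subtype.ext h)), tau_zero]
    have hli2 : LinearIndependent ℂ fun z : A =>
        (⟨z.1 (delta 1), hmem z⟩ : Submodule.span ℂ (delta '' (fcSubgroup Γ : Set Γ))) :=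
      LinearIndependent.of_comp (Submodule.subtype _) hli
    exact Set.finite_coe_iff.1 hli2.finite_of_isNoetherian
  choose W hW hAW using fun z : A => z.2.2
  set P := ∑ z ∈ hAfin.toFinset, z with hP
  have hmem : ∀ z, z ∈ hAfin.toFinset ↔ z ∈ A := fun z => hAfin.mem_toFinset
  have hPp : IsStarProjection P := isStarProjection_sum _ _ (fun z hz => ((hmem z).1 hz).1.2.1)
    fun z hz w hw => horth z w ((hmem z).1 hz).1 ((hmem w).1 hw).1
  have hPD : P ∈ D := sum_mem fun z hz => hZD ((hmem z).1 hz).1.1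
  -- Otherwise atomicity gives a minimal q under 1 − P, but the central support of q is one of the
  -- summands of P.
  have hP1 : 1 - P = 0 := by
    by_contra h0
    obtain ⟨q, hq, hPq⟩ := hat (1 - P) (sub_mem (one_mem D) hPD) hPp.one_sub h0
    obtain ⟨z, hz, hzq, hzW⟩ := hq.exists_central hD
    have hPz : P * z = z := by
      rw [hP, Finset.sum_mul, Finset.sum_eq_single z, hz.2.1.isIdempotentElem]
      · exact fun w hw hwz => horth w z ((hmem w).1 hw).1 hz hwz
      · exact fun h => absurd ((hmem z).2 ⟨hz, hzW⟩) h
    have hPq' : P * q = q := by rw [← hzq, ← mul_assoc, hPz]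
    rw [sub_mul, one_mul, hPq', sub_self] at hPq
    exact hq.2.2.1 hPq.symm
  have : Finite A := hAfin
  have hWfd : ∀ z, FiniteDimensional ℂ (W z) := hW
  refine isFinDim_of_subset D (⨆ z, W z) fun x hx => ?_
  rw [← mul_one x, ← sub_add_cancel 1 P, hP1, zero_add, hP, Finset.mul_sum]
  exact Submodule.sum_mem _ fun z hz =>
    Submodule.mem_iSup_of_mem (⟨z, (hmem z).1 hz⟩ : A) (hAW ⟨z, (hmem z).1 hz⟩ x hx)

end Finite

end

/-! ### Finite dimensionality of the relative commutant and conclusion -/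

section

section Main

variable {Γ : Type*} [Group Γ]

theorem isFinDim_LG_of_finite [Finite Γ] : IsFinDim (LG Γ) := by
  classical
  have := Fintype.ofFinite Γ
  have : FiniteDimensional ℂ (Submodule.span ℂ (Set.range (u : Γ → _))) :=
    FiniteDimensional.span_of_finite ℂ (Set.finite_range _)
  refine isFinDim_of_subset _ (Submodule.span ℂ (Set.range u)) fun x hx => ?_
  have h1 : x = ∑ a, x (delta 1) a • u a := by
    refine ext_of_mem hx (sum_mem fun a _ => vn_smul_mem _ _ (u_mem a)) (ext_delta fun b => ?_)
    rw [inner_delta, sum_apply, inner_sum, Finset.sum_eq_single b]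
    · rw [smul_apply, u_delta, mul_one, inner_smul_right, inner_delta_delta_self, mul_one]
    · intro a _ hab
      rw [smul_apply, u_delta, mul_one, inner_smul_right, inner_delta_delta_ne hab.symm, mul_zero]
    · exact fun h => absurd (Finset.mem_univ b) h
  rw [h1]
  exact Submodule.sum_mem _ fun a _ => Submodule.smul_mem _ _ (Submodule.subset_span ⟨a, rfl⟩)

theorem isFinDim_L_bot : IsFinDim (L (⊥ : Subgroup Γ)) := by
  have : FiniteDimensional ℂ (Submodule.span ℂ {(1 : Ell2 Γ →L[ℂ] Ell2 Γ)}) :=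
    FiniteDimensional.span_of_finite ℂ (Set.finite_singleton _)
  refine isFinDim_of_subset _ (Submodule.span ℂ {1}) fun x hx => ?_
  refine Submodule.mem_span_singleton.2 ⟨x (delta 1) 1, ?_⟩
  refine ext_of_mem (vn_smul_mem _ _ (one_mem _)) (L_le _ hx) (ext_delta fun b => ?_)
  rw [smul_apply, one_apply_eq_self, inner_smul_right]
  by_cases hb : b = 1
  · rw [hb, inner_delta_delta_self, mul_one, inner_delta]
  · rw [inner_delta_delta_ne hb, mul_zero, inner_delta]
    exact (coeff_eq_zero_of_mem_L hx (by rwa [Subgroup.mem_bot])).symm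

/-- The relative commutant of a nonamenable `Γ`-invariant factor is finite dimensional when the
diffuse amenable subalgebras of `L(Γ)` have their relative commutant in an amenable algebra. -/
theorem isFinDim_relCommutant {N : VonNeumannAlgebra (Ell2 Γ)} (hN : N ≤ LG Γ)
    (hf : IsFactor N) (hΓ : ∀ γ : Γ, ∀ x ∈ N, u γ * x * u γ⁻¹ ∈ N) (hNa : ¬ IsAmenable N)
    (hS : ∀ A : VonNeumannAlgebra (Ell2 Γ), A ≤ LG Γ → IsDiffuse A → IsAmenable A →
      ∃ G : VonNeumannAlgebra (Ell2 Γ), G ≤ LG Γ ∧ IsAmenable G ∧ relCommutant A (LG Γ) ≤ G) :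
    IsFinDim (relCommutant N (LG Γ)) := by
  -- The atomicity argument needs L(Γ) diffuse, that is, Γ infinite.
  rcases finite_or_infinite Γ with hfin | hinf
  · exact isFinDim_of_le (relCommutant_le _ _) isFinDim_LG_of_finite
  have hat : ∀ p ∈ relCommutant N (LG Γ), IsStarProjection p → p ≠ 0 →
      ∃ q, IsMinProj (relCommutant N (LG Γ)) q ∧ p * q = q :=
    fun p hp hpp hp0 => exists_isMinProj_le hN hf hNa hS hp hpp hp0
  refine isFinDim_of_finite_fcSubgroup (relCommutant_le _ _) (fun γ x hx => ?_) hat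
    (finite_fcSubgroup hN hf hΓ hat)
  exact ⟨conj_mem_commutant hΓ γ hx.1, mul_mem (mul_mem (u_mem γ) hx.2) (u_mem _)⟩

end Main

end

end GroupVN

theorem mainTheorem10 {Γ : Type*} [Group Γ] [Countable Γ]
    (N : VonNeumannAlgebra (GroupVN.Ell2 Γ))
    (hNM : N ≤ GroupVN.LG Γ) (hN : GroupVN.IsFactor N)
    (hΓ : ∀ γ : Γ, GroupVN.u γ ∈ GroupVN.normalizer N (GroupVN.LG Γ)) :
    (∃ Λ : Subgroup Γ, Λ.Normal ∧
      N ≤ GroupVN.L Λ ∧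
      GroupVN.L Λ ≤ GroupVN.join N (GroupVN.relCommutant N (GroupVN.LG Γ)) ∧
      (GroupVN.IsFinDim (GroupVN.relCommutant N (GroupVN.LG Γ)) →
        GroupVN.HasFiniteIndex N (GroupVN.L Λ) ∧
        GroupVN.HasFiniteIndex (GroupVN.L Λ)
          (GroupVN.join N (GroupVN.relCommutant N (GroupVN.LG Γ)))) ∧
      (GroupVN.IsTrivial (GroupVN.relCommutant N (GroupVN.LG Γ)) → N = GroupVN.L Λ) ∧
      (GroupVN.IsSolid (GroupVN.LG Γ) →
        GroupVN.IsAmenable N ∨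
        (GroupVN.HasFiniteIndex N (GroupVN.L Λ) ∧
          GroupVN.HasFiniteIndex (GroupVN.L Λ)
            (GroupVN.join N (GroupVN.relCommutant N (GroupVN.LG Γ))))) ∧
      (¬ GroupVN.IsAmenable (GroupVN.LG Γ) → GroupVN.IsStronglySolid (GroupVN.LG Γ) →
        GroupVN.IsFinDim N ∨
        (GroupVN.HasFiniteIndex N (GroupVN.L Λ) ∧
          GroupVN.HasFiniteIndex (GroupVN.L Λ)
            (GroupVN.join N (GroupVN.relCommutant N (GroupVN.L Λ)))))) ∧
    (IsSimpleGroup Γ → GroupVN.IsPrimeFactor (GroupVN.LG Γ) →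
      GroupVN.IsFinDim N ∨ GroupVN.HasFiniteIndex N (GroupVN.LG Γ)) := by
  have hinv : ∀ γ : Γ, ∀ x ∈ N, GroupVN.u γ * x * GroupVN.u γ⁻¹ ∈ N := fun γ x hx =>
    GroupVN.conj_mem_of_normalizer (hΓ γ) hx
  have hNL := GroupVN.le_L_innerSubgroup hNM hN hinv
  have hLeq := GroupVN.L_innerSubgroup_eq hNL
  have hnormal := GroupVN.innerSubgroup_normal hinv
  set Λ := GroupVN.innerSubgroup N
  set B := GroupVN.relCommutant N (GroupVN.LG Γ) with hB
  have hCB : GroupVN.relCommutant N (GroupVN.L Λ) ≤ B :=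
    GroupVN.relCommutant_mono N (GroupVN.L_le Λ)
  have hLB : GroupVN.L Λ ≤ GroupVN.join N B := hLeq.le.trans (GroupVN.join_mono_right N hCB)
  -- The base algebra N is recovered as the join of N with its own centre.
  have hself : ∀ C : VonNeumannAlgebra (GroupVN.Ell2 Γ), C ≤ B → GroupVN.IsFinDim C →
      GroupVN.relCommutant N N ≤ C → GroupVN.HasFiniteIndex N (GroupVN.join N C) := by
    intro C hC hfd hle
    have h := GroupVN.hasFiniteIndex_join hNM hN hle hC hfd
    rwa [GroupVN.join_relCommutant_self] at h
  have hfin : GroupVN.IsFinDim B → GroupVN.HasFiniteIndex N (GroupVN.L Λ) ∧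
      GroupVN.HasFiniteIndex (GroupVN.L Λ) (GroupVN.join N B) := by
    intro hfd
    have h1 := hself _ hCB (GroupVN.isFinDim_of_le hCB hfd) (GroupVN.relCommutant_mono N hNL)
    have h2 := GroupVN.hasFiniteIndex_join hNM hN hCB le_rfl hfd
    rw [← hLeq] at h1 h2
    exact ⟨h1, h2⟩
  refine ⟨⟨Λ, hnormal, hNL, hLB, hfin, fun htriv => le_antisymm hNL ?_, fun hsolid => ?_,
    fun hna hss => ?_⟩, fun hsimple hprime => ?_⟩
  · refine hLB.trans (GroupVN.join_le le_rfl fun x hx => ?_)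
    obtain ⟨c, rfl⟩ := htriv x hx
    exact GroupVN.vn_smul_mem N c (one_mem N)
  · exact or_iff_not_imp_left.2 fun hNa =>
      hfin (GroupVN.isFinDim_relCommutant hNM hN hinv hNa hsolid.exists_isAmenable)
  · by_cases hNa : GroupVN.IsAmenable N
    · left
      by_contra hfd
      -- A factor that is not diffuse has a minimal projection, hence is finite dimensional. A
      -- diffuse amenable N is excluded by strong solidity, since its normalizer contains all u_γ
      -- and generates the nonamenable L(Γ).
      have hdiff : GroupVN.IsDiffuse N := by
        by_contra hd
        obtain ⟨q, hq⟩ := GroupVN.exists_isMinProj_of_not_isDiffuse hd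
        exact hfd (GroupVN.isFinDim_of_isMinProj hNM hN hq)
      have hgen : GroupVN.generated (GroupVN.normalizer N (GroupVN.LG Γ)) = GroupVN.LG Γ := by
        refine le_antisymm (GroupVN.generated_le fun v hv => hv.1) (GroupVN.generated_le ?_)
        rintro _ ⟨γ, -, rfl⟩
        exact GroupVN.subset_generated (hΓ γ)
      exact hna (hgen ▸ hss N hNM hdiff hNa)
    · right
      refine ⟨(hfin (GroupVN.isFinDim_relCommutant hNM hN hinv hNa hss.exists_isAmenable)).1, ?_⟩
      rw [← hLeq]
      exact GroupVN.hasFiniteIndex_self _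
  -- Λ trivial puts N inside the scalars; Λ = Γ makes N and its relative commutant generate L(Γ),
  -- with product trace by independence.
  · rcases hnormal.eq_bot_or_eq_top with h | h
    · left
      rw [h] at hNL
      exact GroupVN.isFinDim_of_le hNL GroupVN.isFinDim_L_bot
    · have hjoin : GroupVN.join N B = GroupVN.LG Γ := by
        rw [h] at hLB
        exact le_antisymm (GroupVN.join_le hNM (GroupVN.relCommutant_le _ _)) hLB
      refine (hprime.2 N B ⟨fun x hx y hy => (GroupVN.mem_relCommutant.1 hy).2 x hx,
        fun x hx y hy => ?_, hjoin⟩).imp id fun hfd => ?_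
      · rw [(GroupVN.mem_relCommutant.1 hy).2 x hx, mul_comm,
          GroupVN.tau_mul_of_mem_relCommutant hNM hN hy hx]
      · have := hself B le_rfl hfd (GroupVN.relCommutant_mono N hNM)
        rwa [hjoin] at this
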